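/- **Setting.** Let $\mathbb{C}_\Delta[z^{\pm1}]$ be the localization of $\mathbb{C}[z^{\pm1}]$ along $\Delta=z-z^{-1}$, let $s(f)(z)=f(z^{-1})$ and $\theta=z\partial_z$. For $k=(k_1,k_2)\in\mathbb{C}^2$ put $\rho(k)=\tfrac12(k_1+2k_2)$ and $$D_k=\theta+\frac{k_1}{1-z^{-1}}(1-s)+\frac{2k_2}{1-z^{-2}}(1-s)-\rho(k).$$ For $\ell\in2\mathbb{Z}\times\mathbb{Z}$, a *non-symmetric shift operator with shift $\ell$* is an element $S\in\mathbb{C}_\Delta[z^{\pm1}]\otimes\mathbb{C}[\theta]\otimes\mathbb{C}[\mathbb{Z}_2]$ that maps $\mathbb{C}[z^{\pm1}]$ into itself and satisfies $S D_k=D_{k+\ell}S$. Let $$\mathcal{G}_+(k)=\frac{1}{z-z^{-1}}\theta-\frac{z(1-s)}{(z-z^{-1})^2},\qquad \mathcal{G}_-(k)=(z-z^{-1})\theta+(k_1+2k_2-1)(z+z^{-1})+2k_1+z^{-1}-zs,$$ $$\mathcal{E}_\pm(k)=\Big(\frac{1+z^{-1}}{1-z^{-1}}\Big)^{\pm1}\Big(\theta\mp\frac{1-s}{z-z^{-1}}\Big)+c_\pm(k),\qquad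 c_+(k)=k_2-\tfrac12,\quad c_-(k)=k_1+k_2-\tfrac12 .$$ These have shifts $(0,\pm1)$ and $(\pm2,\mp1)$. For $\ell=\varepsilon_1N_1(2,-1)+\varepsilon_2N_2(0,1)$ with $N_i\ge0$ and $\varepsilon_i\in\{\pm1\}$, let $\mathcal{G}(\ell,k)$ be the operator obtained by applying first $\mathcal{G}_{\varepsilon_2}(k+\varepsilon_2j(0,1))$ for $j=0,\dots,N_2-1$ and then $\mathcal{E}_{\varepsilon_1}(k+\varepsilon_2N_2(0,1)+\varepsilon_1i(2,-1))$ for $i=0,\dots,N_1-1$. Let $(f,g)_k=\int_{S^1}\overline{f(z)}\,g(z)\,\delta_k(z)\frac{dz}{iz}$ with $\delta_k(z)=(2-z-z^{-1})^{k_1}(2-z^2-z^{-2})^{k_2}$. The integral converges if $\operatorname{Re}(k_1+k_2)>-\tfrac12$ and $\operatorname{Re}k_2>-\tfrac12$; call such $k$ *convergent*. For real convergent $k$ let $(E(n,k))_{n\in\mathbb{Z}}$ be the result of the Gram–Schmidt process for $(\cdot,\cdot)_k$ on the ordered basis $1,z,z^{-1},z^2,z^{-2},\dots$, normalized by $E(n,k)=z^n+$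 lower order terms. For complex $k$ with $k_1+2k_2\notin\{-1,-2,\dots\}$ let $E(n,k)$ be the unique Laurent polynomial $z^n+$ lower order terms with $D_kE(n,k)=\widetilde n\,E(n,k)$, where $\widetilde n=n+\rho(k)$ if $n>0$ and $\widetilde n=n-\rho(k)$ if $n\le0$. For $\lambda=n\epsilon\in P=\mathbb{Z}\epsilon$ put $E(\lambda,k)=E(n,k)$, $\widetilde\lambda=\widetilde n$ and $\lambda^*=|n|\epsilon\in P^+=\mathbb{Z}_{\ge0}\epsilon$. Let $\mathbb{Z}_2=\{1,s\}$ act on $P$ by $s\epsilon=-\epsilon$, let $w^\lambda$ be the shortest element with $\lambda=w^\lambda\lambda^*$, and let $w_\lambda$ be the longest element of the stabilizer of $\lambda$. The shift factors of the fundamental operators are, for $n\ge0$, $$\eta(-n\epsilon,\mathcal{G}_+(k))=\eta((n+1)\epsilon,\mathcal{G}_+(k))=n,\qquad \eta(-n\epsilon,\mathcal{G}_-(k))=\eta((n+1)\epsilon,\mathcal{G}_-(k))=n+k_1+2k_2,$$ $$\eta(-n\epsilon,\mathcal{E}_+(k))=n+k_2-\tfrac12,\qquad \eta((n+1)\epsilon,\mathcal{E}_+(k))=n+k_2+\tfrac12,$$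 $$\eta(-n\epsilon,\mathcal{E}_-(k))=n+k_1+k_2-\tfrac12,\qquad \eta((n+1)\epsilon,\mathcal{E}_-(k))=n+k_1+k_2+\tfrac12 .$$ With $\lambda_j=w^\lambda w_{\lambda^*}(\lambda^*-\varepsilon_2j\epsilon)$, let $$\eta(\lambda,\mathcal{G}(\ell,k))=\prod_{j=0}^{N_2-1}\eta\big(\lambda_j,\mathcal{G}_{\varepsilon_2}(k+\varepsilon_2j(0,1))\big)\prod_{i=0}^{N_1-1}\eta\big(\lambda_{N_2},\mathcal{E}_{\varepsilon_1}(k+\varepsilon_2N_2(0,1)+\varepsilon_1i(2,-1))\big).$$ **Statement.** Let $\ell\in2\mathbb{Z}\times\mathbb{Z}$ and $p\in\mathbb{C}[\xi]$, and put $\mathcal{S}(k)=\mathcal{G}(\ell,k)p(D_k)$. For every $k\in\mathbb{C}^2$ this is a non-symmetric shift operator with shift $\ell$. Moreover: (i) If $k$ is real and both $k$ and $k+\ell$ are convergent, or if $k$ is complex and neither $k_1+2k_2$ nor $(k_1+\ell_1)+2(k_2+\ell_2)$ is a negative integer, then for all $\lambda\in P$ $$\mathcal{S}(k)E(\lambda,k)=\begin{cases}\eta(\lambda,\mathcal{S}(k))\,E\big(w^\lambda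 w_{\lambda^*}(\lambda^*-\rho(\ell)\epsilon),k+\ell\big)&\text{if }\lambda^*-\rho(\ell)\epsilon\in P^+,\\0&\text{otherwise,}\end{cases}$$ with shift factors $\eta(\lambda,\mathcal{S}(k))=\eta(\lambda,\mathcal{G}(\ell,k))\,p(\widetilde\lambda)$. (ii) Let $k$ and $k+\ell$ be convergent, let $\bar k=(\overline{k_1},\overline{k_2})$, and let $\bar p$ be the polynomial whose coefficients are the complex conjugates of those of $p$. Then $$(\mathcal{G}(\ell,k)p(D_k)f,\,g)_{\bar k+\ell}=(f,\,\mathcal{G}(-\ell,\bar k+\ell)\,\bar p(D_{\bar k+\ell})\,g)_{\bar k},\qquad f,g\in\mathbb{C}[z^{\pm1}].$$ In particular, for real $k$ and $p$ with real coefficients the formal adjoint of $\mathcal{G}(\ell,k)p(D_k)$ with respect to $(\cdot,\cdot)_k$ and $(\cdot,\cdot)_{k+\ell}$ is $\mathcal{G}(-\ell,k+\ell)p(D_{k+\ell})$. -/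

import Mathlib

namespace JacobiBC1

noncomputable section

/-! ### Laurent polynomials, their localization along `z - z⁻¹`, and the basic operators -/

/-- The ring `ℂ[z, z⁻¹]`, where `z = LaurentPolynomial.T 1`; it is the group algebra of the weight
lattice `P = ℤ ε`, with `n ε` corresponding to `zⁿ`. -/
abbrev Laurent : Type := LaurentPolynomial ℂ

/-- The element `Δ = z - z⁻¹`. -/
def Delta : Laurent := LaurentPolynomial.T 1 - LaurentPolynomial.T (-1)

/-- The localization `ℂ_Δ[z, z⁻¹]` of the Laurent polynomials along `Δ = z - z⁻¹`. -/
abbrev Loc : Type := Localization.Away Delta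

/-- The inclusion of the Laurent polynomials in their localization. -/
def incl : Laurent →ₐ[ℂ] Loc := Algebra.algHom ℂ Laurent Loc

/-- The power `zⁿ` in the localization. -/
def zp (n : ℤ) : Loc := incl (LaurentPolynomial.T n)

theorem incl_apply (f : Laurent) : incl f = algebraMap Laurent Loc f := rfl

theorem zp_add (m n : ℤ) : zp (m + n) = zp m * zp n := by
  unfold zp
  rw [LaurentPolynomial.T_add, map_mul]

theorem zp_zero : zp 0 = 1 := by
  unfold zp
  rw [LaurentPolynomial.T_zero, map_one]

theorem isUnit_Delta : IsUnit (zp 1 - zp (-1)) := by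
  have h : IsUnit (algebraMap Laurent Loc Delta) := IsLocalization.Away.algebraMap_isUnit Delta
  have e : algebraMap Laurent Loc Delta = zp 1 - zp (-1) := by
    rw [← incl_apply]
    exact map_sub incl _ _
  rwa [e] at h

theorem one_sub_zp_neg_two : 1 - zp (-2) = (1 - zp (-1)) * (1 + zp (-1)) := by
  have h : zp (-2) = zp (-1) * zp (-1) := by
    rw [← zp_add]
    norm_num
  rw [h]
  ring

theorem isUnit_one_sub_zp_neg_two : IsUnit (1 - zp (-2)) := by
  have h : zp 1 - zp (-1) = zp 1 * (1 - zp (-2)) := by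
    rw [mul_sub, ← zp_add, mul_one]
    norm_num
  have h2 := isUnit_Delta
  rw [h] at h2
  exact isUnit_of_mul_isUnit_right h2

theorem isUnit_one_sub_zp_neg_one : IsUnit (1 - zp (-1)) := by
  have h := isUnit_one_sub_zp_neg_two
  rw [one_sub_zp_neg_two] at h
  exact isUnit_of_mul_isUnit_left h

theorem isUnit_one_add_zp_neg_one : IsUnit (1 + zp (-1)) := by
  have h := isUnit_one_sub_zp_neg_two
  rw [one_sub_zp_neg_two] at h
  exact isUnit_of_mul_isUnit_right h

/-- The substitution `z ↦ z⁻¹` is well defined on the localization. -/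
theorem isUnit_refl_aux (y : Submonoid.powers Delta) :
    IsUnit ((incl.comp (LaurentPolynomial.invert (R := ℂ)).toAlgHom) (y : Laurent)) := by
  obtain ⟨_, n, rfl⟩ := y
  have h : (incl.comp (LaurentPolynomial.invert (R := ℂ)).toAlgHom) Delta
      = -(zp 1 - zp (-1)) := by
    simp [Delta, zp]
  change IsUnit ((incl.comp (LaurentPolynomial.invert (R := ℂ)).toAlgHom) (Delta ^ n))
  rw [map_pow, h]
  exact isUnit_Delta.neg.pow n

/-- The action of the non-trivial Weyl group element, `s(f)(z) = f(z⁻¹)`, as an algebra map. -/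
def reflHom : Loc →ₐ[ℂ] Loc :=
  IsLocalization.liftAlgHom (M := Submonoid.powers Delta)
    (f := incl.comp (LaurentPolynomial.invert (R := ℂ)).toAlgHom) isUnit_refl_aux

theorem reflHom_incl (f : Laurent) :
    reflHom (incl f) = incl (LaurentPolynomial.invert f) :=
  IsLocalization.lift_eq (M := Submonoid.powers Delta) _ f

/-- The algebra map `f ↦ f + η z ∂_z f` from the Laurent polynomials to the dual numbers
(`η ^ 2 = 0`) over the localization, determined by `zⁿ ↦ zⁿ + η n zⁿ`. -/
def dualAux : Laurent →ₐ[ℂ] DualNumber Loc :=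
  AddMonoidAlgebra.lift ℂ (DualNumber Loc) ℤ
    { toFun := fun n => TrivSqZeroExt.inl (zp n.toAdd) +
        TrivSqZeroExt.inr ((n.toAdd : ℂ) • zp n.toAdd)
      map_one' := by
        ext <;> simp [zp_zero]
      map_mul' := by
        intro a b
        ext
        · simp [zp_add]
        · simp only [toAdd_mul, zp_add, Int.cast_add, TrivSqZeroExt.snd_add,
            TrivSqZeroExt.snd_inl, TrivSqZeroExt.snd_inr, zero_add, TrivSqZeroExt.snd_mul,
            TrivSqZeroExt.fst_add, TrivSqZeroExt.fst_inl, TrivSqZeroExt.fst_inr, add_zero,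
            smul_eq_mul, MulOpposite.smul_eq_mul_unop, MulOpposite.unop_op, Algebra.smul_def,
            map_add]
          ring }

theorem dualAux_T (n : ℤ) :
    dualAux (LaurentPolynomial.T n) =
      TrivSqZeroExt.inl (zp n) + TrivSqZeroExt.inr ((n : ℂ) • zp n) := by
  have h := AddMonoidAlgebra.lift_single (R := ℂ) (A := DualNumber Loc) (M := ℤ)
  unfold dualAux LaurentPolynomial.T
  rw [h, one_smul]
  rfl

theorem fst_dualAux (f : Laurent) : (dualAux f).fst = incl f := by
  have h : (TrivSqZeroExt.fstHom ℂ Loc Loc).comp dualAux = incl := by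
    apply AddMonoidAlgebra.algHom_ext
    intro n
    · change (dualAux (LaurentPolynomial.T n)).fst = zp n
      rw [dualAux_T]
      simp
    · ext
  exact DFunLike.congr_fun h f

theorem isUnit_dual_aux (y : Submonoid.powers Delta) : IsUnit (dualAux (y : Laurent)) := by
  rw [TrivSqZeroExt.isUnit_iff_isUnit_fst, fst_dualAux]
  exact IsLocalization.map_units Loc y

/-- The extension `f ↦ f + η z ∂_z f` of `dualAux` to the localization. -/
def dualHom : Loc →ₐ[ℂ] DualNumber Loc :=
  IsLocalization.liftAlgHom (M := Submonoid.powers Delta) (f := dualAux) isUnit_dual_aux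

theorem dualHom_incl (f : Laurent) : dualHom (incl f) = dualAux f :=
  IsLocalization.lift_eq (M := Submonoid.powers Delta) _ f

theorem fst_dualHom (f : Loc) : (dualHom f).fst = f := by
  have h : (TrivSqZeroExt.fstHom ℂ Loc Loc).comp dualHom = AlgHom.id ℂ Loc := by
    apply IsLocalization.algHom_ext (Submonoid.powers Delta)
    refine AlgHom.ext fun g => ?_
    change (dualHom (incl g)).fst = incl g
    rw [dualHom_incl, fst_dualAux]
  exact DFunLike.congr_fun h f

/-- The derivation `θ = z ∂_z` of the localization. -/
def theta : Derivation ℂ Loc Loc :=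
  Derivation.mk'
    { toFun := fun f => (dualHom f).snd
      map_add' := fun f g => by rw [map_add, TrivSqZeroExt.snd_add]
      map_smul' := fun c f => by rw [map_smul, TrivSqZeroExt.snd_smul]; rfl }
    (by
      intro a b
      change (dualHom (a * b)).snd = a • (dualHom b).snd + b • (dualHom a).snd
      rw [map_mul, TrivSqZeroExt.snd_mul, fst_dualHom, fst_dualHom, op_smul_eq_smul])

theorem theta_zp (n : ℤ) : theta (zp n) = (n : ℂ) • zp n := by
  change (dualHom (incl (LaurentPolynomial.T n))).snd = _
  rw [dualHom_incl, dualAux_T]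
  simp

/-! ### Differential-reflection operators -/

/-- Linear operators on the localization; products are compositions. -/
abbrev Op : Type := Module.End ℂ Loc

/-- The operator of multiplication by `a`. -/
def mulOp (a : Loc) : Op := LinearMap.mulLeft ℂ a

/-- The operator `θ = z ∂_z`. -/
def thetaOp : Op := (theta : Loc →ₗ[ℂ] Loc)

/-- The reflection `s`, `(s f)(z) = f(z⁻¹)`. -/
def s : Op := reflHom.toLinearMap

/-- The algebra `ℂ_Δ[z, z⁻¹] ⊗ ℂ[z ∂_z] ⊗ ℂ[ℤ₂]` of differential-reflection operators, realized
faithfully by its action on the localization. -/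
def diffReflOps : Subalgebra ℂ Op :=
  Algebra.adjoin ℂ (Set.range mulOp ∪ {thetaOp, s})

/-- Root multiplicities `k = (k₁, k₂)`, with `k₁` the value at `ε` and `k₂` the value at `2 ε`. -/
abbrev Mult : Type := ℂ × ℂ

/-- The multiplicity `k + ℓ`. -/
def shiftBy (k : Mult) (l : ℤ × ℤ) : Mult := (k.1 + l.1, k.2 + l.2)

/-- `ρ(k) = (k₁ + 2 k₂) / 2`. -/
def rho (k : Mult) : ℂ := (k.1 + 2 * k.2) / 2

/-- `ρ(ℓ) = (ℓ₁ + 2 ℓ₂) / 2`, an integer for `ℓ ∈ 2ℤ × ℤ` (the only case used). -/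
def rhoZ (l : ℤ × ℤ) : ℤ := l.1 / 2 + l.2

/-- The Cherednik operator
`D_k = z ∂_z + k₁ (1 - z⁻¹)⁻¹ (1 - s) + 2 k₂ (1 - z⁻²)⁻¹ (1 - s) - ρ(k)`.
Here and below `Ring.inverse` is applied to units only. -/
def cherednik (k : Mult) : Op :=
  thetaOp + k.1 • (mulOp (Ring.inverse (1 - zp (-1))) * (1 - s))
    + (2 * k.2) • (mulOp (Ring.inverse (1 - zp (-2))) * (1 - s)) - rho k • 1

/-- Non-symmetric shift operators with shift `ℓ`: differential-reflection operators `S` with the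
transmutation property `S D_k = D_{k + ℓ} S` that map Laurent polynomials to Laurent polynomials. -/
structure IsNonsymShiftOp (l : ℤ × ℤ) (k : Mult) (S : Op) : Prop where
  mem : S ∈ diffReflOps
  transmutation : S * cherednik k = cherednik (shiftBy k l) * S
  maps_laurent : ∀ f : Laurent, ∃ g : Laurent, S (incl f) = incl g

/-- The symmetric forward shift operator `G₊(k) = (z - z⁻¹)⁻¹ z ∂_z`. -/
def symGPlus (_k : Mult) : Op := mulOp (Ring.inverse (zp 1 - zp (-1))) * thetaOp

/-- The symmetric backward shift operator
`G₋(k) = (z - z⁻¹) z ∂_z + (k₁ + 2 k₂ - 1) (z + z⁻¹) + 2 k₁`. -/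
def symGMinus (k : Mult) : Op :=
  mulOp (zp 1 - zp (-1)) * thetaOp + (k.1 + 2 * k.2 - 1) • mulOp (zp 1 + zp (-1)) + (2 * k.1) • 1

/-- The symmetric contiguity operator `E₊(k) = (1 + z⁻¹) / (1 - z⁻¹) z ∂_z + k₂ - 1/2`. -/
def symEPlus (k : Mult) : Op :=
  mulOp ((1 + zp (-1)) * Ring.inverse (1 - zp (-1))) * thetaOp + (k.2 - 1 / 2) • 1

/-- The symmetric contiguity operator `E₋(k) = (1 - z⁻¹) / (1 + z⁻¹) z ∂_z + k₁ + k₂ - 1/2`. -/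
def symEMinus (k : Mult) : Op :=
  mulOp ((1 - zp (-1)) * Ring.inverse (1 + zp (-1))) * thetaOp + (k.1 + k.2 - 1 / 2) • 1

/-- The non-symmetric forward shift operator `G₊(k) - z (z - z⁻¹)⁻² (1 - s)`. -/
def calGPlus (k : Mult) : Op :=
  symGPlus k - mulOp (zp 1 * Ring.inverse ((zp 1 - zp (-1)) ^ 2)) * (1 - s)

/-- The non-symmetric backward shift operator `G₋(k) + z⁻¹ - z s`. -/
def calGMinus (k : Mult) : Op :=
  symGMinus k + mulOp (zp (-1)) - mulOp (zp 1) * s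

/-- The non-symmetric contiguity operator
`E₊(k) - (1 + z⁻¹) / (1 - z⁻¹) (z - z⁻¹)⁻¹ (1 - s)`. -/
def calEPlus (k : Mult) : Op :=
  symEPlus k - mulOp ((1 + zp (-1)) * Ring.inverse (1 - zp (-1))
    * Ring.inverse (zp 1 - zp (-1))) * (1 - s)

/-- The non-symmetric contiguity operator
`E₋(k) + (1 - z⁻¹) / (1 + z⁻¹) (z - z⁻¹)⁻¹ (1 - s)`. -/
def calEMinus (k : Mult) : Op :=
  symEMinus k + mulOp ((1 - zp (-1)) * Ring.inverse (1 + zp (-1))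
    * Ring.inverse (zp 1 - zp (-1))) * (1 - s)

/-- The `N`-fold composition `S(k + (N-1) d) ⋯ S(k + d) S(k)` of a family of operators of
shift `d`. -/
def chain (S : Mult → Op) (d : ℤ × ℤ) (k : Mult) : ℕ → Op
  | 0 => 1
  | N + 1 => S (shiftBy k ((N : ℤ) • d)) * chain S d k N

/-- The operator `𝒢(ℓ, k)`. Writing `ℓ = m (2, -1) + r (0, 1)`, so `m = ℓ₁ / 2` and `r = ρ(ℓ)`, one
composes `|r|` forward or backward operators, according to the sign of `r`, and then `|m|`
contiguity operators, according to the sign of `m`. -/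
def calG (l : ℤ × ℤ) (k : Mult) : Op :=
  (if 0 ≤ l.1 / 2 then chain calEPlus (2, -1) (shiftBy k (0, rhoZ l)) (l.1 / 2).natAbs
    else chain calEMinus (-2, 1) (shiftBy k (0, rhoZ l)) (l.1 / 2).natAbs) *
  (if 0 ≤ rhoZ l then chain calGPlus (0, 1) k (rhoZ l).natAbs
    else chain calGMinus (0, -1) k (rhoZ l).natAbs)

/-- The operator `𝒢(ℓ, k) p(D_k)`. -/
def shiftOp (l : ℤ × ℤ) (k : Mult) (p : Polynomial ℂ) : Op :=
  calG l k * Polynomial.aeval (cherednik k) p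

/-! ### Labels and shift factors

A weight `n ε` is represented by `n : ℤ`, the Weyl group `ℤ₂` by `ℤˣ = {1, -1}` acting on `ℤ`, and
`(n ε)* = |n| ε`. -/

/-- The shortest `w` in the Weyl group with `n = w |n|`. -/
def wUp (n : ℤ) : ℤˣ := if 0 ≤ n then 1 else -1

/-- The longest element of the stabilizer of `n` in the Weyl group. -/
def wStab (n : ℤ) : ℤˣ := if n = 0 then -1 else 1

/-- The label `w^λ w_{λ*} (λ* - r ε)` for `λ = n ε`. -/
def label (r n : ℤ) : ℤ := (wUp n * wStab |n|) • (|n| - r)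

/-- The number `N ≥ 0` with `n = -N` or `n = N + 1`. -/
def level (n : ℤ) : ℤ := if 0 < n then n - 1 else -n

/-- Shift factors of the non-symmetric forward shift operator. -/
def etaGPlus (n : ℤ) (_k : Mult) : ℂ := level n

/-- Shift factors of the non-symmetric backward shift operator. -/
def etaGMinus (n : ℤ) (k : Mult) : ℂ := level n + k.1 + 2 * k.2

/-- Shift factors of the non-symmetric contiguity operator with shift `(2, -1)`. -/
def etaEPlus (n : ℤ) (k : Mult) : ℂ :=
  if 0 < n then level n + k.2 + 1 / 2 else level n + k.2 - 1 / 2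

/-- Shift factors of the non-symmetric contiguity operator with shift `(-2, 1)`. -/
def etaEMinus (n : ℤ) (k : Mult) : ℂ :=
  if 0 < n then level n + k.1 + k.2 + 1 / 2 else level n + k.1 + k.2 - 1 / 2

/-- The shift factor `η(n ε, 𝒢(ℓ, k))`: the product of the shift factors of the fundamental
operators composing `𝒢(ℓ, k)`, each taken at the label and multiplicity at which it acts. -/
def etaG (l : ℤ × ℤ) (n : ℤ) (k : Mult) : ℂ :=
  (if 0 ≤ rhoZ l then
      ∏ j ∈ Finset.range (rhoZ l).natAbs, etaGPlus (label j n) (shiftBy k (0, (j : ℤ)))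
    else
      ∏ j ∈ Finset.range (rhoZ l).natAbs, etaGMinus (label (-j) n) (shiftBy k (0, -(j : ℤ)))) *
  (if 0 ≤ l.1 / 2 then
      ∏ i ∈ Finset.range (l.1 / 2).natAbs,
        etaEPlus (label (rhoZ l) n) (shiftBy (shiftBy k (0, rhoZ l)) ((i : ℤ) • (2, -1)))
    else
      ∏ i ∈ Finset.range (l.1 / 2).natAbs,
        etaEMinus (label (rhoZ l) n) (shiftBy (shiftBy k (0, rhoZ l)) ((i : ℤ) • (-2, 1))))

/-- The eigenvalue `n + ρ(k)` for `n > 0`, and `n - ρ(k)` for `n ≤ 0`. -/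
def tilde (n : ℤ) (k : Mult) : ℂ := if 0 < n then n + rho k else n - rho k

/-- The shift factor `η(n ε, 𝒢(ℓ, k) p(D_k))`. -/
def eta (l : ℤ × ℤ) (n : ℤ) (k : Mult) (p : Polynomial ℂ) : ℂ :=
  etaG l n k * p.eval (tilde n k)

/-! ### The pairing and the non-symmetric Jacobi polynomials -/

/-- The value of a Laurent polynomial at `z = exp(i t)`. -/
def evalCircle (f : Laurent) (t : ℝ) : ℂ :=
  f.coeff.sum fun n a => a * Complex.exp (n * t * Complex.I)

/-- The weight `δ_k(z) = (2 - z - z⁻¹)^{k₁} (2 - z² - z⁻²)^{k₂}` at `z = exp(i t)`. -/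
def weight (k : Mult) (t : ℝ) : ℂ :=
  ((2 - 2 * Real.cos t : ℝ) : ℂ) ^ k.1 * ((2 - 2 * Real.cos (2 * t) : ℝ) : ℂ) ^ k.2

/-- The sesquilinear pairing `(f, g)_k = ∫_{S¹} conj(f(z)) g(z) δ_k(z) dz / (i z)`. -/
def pairing (k : Mult) (f g : Laurent) : ℂ :=
  ∫ t in (0 : ℝ)..(2 * Real.pi),
    (starRingEnd ℂ) (evalCircle f t) * evalCircle g t * weight k t

/-- The condition that the weight `δ_k` is integrable over the circle: the exponents `2 (k₁ + k₂)`
at `z = 1` and `2 k₂` at `z = -1` have real part larger than `-1`. -/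
def Convergent (k : Mult) : Prop := -(1 / 2) < (k.1 + k.2).re ∧ -(1 / 2) < k.2.re

/-- The exponent of the `j`-th element of the ordered basis `1, z, z⁻¹, z², z⁻², …`. -/
def expo (j : ℕ) : ℤ := if Even j then -((j / 2 : ℕ) : ℤ) else ((j / 2 : ℕ) : ℤ) + 1

/-- The position of `zⁿ` in the ordered basis `1, z, z⁻¹, z², z⁻², …`. -/
def pos (n : ℤ) : ℕ := if 0 < n then 2 * n.natAbs - 1 else 2 * n.natAbs

theorem expo_pos (n : ℤ) : expo (pos n) = n := by
  unfold expo pos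
  split_ifs with h1 h2 h2 <;> grind

theorem pos_expo (j : ℕ) : pos (expo j) = j := by
  unfold expo pos
  split_ifs with h1 h2 h2 <;> grind

/-- The (unnormalized) Gram-Schmidt process for `(·, ·)_k` on the ordered basis
`1, z, z⁻¹, z², z⁻², …`. -/
def gramSchmidt (k : Mult) (j : ℕ) : Laurent :=
  LaurentPolynomial.T (expo j) - ∑ i : Fin j,
    (pairing k (gramSchmidt k i) (LaurentPolynomial.T (expo j)) /
      pairing k (gramSchmidt k i) (gramSchmidt k i)) • gramSchmidt k i
termination_by j
decreasing_by all_goals exact i.2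

/-- The non-symmetric Jacobi polynomial `E(n, k)` for real `k`. -/
def jacobiE (n : ℤ) (k : Mult) : Laurent := gramSchmidt k (pos n)

/-- `E` is of the form `zⁿ + lower order terms` and is an eigenfunction of the Cherednik operator
with the eigenvalue belonging to `n`. For complex `k` such that `k₁ + 2 k₂` is not a negative integer
there is exactly one such `E`; this is how `E(n, k)` is understood for such `k`. -/
structure IsJacobiE (n : ℤ) (k : Mult) (E : Laurent) : Prop where
  monic : E.coeff n = 1
  lower : ∀ m : ℤ, E.coeff m ≠ 0 → pos m ≤ pos n
  eigen : cherednik k (incl E) = tilde n k • incl E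

/-- The condition that `k₁ + 2 k₂` is not a negative integer. -/
def Generic (k : Mult) : Prop := ∀ j : ℕ, k.1 + 2 * k.2 ≠ -((j : ℂ) + 1)

/-- The complex conjugate multiplicity. -/
def conjMult (k : Mult) : Mult := ((starRingEnd ℂ) k.1, (starRingEnd ℂ) k.2)

/-- A real multiplicity, viewed as a complex one. -/
def realMult (k : ℝ × ℝ) : Mult := ((k.1 : ℂ), (k.2 : ℂ))

theorem conjMult_realMult (k : ℝ × ℝ) : conjMult (realMult k) = realMult k := by
  simp [conjMult, realMult]

end

end JacobiBC1

open JacobiBC1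

namespace JacobiBC1

noncomputable section
set_option linter.unusedSimpArgs false

/-! ### The localization as a domain, and its structure maps -/

theorem Delta_ne_zero : Delta ≠ 0 := by
  intro h
  have h1 := congrArg (fun f : Laurent => f.coeff 1) h
  simp [Delta] at h1

instance isDomain_Laurent : IsDomain Laurent :=
  IsLocalization.isDomain_of_le_nonZeroDivisors (R := Polynomial ℂ) (S := Laurent)
    (M := Submonoid.powers Polynomial.X)
    (powers_le_nonZeroDivisors_of_noZeroDivisors Polynomial.X_ne_zero)

theorem powers_Delta_le : Submonoid.powers Delta ≤ nonZeroDivisors Laurent :=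
  powers_le_nonZeroDivisors_of_noZeroDivisors Delta_ne_zero

instance isDomain_Loc : IsDomain Loc :=
  IsLocalization.isDomain_of_le_nonZeroDivisors Loc powers_Delta_le

theorem incl_injective : Function.Injective incl :=
  IsLocalization.injective Loc powers_Delta_le

theorem incl_inj {f g : Laurent} : incl f = incl g ↔ f = g := incl_injective.eq_iff

theorem zp_mul_zp_neg : zp 1 * zp (-1) = 1 := by
  rw [← zp_add, ← zp_zero]; norm_num

/-- The inverse of `z - z⁻¹`. -/
def dInv : Loc := Ring.inverse (zp 1 - zp (-1))

theorem inverse_Delta : Ring.inverse (zp 1 - zp (-1)) = dInv := rfl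

theorem dInv_mul : dInv * (zp 1 - zp (-1)) = 1 := Ring.inverse_mul_cancel _ isUnit_Delta

theorem inverse_eq_of_mul_eq_one {R : Type*} [CommRing R] {a b : R} (h : a * b = 1) :
    Ring.inverse a = b := by
  have hu : IsUnit a := IsUnit.of_mul_eq_one b h
  calc Ring.inverse a = Ring.inverse a * (a * b) := by rw [h, mul_one]
    _ = b := by rw [← mul_assoc, Ring.inverse_mul_cancel _ hu, one_mul]

theorem zp_neg_two : zp (-2) = zp (-1) * zp (-1) := by
  rw [← zp_add]; norm_num

theorem inverse_one_sub : Ring.inverse (1 - zp (-1)) = (zp 1 + 1) * dInv := by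
  apply inverse_eq_of_mul_eq_one
  linear_combination dInv_mul - dInv * zp_mul_zp_neg

theorem inverse_one_add : Ring.inverse (1 + zp (-1)) = (zp 1 - 1) * dInv := by
  apply inverse_eq_of_mul_eq_one
  linear_combination dInv_mul + dInv * zp_mul_zp_neg

theorem inverse_one_sub_two : Ring.inverse (1 - zp (-2)) = zp 1 * dInv := by
  apply inverse_eq_of_mul_eq_one
  rw [zp_neg_two]
  linear_combination dInv_mul - dInv * zp (-1) * zp_mul_zp_neg

theorem inverse_Delta_sq : Ring.inverse ((zp 1 - zp (-1)) ^ 2) = dInv ^ 2 := by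
  apply inverse_eq_of_mul_eq_one
  rw [← mul_pow, mul_comm, dInv_mul, one_pow]

theorem reflHom_zp (n : ℤ) : reflHom (zp n) = zp (-n) := by
  unfold zp
  rw [reflHom_incl, LaurentPolynomial.invert_T]

theorem reflHom_dInv : reflHom dInv = -dInv := by
  have h := congrArg reflHom dInv_mul
  rw [map_mul, map_sub, reflHom_zp, reflHom_zp, neg_neg, map_one] at h
  linear_combination -dInv * h - reflHom dInv * dInv_mul

theorem reflHom_reflHom (x : Loc) : reflHom (reflHom x) = x := by
  have h : reflHom.comp reflHom = AlgHom.id ℂ Loc := by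
    apply IsLocalization.algHom_ext (Submonoid.powers Delta)
    refine AlgHom.ext fun g => ?_
    change reflHom (reflHom (incl g)) = incl g
    rw [reflHom_incl, reflHom_incl, LaurentPolynomial.involutive_invert]
  exact DFunLike.congr_fun h x

theorem theta_dInv : theta dInv = -(zp 1 + zp (-1)) * dInv ^ 2 := by
  have h := congrArg theta dInv_mul
  rw [Derivation.leibniz, map_sub, theta_zp, theta_zp, Derivation.map_one_eq_zero] at h
  simp only [smul_eq_mul, Int.cast_one, one_smul, Int.cast_neg, neg_smul] at h
  linear_combination dInv * h - theta dInv * dInv_mul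

/-- Every element of the localization becomes a Laurent polynomial after multiplication by a unit
which is a Laurent polynomial. -/
theorem exists_mul_eq_incl (x : Loc) : ∃ u f : Laurent, IsUnit (incl u) ∧ x * incl u = incl f := by
  obtain ⟨⟨f, u⟩, h⟩ := IsLocalization.surj (Submonoid.powers Delta) x
  exact ⟨u, f, IsLocalization.map_units Loc u, h⟩

theorem laurent_induction {p : Laurent → Prop} (f : Laurent) (hT : ∀ n, p (LaurentPolynomial.T n))
    (hadd : ∀ f g, p f → p g → p (f + g)) (hsmul : ∀ (a : ℂ) f, p f → p (a • f)) : p f := by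
  induction f using LaurentPolynomial.induction_on' with
  | add f g hf hg => exact hadd f g hf hg
  | C_mul_T n a =>
    rw [← LaurentPolynomial.smul_eq_C_mul]
    exact hsmul a _ (hT n)

theorem reflHom_theta (x : Loc) : reflHom (theta x) = -theta (reflHom x) := by
  have key : ∀ f : Laurent, reflHom (theta (incl f)) = -theta (reflHom (incl f)) := by
    intro f
    induction f using laurent_induction with
    | hT n =>
      change reflHom (theta (zp n)) = -theta (reflHom (zp n))
      rw [theta_zp, map_smul, reflHom_zp, theta_zp]
      simp
    | hadd f g hf hg => simp only [map_add, hf, hg, neg_add]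
    | hsmul a f hf =>
      rw [map_smul, Derivation.map_smul, map_smul, map_smul, Derivation.map_smul, hf, smul_neg]
  obtain ⟨u, f, hu, h⟩ := exists_mul_eq_incl x
  have hu' : IsUnit (reflHom (incl u)) := hu.map reflHom
  have h1 := key f
  rw [← h] at h1
  simp only [map_mul, Derivation.leibniz, map_add, smul_eq_mul, key u] at h1
  apply hu'.mul_left_cancel
  linear_combination h1

/-! ### The fundamental operators in terms of `dInv` -/

/-- Scalars in the localization. -/
abbrev cst (a : ℂ) : Loc := algebraMap ℂ Loc a

theorem theta_cst (a : ℂ) : theta (cst a) = 0 := Derivation.map_algebraMap _ _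
theorem reflHom_cst (a : ℂ) : reflHom (cst a) = cst a := AlgHom.commutes _ _

theorem cherednik_apply (k : Mult) (x : Loc) : cherednik k x =
    theta x + (cst k.1 * (zp 1 + 1) * dInv + 2 * cst k.2 * zp 1 * dInv) * (x - reflHom x)
      - cst (rho k) * x := by
  simp only [cherednik, inverse_one_sub, inverse_one_sub_two]
  simp only [LinearMap.add_apply, LinearMap.sub_apply, LinearMap.smul_apply, Module.End.mul_apply, thetaOp, mulOp, s, Module.End.one_apply,
    Derivation.coeFn_coe, LinearMap.mulLeft_apply, AlgHom.toLinearMap_apply]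
  simp only [Algebra.smul_def, map_mul, map_ofNat, cst]
  ring

theorem calGPlus_apply (k : Mult) (x : Loc) : calGPlus k x =
    dInv * theta x - zp 1 * dInv ^ 2 * (x - reflHom x) := by
  simp only [calGPlus, symGPlus, inverse_Delta_sq]
  rfl

theorem calGMinus_apply (k : Mult) (x : Loc) : calGMinus k x =
    (zp 1 - zp (-1)) * theta x + (cst k.1 + 2 * cst k.2 - 1) * (zp 1 + zp (-1)) * x
      + 2 * cst k.1 * x + zp (-1) * x - zp 1 * reflHom x := by
  simp only [calGMinus, symGMinus]
  simp only [LinearMap.add_apply, LinearMap.sub_apply, LinearMap.smul_apply, Module.End.mul_apply, thetaOp, mulOp, s, Module.End.one_apply,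
    Derivation.coeFn_coe, LinearMap.mulLeft_apply, AlgHom.toLinearMap_apply]
  simp only [Algebra.smul_def, map_mul, map_ofNat, cst,
    map_add, map_sub, map_one]
  ring

theorem calEPlus_apply (k : Mult) (x : Loc) : calEPlus k x =
    (1 + zp (-1)) * (zp 1 + 1) * dInv * (theta x - dInv * (x - reflHom x))
      + cst (k.2 - 1 / 2) * x := by
  simp only [calEPlus, symEPlus, inverse_one_sub]
  simp only [LinearMap.add_apply, LinearMap.sub_apply, LinearMap.smul_apply, Module.End.mul_apply, thetaOp, mulOp, s, Module.End.one_apply,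
    Derivation.coeFn_coe, LinearMap.mulLeft_apply, AlgHom.toLinearMap_apply, inverse_Delta]
  simp only [Algebra.smul_def, cst]
  ring

theorem calEMinus_apply (k : Mult) (x : Loc) : calEMinus k x =
    (1 - zp (-1)) * (zp 1 - 1) * dInv * (theta x + dInv * (x - reflHom x))
      + cst (k.1 + k.2 - 1 / 2) * x := by
  simp only [calEMinus, symEMinus, inverse_one_add]
  simp only [LinearMap.add_apply, LinearMap.sub_apply, LinearMap.smul_apply, Module.End.mul_apply, thetaOp, mulOp, s, Module.End.one_apply,
    Derivation.coeFn_coe, LinearMap.mulLeft_apply, AlgHom.toLinearMap_apply, inverse_Delta]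
  simp only [Algebra.smul_def, cst]
  ring

/-- The field of rational functions. -/
abbrev Rat : Type := FractionRing Loc

/-- The embedding of the localization in the field of rational functions. -/
def toRat : Loc →+* Rat := algebraMap Loc Rat

theorem toRat_injective : Function.Injective toRat := IsFractionRing.injective Loc Rat

theorem toRat_ne_zero : toRat (zp 1) ≠ 0 := by
  intro h
  have := congrArg toRat zp_mul_zp_neg
  rw [map_mul, h, zero_mul, map_one] at this
  exact zero_ne_one this

theorem toRat_zp_neg : toRat (zp (-1)) = (toRat (zp 1))⁻¹ := by
  have := congrArg toRat zp_mul_zp_neg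
  rw [map_mul, map_one] at this
  exact eq_inv_of_mul_eq_one_right this

theorem toRat_sq_sub_one_ne_zero : toRat (zp 1) ^ 2 - 1 ≠ 0 := by
  intro h
  have h1 := congrArg toRat dInv_mul
  have h0 := toRat_ne_zero
  rw [map_mul, map_one, map_sub, toRat_zp_neg] at h1
  have h2 : toRat (zp 1) - (toRat (zp 1))⁻¹ = 0 := by
    field_simp
    rw [h, mul_zero]
  rw [h2, mul_zero] at h1
  exact zero_ne_one h1

theorem toRat_dInv : toRat dInv = toRat (zp 1) / (toRat (zp 1) ^ 2 - 1) := by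
  have h1 := congrArg toRat dInv_mul
  have h0 := toRat_ne_zero
  have h2 := toRat_sq_sub_one_ne_zero
  rw [map_mul, map_one, map_sub, toRat_zp_neg] at h1
  field_simp at h1 ⊢
  exact h1

/-- Scalars as rational functions. -/
def cstRat : ℂ →+* Rat := toRat.comp (algebraMap ℂ Loc)

theorem toRat_cst (a : ℂ) : toRat (cst a) = cstRat a := rfl
theorem toRat_two : toRat 2 = 2 := map_ofNat toRat 2
theorem cst_two : cst 2 = 2 := map_ofNat (algebraMap ℂ Loc) 2
theorem cstRat_two : cstRat 2 = 2 := map_ofNat cstRat 2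
theorem theta_two : theta 2 = 0 := by rw [← cst_two, theta_cst]
theorem reflHom_two : reflHom 2 = 2 := map_ofNat reflHom 2
theorem theta_zp_one : theta (zp 1) = zp 1 := by simp [theta_zp]
theorem theta_zp_neg_one : theta (zp (-1)) = -zp (-1) := by simp [theta_zp]

theorem two_ne_zero_rat : (2 : Rat) ≠ 0 := by
  rw [← cstRat_two]
  exact (map_ne_zero cstRat).2 two_ne_zero

theorem transmutation_calGPlus_apply (k : Mult) (x : Loc) :
    calGPlus k (cherednik k x) = cherednik (shiftBy k (0, 1)) (calGPlus k x) := by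
  have h0 := toRat_ne_zero
  have h2 := toRat_sq_sub_one_ne_zero
  have h3 := two_ne_zero_rat
  apply toRat_injective
  simp only [cherednik_apply, calGPlus_apply, calGMinus_apply, calEPlus_apply, calEMinus_apply,
    shiftBy, rho, map_add, map_sub, map_mul, map_neg, Derivation.leibniz, pow_two, theta_dInv,
    theta_cst, theta_zp_one, theta_zp_neg_one, theta_two, reflHom_two, map_one,
    Derivation.map_one_eq_zero, reflHom_dInv, reflHom_cst, reflHom_theta, reflHom_reflHom,
    reflHom_zp, neg_neg, smul_eq_mul, toRat_cst, toRat_two, map_div₀, cstRat_two, map_zero,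
    toRat_dInv, toRat_zp_neg, Int.cast_zero, Int.cast_one, Int.cast_neg, Int.cast_ofNat]
  simp only [← pow_two]
  generalize toRat (theta (theta x)) = a1
  generalize toRat (theta (theta (reflHom x))) = a2
  generalize toRat (theta (reflHom x)) = a3
  generalize toRat (theta x) = a4
  generalize toRat (reflHom x) = a5
  generalize toRat x = a6
  generalize toRat (zp 1) = z at *
  generalize cstRat k.1 = k1
  generalize cstRat k.2 = k2
  field_simp
  ring

theorem transmutation_calGMinus_apply (k : Mult) (x : Loc) :
    calGMinus k (cherednik k x) = cherednik (shiftBy k (0, -1)) (calGMinus k x) := by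
  have h0 := toRat_ne_zero
  have h2 := toRat_sq_sub_one_ne_zero
  have h3 := two_ne_zero_rat
  apply toRat_injective
  simp only [cherednik_apply, calGPlus_apply, calGMinus_apply, calEPlus_apply, calEMinus_apply,
    shiftBy, rho, map_add, map_sub, map_mul, map_neg, Derivation.leibniz, pow_two, theta_dInv,
    theta_cst, theta_zp_one, theta_zp_neg_one, theta_two, reflHom_two, map_one,
    Derivation.map_one_eq_zero, reflHom_dInv, reflHom_cst, reflHom_theta, reflHom_reflHom,
    reflHom_zp, neg_neg, smul_eq_mul, toRat_cst, toRat_two, map_div₀, cstRat_two, map_zero,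
    toRat_dInv, toRat_zp_neg, Int.cast_zero, Int.cast_one, Int.cast_neg, Int.cast_ofNat]
  simp only [← pow_two]
  generalize toRat (theta (theta x)) = a1
  generalize toRat (theta (theta (reflHom x))) = a2
  generalize toRat (theta (reflHom x)) = a3
  generalize toRat (theta x) = a4
  generalize toRat (reflHom x) = a5
  generalize toRat x = a6
  generalize toRat (zp 1) = z at *
  generalize cstRat k.1 = k1
  generalize cstRat k.2 = k2
  field_simp
  ring

theorem transmutation_calEPlus_apply (k : Mult) (x : Loc) :
    calEPlus k (cherednik k x) = cherednik (shiftBy k (2, -1)) (calEPlus k x) := by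
  have h0 := toRat_ne_zero
  have h2 := toRat_sq_sub_one_ne_zero
  have h3 := two_ne_zero_rat
  apply toRat_injective
  simp only [cherednik_apply, calGPlus_apply, calGMinus_apply, calEPlus_apply, calEMinus_apply,
    shiftBy, rho, map_add, map_sub, map_mul, map_neg, Derivation.leibniz, pow_two, theta_dInv,
    theta_cst, theta_zp_one, theta_zp_neg_one, theta_two, reflHom_two, map_one,
    Derivation.map_one_eq_zero, reflHom_dInv, reflHom_cst, reflHom_theta, reflHom_reflHom,
    reflHom_zp, neg_neg, smul_eq_mul, toRat_cst, toRat_two, map_div₀, cstRat_two, map_zero,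
    toRat_dInv, toRat_zp_neg, Int.cast_zero, Int.cast_one, Int.cast_neg, Int.cast_ofNat]
  simp only [← pow_two]
  generalize toRat (theta (theta x)) = a1
  generalize toRat (theta (theta (reflHom x))) = a2
  generalize toRat (theta (reflHom x)) = a3
  generalize toRat (theta x) = a4
  generalize toRat (reflHom x) = a5
  generalize toRat x = a6
  generalize toRat (zp 1) = z at *
  generalize cstRat k.1 = k1
  generalize cstRat k.2 = k2
  field_simp
  ring

theorem transmutation_calEMinus_apply (k : Mult) (x : Loc) :
    calEMinus k (cherednik k x) = cherednik (shiftBy k (-2, 1)) (calEMinus k x) := by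
  have h0 := toRat_ne_zero
  have h2 := toRat_sq_sub_one_ne_zero
  have h3 := two_ne_zero_rat
  apply toRat_injective
  simp only [cherednik_apply, calGPlus_apply, calGMinus_apply, calEPlus_apply, calEMinus_apply,
    shiftBy, rho, map_add, map_sub, map_mul, map_neg, Derivation.leibniz, pow_two, theta_dInv,
    theta_cst, theta_zp_one, theta_zp_neg_one, theta_two, reflHom_two, map_one,
    Derivation.map_one_eq_zero, reflHom_dInv, reflHom_cst, reflHom_theta, reflHom_reflHom,
    reflHom_zp, neg_neg, smul_eq_mul, toRat_cst, toRat_two, map_div₀, cstRat_two, map_zero,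
    toRat_dInv, toRat_zp_neg, Int.cast_zero, Int.cast_one, Int.cast_neg, Int.cast_ofNat]
  simp only [← pow_two]
  generalize toRat (theta (theta x)) = a1
  generalize toRat (theta (theta (reflHom x))) = a2
  generalize toRat (theta (reflHom x)) = a3
  generalize toRat (theta x) = a4
  generalize toRat (reflHom x) = a5
  generalize toRat x = a6
  generalize toRat (zp 1) = z at *
  generalize cstRat k.1 = k1
  generalize cstRat k.2 = k2
  field_simp
  ring

theorem calEPlus_calGMinus_apply (k : Mult) (x : Loc) :
    calEPlus (shiftBy k (0, -1)) (calGMinus k x) =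
      calGMinus (shiftBy k (2, -1)) (calEPlus k x) := by
  have h0 := toRat_ne_zero
  have h2 := toRat_sq_sub_one_ne_zero
  have h3 := two_ne_zero_rat
  apply toRat_injective
  simp only [cherednik_apply, calGPlus_apply, calGMinus_apply, calEPlus_apply, calEMinus_apply,
    shiftBy, rho, map_add, map_sub, map_mul, map_neg, Derivation.leibniz, pow_two, theta_dInv,
    theta_cst, theta_zp_one, theta_zp_neg_one, theta_two, reflHom_two, map_one,
    Derivation.map_one_eq_zero, reflHom_dInv, reflHom_cst, reflHom_theta, reflHom_reflHom,
    reflHom_zp, neg_neg, smul_eq_mul, toRat_cst, toRat_two, map_div₀, cstRat_two, map_zero,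
    toRat_dInv, toRat_zp_neg, Int.cast_zero, Int.cast_one, Int.cast_neg, Int.cast_ofNat]
  simp only [← pow_two]
  generalize toRat (theta (theta x)) = a1
  generalize toRat (theta (theta (reflHom x))) = a2
  generalize toRat (theta (reflHom x)) = a3
  generalize toRat (theta x) = a4
  generalize toRat (reflHom x) = a5
  generalize toRat x = a6
  generalize toRat (zp 1) = z at *
  generalize cstRat k.1 = k1
  generalize cstRat k.2 = k2
  field_simp
  ring

theorem calEMinus_calGMinus_apply (k : Mult) (x : Loc) :
    calEMinus (shiftBy k (0, -1)) (calGMinus k x) =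
      calGMinus (shiftBy k (-2, 1)) (calEMinus k x) := by
  have h0 := toRat_ne_zero
  have h2 := toRat_sq_sub_one_ne_zero
  have h3 := two_ne_zero_rat
  apply toRat_injective
  simp only [cherednik_apply, calGPlus_apply, calGMinus_apply, calEPlus_apply, calEMinus_apply,
    shiftBy, rho, map_add, map_sub, map_mul, map_neg, Derivation.leibniz, pow_two, theta_dInv,
    theta_cst, theta_zp_one, theta_zp_neg_one, theta_two, reflHom_two, map_one,
    Derivation.map_one_eq_zero, reflHom_dInv, reflHom_cst, reflHom_theta, reflHom_reflHom,
    reflHom_zp, neg_neg, smul_eq_mul, toRat_cst, toRat_two, map_div₀, cstRat_two, map_zero,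
    toRat_dInv, toRat_zp_neg, Int.cast_zero, Int.cast_one, Int.cast_neg, Int.cast_ofNat]
  simp only [← pow_two]
  generalize toRat (theta (theta x)) = a1
  generalize toRat (theta (theta (reflHom x))) = a2
  generalize toRat (theta (reflHom x)) = a3
  generalize toRat (theta x) = a4
  generalize toRat (reflHom x) = a5
  generalize toRat x = a6
  generalize toRat (zp 1) = z at *
  generalize cstRat k.1 = k1
  generalize cstRat k.2 = k2
  field_simp
  ring

/-! ### Supports and leading terms -/

/-- The span of the monomials with exponents in `A`. -/
def Z (A : Set ℤ) : Submodule ℂ Loc := Submodule.span ℂ (zp '' A)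

theorem zp_mem_Z {A : Set ℤ} {m : ℤ} (h : m ∈ A) : zp m ∈ Z A :=
  Submodule.subset_span ⟨m, h, rfl⟩

theorem Z_mono {A B : Set ℤ} (h : A ⊆ B) : Z A ≤ Z B :=
  Submodule.span_mono (Set.image_mono h)

theorem map_mem_Z {A : Set ℤ} {W : Submodule ℂ Loc} (S : Op) (h : ∀ m ∈ A, S (zp m) ∈ W) {x : Loc}
    (hx : x ∈ Z A) : S x ∈ W := by
  have : Z A ≤ W.comap S := by
    refine Submodule.span_le.2 ?_
    rintro _ ⟨m, hm, rfl⟩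
    exact h m hm
  exact this hx

theorem zp_mul_mem_Z {A B : Set ℤ} (i : ℤ) (h : ∀ a ∈ A, i + a ∈ B) {x : Loc} (hx : x ∈ Z A) :
    zp i * x ∈ Z B := by
  refine map_mem_Z (mulOp (zp i)) (fun m hm => ?_) hx
  change zp i * zp m ∈ _
  rw [← zp_add]
  exact zp_mem_Z (h m hm)

theorem Z_empty : Z ∅ = ⊥ := by simp [Z]

theorem incl_mem_Z {f : Laurent} {A : Set ℤ} : incl f ∈ Z A ↔ ∀ m, f.coeff m ≠ 0 → m ∈ A := by
  constructor
  · intro h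
    obtain ⟨g, hg, hgf⟩ : ∃ g : Laurent, (∀ m, g.coeff m ≠ 0 → m ∈ A) ∧ incl g = incl f := by
      unfold Z at h
      generalize incl f = y at h
      induction h using Submodule.span_induction with
      | mem x hx =>
        obtain ⟨m, hm, rfl⟩ := hx
        refine ⟨LaurentPolynomial.T m, fun i hi => ?_, rfl⟩
        rw [LaurentPolynomial.T_apply] at hi
        split_ifs at hi with e
        · exact e ▸ hm
        · exact absurd rfl hi
      | zero => exact ⟨0, by simp, map_zero _⟩
      | add x y _ _ hx hy =>
        obtain ⟨g1, h1, rfl⟩ := hx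
        obtain ⟨g2, h2, rfl⟩ := hy
        refine ⟨g1 + g2, fun m hm => ?_, map_add _ _ _⟩
        by_contra hA
        have e1 : g1.coeff m = 0 := by_contra fun e => hA (h1 m e)
        have e2 : g2.coeff m = 0 := by_contra fun e => hA (h2 m e)
        exact hm (by simp [e1, e2])
      | smul a x _ hx =>
        obtain ⟨g, h, rfl⟩ := hx
        refine ⟨a • g, fun m hm => h m ?_, map_smul _ _ _⟩
        intro e
        exact hm (by simp [e])
    rwa [← incl_injective hgf]
  · intro h
    have e : f = f.coeff.sum fun n a => a • LaurentPolynomial.T n := by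
      ext m
      simp only [AddMonoidAlgebra.coeff_finsuppSum]
      rw [Finsupp.sum, Finset.sum_apply']
      simp [LaurentPolynomial.T_apply]
    rw [e, Finsupp.sum, map_sum]
    refine Submodule.sum_mem _ fun m hm => ?_
    rw [map_smul]
    exact Submodule.smul_mem _ _ (zp_mem_Z (h m (Finsupp.mem_support_iff.1 hm)))

theorem mem_Z_univ {x : Loc} : x ∈ Z Set.univ ↔ ∃ f, x = incl f := by
  constructor
  · intro h
    unfold Z at h
    induction h using Submodule.span_induction with
    | mem x hx =>
      obtain ⟨m, -, rfl⟩ := hx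
      exact ⟨_, rfl⟩
    | zero => exact ⟨0, (map_zero _).symm⟩
    | add x y _ _ hx hy =>
      obtain ⟨g1, rfl⟩ := hx
      obtain ⟨g2, rfl⟩ := hy
      exact ⟨g1 + g2, (map_add _ _ _).symm⟩
    | smul a x _ hx =>
      obtain ⟨g, rfl⟩ := hx
      exact ⟨a • g, (map_smul _ _ _).symm⟩
  · rintro ⟨f, rfl⟩
    exact incl_mem_Z.2 fun _ _ => trivial

/-- The span of the first `j` elements of the ordered basis `1, z, z⁻¹, z², z⁻², …`. -/
def V (j : ℕ) : Submodule ℂ Loc := Z {m | pos m < j}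

theorem V_mono {i j : ℕ} (h : i ≤ j) : V i ≤ V j :=
  Z_mono fun _ hm => lt_of_lt_of_le hm h

theorem mem_V_zero {x : Loc} : x ∈ V 0 ↔ x = 0 := by
  have : {m : ℤ | pos m < 0} = ∅ := by ext; simp
  rw [V, this, Z_empty, Submodule.mem_bot]

theorem zp_mem_V {m : ℤ} {j : ℕ} (h : pos m < j) : zp m ∈ V j := zp_mem_Z h

theorem incl_mem_V {f : Laurent} {j : ℕ} : incl f ∈ V j ↔ ∀ m, f.coeff m ≠ 0 → pos m < j :=
  incl_mem_Z

/-- The divided difference `x ↦ (x - s x) / (z - z⁻¹)`. -/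
def divDiff : Op := mulOp dInv * (1 - s)

theorem divDiff_apply (x : Loc) : divDiff x = dInv * (x - reflHom x) := rfl

theorem divDiff_zp (n : ℤ) : divDiff (zp n) = dInv * (zp n - zp (-n)) := by
  rw [divDiff_apply, reflHom_zp]

theorem divDiff_zp_neg (n : ℤ) : divDiff (zp (-n)) = -divDiff (zp n) := by
  rw [divDiff_zp, divDiff_zp, neg_neg]
  ring

theorem divDiff_zp_add_two (n : ℤ) :
    divDiff (zp (n + 2)) = divDiff (zp n) + zp (n + 1) + zp (-(n + 1)) := by
  rw [divDiff_zp, divDiff_zp]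
  have e1 : zp (n + 2) = zp (n + 1) * zp 1 := by rw [← zp_add]; ring_nf
  have e2 : zp n = zp (n + 1) * zp (-1) := by rw [← zp_add]; ring_nf
  have e3 : zp (-(n + 2)) = zp (-(n + 1)) * zp (-1) := by rw [← zp_add]; ring_nf
  have e4 : zp (-n) = zp (-(n + 1)) * zp 1 := by rw [← zp_add]; ring_nf
  rw [e1, e2, e3, e4]
  linear_combination (zp (n + 1) + zp (-(n + 1))) * dInv_mul

theorem calGPlus_zp (k : Mult) (n : ℤ) :
    calGPlus k (zp n) = dInv * ((n : ℂ) • zp n - zp 1 * divDiff (zp n)) := by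
  rw [calGPlus_apply, divDiff_zp, theta_zp, reflHom_zp]
  ring

theorem calGPlus_zp_add_two (k : Mult) (n : ℤ) :
    calGPlus k (zp (n + 2)) =
      calGPlus k (zp n) + ((n + 1 : ℤ) : ℂ) • zp (n + 1) + divDiff (zp n) := by
  rw [calGPlus_zp, calGPlus_zp, divDiff_zp_add_two, divDiff_zp]
  have e1 : zp (n + 2) = zp n * zp 1 * zp 1 := by rw [← zp_add, ← zp_add]; ring_nf
  have e2 : zp (n + 1) = zp n * zp 1 := by rw [← zp_add]
  have e3 : zp (-(n + 1)) = zp (-n) * zp (-1) := by rw [← zp_add]; ring_nf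
  rw [e1, e2, e3]
  simp only [Algebra.smul_def, Int.cast_add, Int.cast_one, map_add, map_one, Int.cast_ofNat,
    map_ofNat]
  linear_combination (algebraMap ℂ Loc n + 1) * zp n * zp 1 * dInv_mul +
    (algebraMap ℂ Loc n * zp n - zp (-n) + zp n) * dInv * zp_mul_zp_neg

theorem divDiff_zp_zero : divDiff (zp 0) = 0 := by
  rw [divDiff_zp]; simp

theorem divDiff_zp_one : divDiff (zp 1) = 1 := by
  rw [divDiff_zp, dInv_mul]

theorem calGPlus_zp_zero (k : Mult) : calGPlus k (zp 0) = 0 := by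
  rw [calGPlus_zp, divDiff_zp_zero]; simp

theorem calGPlus_zp_one (k : Mult) : calGPlus k (zp 1) = 0 := by
  rw [calGPlus_zp, divDiff_zp_one]; simp

theorem calGPlus_zp_neg_one (k : Mult) : calGPlus k (zp (-1)) = 1 := by
  have h := calGPlus_zp_add_two k (-1)
  rw [divDiff_zp_neg, divDiff_zp_one] at h
  norm_num at h
  rw [calGPlus_zp_one] at h
  linear_combination -h

theorem divDiff_zp_succ (n : ℕ) :
    divDiff (zp (n + 1)) - zp n ∈ Z (Set.Icc (-n : ℤ) (n - 1)) := by
  induction n using Nat.twoStepInduction with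
  | zero =>
    have : divDiff (zp ((0 : ℕ) + 1)) - zp (0 : ℕ) = 0 := by
      simp [divDiff_zp_one, zp_zero]
    rw [this]
    exact zero_mem _
  | one =>
    have h := divDiff_zp_add_two 0
    rw [divDiff_zp_zero] at h
    have : divDiff (zp ((1 : ℕ) + 1)) - zp (1 : ℕ) = zp (-1) := by
      norm_num at h ⊢
      rw [h]; ring
    rw [this]
    exact zp_mem_Z (by simp)
  | more n ih _ =>
    have h := divDiff_zp_add_two (n + 1)
    have : divDiff (zp ((n + 2 : ℕ) + 1)) - zp (n + 2 : ℕ) =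
        (divDiff (zp (n + 1)) - zp n) + zp n + zp (-(n + 2)) := by
      have e1 : ((n + 2 : ℕ) + 1 : ℤ) = n + 1 + 2 := by push_cast; ring
      have e2 : ((n + 2 : ℕ) : ℤ) = n + 1 + 1 := by push_cast; ring
      have e3 : -((n : ℤ) + 2) = -(n + 1 + 1) := by ring
      rw [e1, h, e2, e3]
      ring
    rw [this]
    refine add_mem (add_mem (Z_mono ?_ ih) (zp_mem_Z ?_)) (zp_mem_Z ?_)
    · intro i; simp only [Set.mem_Icc]; omega
    · simp only [Set.mem_Icc]; omega
    · simp only [Set.mem_Icc]; omega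

theorem calGPlus_zp_succ (k : Mult) (n : ℕ) :
    calGPlus k (zp (n + 1)) - (n : ℂ) • zp n ∈ Z (Set.Icc (1 - n : ℤ) (n - 1)) := by
  induction n using Nat.twoStepInduction with
  | zero =>
    have : calGPlus k (zp ((0 : ℕ) + 1)) - ((0 : ℕ) : ℂ) • zp (0 : ℕ) = 0 := by
      simp [calGPlus_zp_one]
    rw [this]
    exact zero_mem _
  | one =>
    have h := calGPlus_zp_add_two k 0
    rw [calGPlus_zp_zero, divDiff_zp_zero] at h
    have : calGPlus k (zp ((1 : ℕ) + 1)) - ((1 : ℕ) : ℂ) • zp (1 : ℕ) = 0 := by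
      norm_num at h ⊢
      rw [h]; ring
    rw [this]
    exact zero_mem _
  | more n ih _ =>
    have h := calGPlus_zp_add_two k (n + 1)
    have : calGPlus k (zp ((n + 2 : ℕ) + 1)) - ((n + 2 : ℕ) : ℂ) • zp (n + 2 : ℕ) =
        (calGPlus k (zp (n + 1)) - (n : ℂ) • zp n) + (n : ℂ) • zp n +
          ((divDiff (zp (n + 1)) - zp n) + zp n) := by
      have e1 : ((n + 2 : ℕ) + 1 : ℤ) = n + 1 + 2 := by push_cast; ring
      have e2 : ((n + 2 : ℕ) : ℤ) = n + 1 + 1 := by push_cast; ring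
      have e3 : ((n + 2 : ℕ) : ℂ) = ((n + 1 + 1 : ℤ) : ℂ) := by push_cast; ring
      rw [e1, h, e2, e3]
      ring
    rw [this]
    refine add_mem (add_mem (Z_mono ?_ ih) (Submodule.smul_mem _ _ (zp_mem_Z ?_)))
      (add_mem (Z_mono ?_ (divDiff_zp_succ n)) (zp_mem_Z ?_))
    · intro i; simp only [Set.mem_Icc]; omega
    · simp only [Set.mem_Icc]; omega
    · intro i; simp only [Set.mem_Icc]; omega
    · simp only [Set.mem_Icc]; omega

theorem calGPlus_zp_neg_succ (k : Mult) (n : ℕ) :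
    calGPlus k (zp (-(n + 1))) - (n + 1 : ℂ) • zp (-n) ∈ Z (Set.Icc (1 - n : ℤ) n) := by
  induction n using Nat.twoStepInduction with
  | zero =>
    have : calGPlus k (zp (-((0 : ℕ) + 1))) - (((0 : ℕ) : ℂ) + 1) • zp (-(0 : ℕ)) = 0 := by
      norm_num
      rw [calGPlus_zp_neg_one, zp_zero, sub_self]
    rw [this]
    exact zero_mem _
  | one =>
    have h := calGPlus_zp_add_two k (-2)
    have h2 := divDiff_zp_add_two 0
    norm_num at h h2
    rw [divDiff_zp_neg, calGPlus_zp_zero, h2, divDiff_zp_zero] at h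
    have : calGPlus k (zp (-((1 : ℕ) + 1))) - (((1 : ℕ) : ℂ) + 1) • zp (-(1 : ℕ)) = zp 1 := by
      norm_num [two_smul]
      linear_combination -h
    rw [this]
    exact zp_mem_Z (by simp)
  | more n ih _ =>
    have h := calGPlus_zp_add_two k (-(n + 3))
    have h2 := divDiff_zp_add_two (n + 1)
    have : calGPlus k (zp (-((n + 2 : ℕ) + 1))) - ((n + 2 : ℕ) + 1 : ℂ) • zp (-(n + 2 : ℕ)) =
        (calGPlus k (zp (-(n + 1))) - (n + 1 : ℂ) • zp (-n)) + (n + 1 : ℂ) • zp (-n) +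
          ((divDiff (zp (n + 1)) - zp n) + zp n) + zp (n + 2) := by
      have e1 : (-((n + 2 : ℕ) + 1) : ℤ) = -(n + 3) := by push_cast; ring
      have e2 : (-(n + 3) + 2 : ℤ) = -(n + 1) := by ring
      have e3 : (-(n + 3) + 1 : ℤ) = -(n + 2) := by ring
      have e4 : (n + 1 + 2 : ℤ) = n + 3 := by ring
      have e5 : (n + 1 + 1 : ℤ) = n + 2 := by ring
      have e6 : (-(n + 2 : ℕ) : ℤ) = -(n + 2) := by push_cast; ring
      have e7 : ((-(n + 2) : ℤ) : ℂ) = -(n + 2) := by push_cast; ring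
      have e8 : (((n + 2 : ℕ) : ℂ) + 1) = n + 2 + 1 := by push_cast; ring
      rw [e4, e5] at h2
      rw [e2, e3, divDiff_zp_neg, h2, e7] at h
      rw [e1, e6, e8, h, add_smul (n + 2 : ℂ), one_smul, neg_smul]
      ring
    rw [this]
    refine add_mem (add_mem (add_mem (Z_mono ?_ ih) (Submodule.smul_mem _ _ (zp_mem_Z ?_)))
      (add_mem (Z_mono ?_ (divDiff_zp_succ n)) (zp_mem_Z ?_))) (zp_mem_Z ?_)
    · intro i; simp only [Set.mem_Icc]; omega
    · simp only [Set.mem_Icc]; omega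
    · intro i; simp only [Set.mem_Icc]; omega
    · simp only [Set.mem_Icc]; omega
    · simp only [Set.mem_Icc]; omega

theorem cherednik_eq_divDiff (k : Mult) (x : Loc) : cherednik k x =
    theta x + k.1 • (zp 1 * divDiff x + divDiff x) + (2 * k.2) • (zp 1 * divDiff x)
      - rho k • x := by
  rw [cherednik_apply, divDiff_apply]
  simp only [Algebra.smul_def, map_mul, map_ofNat]
  ring

theorem calEPlus_eq_divDiff (k : Mult) (x : Loc) : calEPlus k x =
    (zp 1 * calGPlus k x + 2 • calGPlus k x + zp (-1) * calGPlus k x)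
      + (zp 1 * divDiff x + divDiff x) + (k.2 - 1 / 2) • x := by
  rw [calEPlus_apply, calGPlus_apply, divDiff_apply]
  simp only [Algebra.smul_def, nsmul_eq_mul, Nat.cast_ofNat]
  linear_combination (theta x * dInv + dInv ^ 2 * (x - reflHom x)) * zp_mul_zp_neg +
    (zp 1 * dInv + dInv) * (x - reflHom x) * dInv_mul

theorem calEMinus_eq_divDiff (k : Mult) (x : Loc) : calEMinus k x =
    (zp 1 * calGPlus k x - 2 • calGPlus k x + zp (-1) * calGPlus k x)
      + (zp 1 * divDiff x - divDiff x) + (k.1 + k.2 - 1 / 2) • x := by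
  rw [calEMinus_apply, calGPlus_apply, divDiff_apply]
  simp only [Algebra.smul_def, nsmul_eq_mul, Nat.cast_ofNat]
  linear_combination (-theta x * dInv + dInv ^ 2 * (x - reflHom x)) * zp_mul_zp_neg +
    (zp 1 * dInv - dInv) * (x - reflHom x) * dInv_mul

theorem label_of_pos (r : ℤ) {n : ℤ} (h : 0 < n) : label r n = n - r := by
  simp [label, wUp, wStab, h.le, h.ne', abs_of_pos h]

theorem label_of_nonpos (r : ℤ) {n : ℤ} (h : n ≤ 0) : label r n = n + r := by
  rcases h.lt_or_eq with h | rfl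
  · simp [label, wUp, wStab, h.not_ge, h.ne, abs_of_neg h]
    ring
  · simp [label, wUp, wStab]

theorem label_zero_left (n : ℤ) : label 0 n = n := by
  rcases le_or_gt n 0 with h | h
  · rw [label_of_nonpos _ h, add_zero]
  · rw [label_of_pos _ h, sub_zero]

/-- `S` maps `zⁿ` to a multiple of `z` to the power `lab n`, up to lower order terms. Here `φ`
bounds the positions of the exponents in `S zⁿ` in terms of the position of `n`. -/
structure HasLead (S : Op) (φ : ℕ → ℕ) (lab : ℤ → ℤ) (η : ℤ → ℂ) : Prop where
  mono : Monotone φ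
  lead : ∀ n, S (zp n) - η n • zp (lab n) ∈ V (φ (pos n))
  le : ∀ n, φ (pos n) ≤ pos (lab n)
  lt : ∀ m n, pos m < pos n → η m ≠ 0 → pos (lab m) < φ (pos n)

/-- `x` has the form `c zⁿ + lower order terms`. -/
def IsLead (n : ℤ) (c : ℂ) (x : Loc) : Prop := x - c • zp n ∈ V (pos n)

theorem HasLead.map_V {S : Op} {φ : ℕ → ℕ} {lab : ℤ → ℤ} {η : ℤ → ℂ} (h : HasLead S φ lab η)
    {n : ℤ} {x : Loc} (hx : x ∈ V (pos n)) : S x ∈ V (φ (pos n)) := by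
  refine map_mem_Z S (fun m hm => ?_) hx
  have hm' : pos m < pos n := hm
  have e : S (zp m) = (S (zp m) - η m • zp (lab m)) + η m • zp (lab m) := by abel
  rw [e]
  refine add_mem (V_mono (h.mono hm'.le) (h.lead m)) ?_
  by_cases h0 : η m = 0
  · rw [h0, zero_smul]
    exact zero_mem _
  · exact Submodule.smul_mem _ _ (zp_mem_V (h.lt m n hm' h0))

theorem HasLead.isLead {S : Op} {φ : ℕ → ℕ} {lab : ℤ → ℤ} {η : ℤ → ℂ} (h : HasLead S φ lab η)
    {n : ℤ} {c : ℂ} {x : Loc} (hx : IsLead n c x) : IsLead (lab n) (c * η n) (S x) := by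
  have e : S x - (c * η n) • zp (lab n) =
      S (x - c • zp n) + c • (S (zp n) - η n • zp (lab n)) := by
    rw [map_sub, map_smul, smul_sub, mul_smul]
    abel
  unfold IsLead
  rw [e]
  exact V_mono (h.le n) (add_mem (h.map_V hx) (Submodule.smul_mem _ _ (h.lead n)))

theorem HasLead.map_laurent {S : Op} {φ : ℕ → ℕ} {lab : ℤ → ℤ} {η : ℤ → ℂ}
    (h : HasLead S φ lab η) (f : Laurent) : ∃ g, S (incl f) = incl g := by
  rw [← mem_Z_univ]
  refine map_mem_Z S (fun m _ => ?_) (mem_Z_univ.2 ⟨f, rfl⟩)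
  have e : S (zp m) = (S (zp m) - η m • zp (lab m)) + η m • zp (lab m) := by abel
  rw [e]
  exact add_mem (Z_mono (Set.subset_univ _) (h.lead m))
    (Submodule.smul_mem _ _ (zp_mem_Z trivial))

theorem pos_of_pos {n : ℤ} (h : 0 < n) : pos n = 2 * n.natAbs - 1 := if_pos h
theorem pos_of_nonpos {n : ℤ} (h : n ≤ 0) : pos n = 2 * n.natAbs := if_neg h.not_gt

theorem Icc_le_V {a b : ℤ} {j : ℕ} (ha : 2 - j ≤ 2 * a + 1) (hb : 2 * b ≤ j) :
    Z (Set.Icc a b) ≤ V j := by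
  refine Z_mono fun i hi => ?_
  simp only [Set.mem_Icc] at hi
  simp only [Set.mem_ofPred_eq, pos]
  split_ifs <;> omega

theorem exists_eq_of_pos {n : ℤ} (h : 0 < n) : ∃ m : ℕ, n = m + 1 := ⟨(n - 1).toNat, by omega⟩

theorem exists_eq_of_neg {n : ℤ} (h : n < 0) : ∃ m : ℕ, n = -(m + 1) := ⟨(-n - 1).toNat, by omega⟩

theorem hasLead_calGPlus (k : Mult) :
    HasLead (calGPlus k) (· - 2) (label 1) (fun n => etaGPlus n k) where
  mono _ _ h := Nat.sub_le_sub_right h 2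
  lead n := by
    rcases lt_trichotomy n 0 with h | rfl | h
    · obtain ⟨m, rfl⟩ := exists_eq_of_neg h
      have e : label 1 (-(m + 1)) = -m := by rw [label_of_nonpos _ h.le]; ring
      have e2 : etaGPlus (-(m + 1)) k = m + 1 := by
        simp only [etaGPlus, level, if_neg h.not_gt]; push_cast; ring
      rw [e, e2, pos_of_nonpos h.le]
      exact Icc_le_V (by omega) (by omega) (calGPlus_zp_neg_succ k m)
    · simp [calGPlus_zp_zero, etaGPlus, level]
    · obtain ⟨m, rfl⟩ := exists_eq_of_pos h
      have e : label 1 (m + 1) = m := by rw [label_of_pos _ h]; ring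
      have e2 : etaGPlus (m + 1) k = m := by
        simp only [etaGPlus, level, if_pos h]; push_cast; ring
      rw [e, e2, pos_of_pos h]
      refine V_mono ?_ (Icc_le_V (j := 2 * m - 1) (by omega) (by omega) (calGPlus_zp_succ k m))
      omega
  le n := by
    rcases le_or_gt n 0 with h | h
    · rw [label_of_nonpos _ h]
      simp only [pos]; split_ifs <;> omega
    · rw [label_of_pos _ h]
      simp only [pos]; split_ifs <;> omega
  lt m n h h0 := by
    have h1 : m ≠ 0 := by rintro rfl; simp [etaGPlus, level] at h0
    have h2 : m ≠ 1 := by rintro rfl; simp [etaGPlus, level] at h0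
    rcases le_or_gt m 0 with hm | hm
    · rw [label_of_nonpos _ hm]
      simp only [pos] at h ⊢; split_ifs at h ⊢ <;> omega
    · rw [label_of_pos _ hm]
      simp only [pos] at h ⊢; split_ifs at h ⊢ <;> omega

theorem calGMinus_zp (k : Mult) (n : ℤ) : calGMinus k (zp n) =
    (n : ℂ) • (zp (n + 1) - zp (n - 1)) + (k.1 + 2 * k.2 - 1) • (zp (n + 1) + zp (n - 1))
      + (2 * k.1) • zp n + zp (n - 1) - zp (1 - n) := by
  rw [calGMinus_apply, theta_zp, reflHom_zp, sub_eq_add_neg n, sub_eq_add_neg 1, zp_add n, zp_add n,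
    zp_add 1 (-n)]
  simp only [Algebra.smul_def, map_sub, map_add, map_mul, map_ofNat, map_one]
  ring

theorem hasLead_calGMinus (k : Mult) :
    HasLead (calGMinus k) (· + 2) (label (-1)) (fun n => etaGMinus n k) where
  mono _ _ h := Nat.add_le_add_right h 2
  lead n := by
    rcases le_or_gt n 0 with h | h
    · have e2 : etaGMinus n k = -n + k.1 + 2 * k.2 := by
        simp only [etaGMinus, level, if_neg h.not_gt]; push_cast; ring
      have e : calGMinus k (zp n) - etaGMinus n k • zp (label (-1) n) =
          (n + k.1 + 2 * k.2 - 1) • zp (n + 1) + (2 * k.1) • zp n - zp (1 - n) := by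
        rw [e2, label_of_nonpos _ h, calGMinus_zp, ← sub_eq_add_neg]
        module
      rw [e]
      refine sub_mem (add_mem (Submodule.smul_mem _ _ (zp_mem_V ?_))
        (Submodule.smul_mem _ _ (zp_mem_V ?_))) (zp_mem_V ?_)
      all_goals simp only [pos]; split_ifs <;> omega
    · have e2 : etaGMinus n k = n - 1 + k.1 + 2 * k.2 := by
        simp only [etaGMinus, level, if_pos h]; push_cast; ring
      have e : calGMinus k (zp n) - etaGMinus n k • zp (label (-1) n) =
          (-n + k.1 + 2 * k.2) • zp (n - 1) + (2 * k.1) • zp n - zp (1 - n) := by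
        rw [e2, label_of_pos _ h, calGMinus_zp, sub_neg_eq_add]
        module
      rw [e]
      refine sub_mem (add_mem (Submodule.smul_mem _ _ (zp_mem_V ?_))
        (Submodule.smul_mem _ _ (zp_mem_V ?_))) (zp_mem_V ?_)
      all_goals simp only [pos]; split_ifs <;> omega
  le n := by
    rcases le_or_gt n 0 with h | h
    · rw [label_of_nonpos _ h]
      simp only [pos]; split_ifs <;> omega
    · rw [label_of_pos _ h]
      simp only [pos]; split_ifs <;> omega
  lt m n h _ := by
    rcases le_or_gt m 0 with hm | hm
    · rw [label_of_nonpos _ hm]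
      simp only [pos] at h ⊢; split_ifs at h ⊢ <;> omega
    · rw [label_of_pos _ hm]
      simp only [pos] at h ⊢; split_ifs at h ⊢ <;> omega

theorem hasLead_diagonal {S : Op} {η : ℤ → ℂ} (h0 : S (zp 0) = η 0 • zp 0)
    (hpos : ∀ m : ℕ, S (zp (m + 1)) - η (m + 1) • zp (m + 1) ∈ Z (Set.Icc (-m : ℤ) m))
    (hneg : ∀ m : ℕ, S (zp (-(m + 1))) - η (-(m + 1)) • zp (-(m + 1)) ∈
      Z (Set.Icc (-m : ℤ) (m + 1))) :
    HasLead S id (label 0) η where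
  mono := monotone_id
  lead n := by
    rw [label_zero_left]
    rcases lt_trichotomy n 0 with h | rfl | h
    · obtain ⟨m, rfl⟩ := exists_eq_of_neg h
      refine Icc_le_V ?_ ?_ (hneg m)
      all_goals rw [id_eq, pos_of_nonpos h.le]; omega
    · rw [h0, sub_self]
      exact zero_mem _
    · obtain ⟨m, rfl⟩ := exists_eq_of_pos h
      refine Icc_le_V ?_ ?_ (hpos m)
      all_goals rw [id_eq, pos_of_pos h]; omega
  le n := by rw [label_zero_left, id_eq]
  lt m n h _ := by rwa [label_zero_left, id_eq]

theorem Icc_mono {a b c d : ℤ} (h1 : c ≤ a) (h2 : b ≤ d) :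
    Z (Set.Icc a b) ≤ Z (Set.Icc c d) := Z_mono (Set.Icc_subset_Icc h1 h2)

theorem zp_mul_mem_Icc {a b c d : ℤ} (i : ℤ) (h1 : c ≤ i + a) (h2 : i + b ≤ d) {x : Loc}
    (hx : x ∈ Z (Set.Icc a b)) : zp i * x ∈ Z (Set.Icc c d) := by
  refine zp_mul_mem_Z i (fun j hj => ?_) hx
  simp only [Set.mem_Icc] at hj ⊢
  omega

theorem zp_mem_Icc {m a b : ℤ} (h1 : a ≤ m) (h2 : m ≤ b) : zp m ∈ Z (Set.Icc a b) :=
  zp_mem_Z ⟨h1, h2⟩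

theorem divDiff_zp_succ_mem (m : ℕ) : divDiff (zp (m + 1)) ∈ Z (Set.Icc (-m : ℤ) m) := by
  have e : divDiff (zp (m + 1)) = (divDiff (zp (m + 1)) - zp m) + zp m := by abel
  rw [e]
  exact add_mem (Icc_mono le_rfl (by omega) (divDiff_zp_succ m)) (zp_mem_Icc (by omega) le_rfl)

theorem zp_one_mul_divDiff_sub_mem (m : ℕ) :
    zp 1 * divDiff (zp (m + 1)) - zp (m + 1) ∈ Z (Set.Icc (-m : ℤ) m) := by
  have e : zp 1 * divDiff (zp (m + 1)) - zp (m + 1) = zp 1 * (divDiff (zp (m + 1)) - zp m) := by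
    rw [mul_sub, ← zp_add, add_comm (1 : ℤ) m]
  rw [e]
  exact zp_mul_mem_Icc 1 (by omega) (by omega) (divDiff_zp_succ m)

theorem divDiff_zp_neg_succ_mem (m : ℕ) :
    divDiff (zp (-(m + 1))) ∈ Z (Set.Icc (-m : ℤ) (m + 1)) := by
  rw [divDiff_zp_neg]
  exact neg_mem (Icc_mono le_rfl (by omega) (divDiff_zp_succ_mem m))

theorem zp_one_mul_divDiff_zp_neg_succ_mem (m : ℕ) :
    zp 1 * divDiff (zp (-(m + 1))) ∈ Z (Set.Icc (-m : ℤ) (m + 1)) := by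
  rw [divDiff_zp_neg, mul_neg]
  exact neg_mem (zp_mul_mem_Icc 1 (by omega) (by omega) (divDiff_zp_succ_mem m))

theorem hasLead_cherednik (k : Mult) : HasLead (cherednik k) id (label 0) (fun n => tilde n k) := by
  apply hasLead_diagonal
  · rw [cherednik_eq_divDiff, divDiff_zp_zero, theta_zp]
    simp [tilde]
  · intro m
    have e : cherednik k (zp (m + 1)) - tilde (m + 1) k • zp (m + 1) =
        (k.1 + 2 * k.2) • (zp 1 * divDiff (zp (m + 1)) - zp (m + 1))
          + k.1 • divDiff (zp (m + 1)) := by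
      rw [cherednik_eq_divDiff, theta_zp, tilde, if_pos (by omega), rho]
      push_cast
      module
    rw [e]
    exact add_mem (Submodule.smul_mem _ _ (zp_one_mul_divDiff_sub_mem m))
      (Submodule.smul_mem _ _ (divDiff_zp_succ_mem m))
  · intro m
    have e : cherednik k (zp (-(m + 1))) - tilde (-(m + 1)) k • zp (-(m + 1)) =
        (k.1 + 2 * k.2) • (zp 1 * divDiff (zp (-(m + 1))))
          + k.1 • divDiff (zp (-(m + 1))) := by
      rw [cherednik_eq_divDiff, theta_zp, tilde, if_neg (by omega)]
      module
    rw [e]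
    exact add_mem (Submodule.smul_mem _ _ (zp_one_mul_divDiff_zp_neg_succ_mem m))
      (Submodule.smul_mem _ _ (divDiff_zp_neg_succ_mem m))

theorem calGPlus_zp_succ_mem (k : Mult) (m : ℕ) :
    calGPlus k (zp (m + 1)) ∈ Z (Set.Icc (-m : ℤ) m) := by
  have e : calGPlus k (zp (m + 1)) =
      (calGPlus k (zp (m + 1)) - (m : ℂ) • zp m) + (m : ℂ) • zp m := by abel
  rw [e]
  exact add_mem (Icc_mono (by omega) (by omega) (calGPlus_zp_succ k m))
    (Submodule.smul_mem _ _ (zp_mem_Icc (by omega) le_rfl))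

theorem zp_one_mul_calGPlus_sub_mem (k : Mult) (m : ℕ) :
    zp 1 * calGPlus k (zp (m + 1)) - (m : ℂ) • zp (m + 1) ∈ Z (Set.Icc (-m : ℤ) m) := by
  have e : zp 1 * calGPlus k (zp (m + 1)) - (m : ℂ) • zp (m + 1) =
      zp 1 * (calGPlus k (zp (m + 1)) - (m : ℂ) • zp m) := by
    rw [mul_sub, mul_smul_comm, ← zp_add, add_comm (1 : ℤ) m]
  rw [e]
  exact zp_mul_mem_Icc 1 (by omega) (by omega) (calGPlus_zp_succ k m)

theorem zp_neg_one_mul_calGPlus_mem (k : Mult) (m : ℕ) :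
    zp (-1) * calGPlus k (zp (m + 1)) ∈ Z (Set.Icc (-m : ℤ) m) := by
  have e : zp (-1) * calGPlus k (zp (m + 1)) =
      zp (-1) * (calGPlus k (zp (m + 1)) - (m : ℂ) • zp m) + (m : ℂ) • zp (m - 1) := by
    rw [mul_sub, mul_smul_comm, ← zp_add, neg_add_eq_sub]
    abel
  rw [e]
  exact add_mem (zp_mul_mem_Icc (-1) (by omega) (by omega) (calGPlus_zp_succ k m)) <| by
    rcases m.eq_zero_or_pos with rfl | hm
    · simp
    · exact Submodule.smul_mem _ _ (zp_mem_Icc (by omega) (by omega))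

theorem calGPlus_zp_neg_succ_mem (k : Mult) (m : ℕ) :
    calGPlus k (zp (-(m + 1))) ∈ Z (Set.Icc (-m : ℤ) m) := by
  have e : calGPlus k (zp (-(m + 1))) =
      (calGPlus k (zp (-(m + 1))) - (m + 1 : ℂ) • zp (-m)) + (m + 1 : ℂ) • zp (-m) := by abel
  rw [e]
  exact add_mem (Icc_mono (by omega) (by omega) (calGPlus_zp_neg_succ k m))
    (Submodule.smul_mem _ _ (zp_mem_Icc (by omega) (by omega)))

theorem zp_neg_one_mul_calGPlus_sub_mem (k : Mult) (m : ℕ) :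
    zp (-1) * calGPlus k (zp (-(m + 1))) - (m + 1 : ℂ) • zp (-(m + 1)) ∈
      Z (Set.Icc (-m : ℤ) (m + 1)) := by
  have e : zp (-1) * calGPlus k (zp (-(m + 1))) - (m + 1 : ℂ) • zp (-(m + 1)) =
      zp (-1) * (calGPlus k (zp (-(m + 1))) - (m + 1 : ℂ) • zp (-m)) := by
    rw [mul_sub, mul_smul_comm, ← zp_add, neg_add (m : ℤ) 1, add_comm (-1 : ℤ)]
  rw [e]
  exact zp_mul_mem_Icc (-1) (by omega) (by omega) (calGPlus_zp_neg_succ k m)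

theorem hasLead_calEPlus (k : Mult) :
    HasLead (calEPlus k) id (label 0) (fun n => etaEPlus n k) := by
  apply hasLead_diagonal
  · rw [calEPlus_eq_divDiff, divDiff_zp_zero, calGPlus_zp_zero]
    simp [etaEPlus, level]
  · intro m
    have e : calEPlus k (zp (m + 1)) - etaEPlus (m + 1) k • zp (m + 1) =
        (zp 1 * calGPlus k (zp (m + 1)) - (m : ℂ) • zp (m + 1))
          + (2 : ℂ) • calGPlus k (zp (m + 1)) + zp (-1) * calGPlus k (zp (m + 1))
          + (zp 1 * divDiff (zp (m + 1)) - zp (m + 1)) + divDiff (zp (m + 1)) := by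
      rw [calEPlus_eq_divDiff, etaEPlus, level, if_pos (by omega), if_pos (by omega)]
      push_cast
      module
    rw [e]
    exact add_mem (add_mem (add_mem (add_mem (zp_one_mul_calGPlus_sub_mem k m)
      (Submodule.smul_mem _ _ (calGPlus_zp_succ_mem k m))) (zp_neg_one_mul_calGPlus_mem k m))
      (zp_one_mul_divDiff_sub_mem m)) (divDiff_zp_succ_mem m)
  · intro m
    have e : calEPlus k (zp (-(m + 1))) - etaEPlus (-(m + 1)) k • zp (-(m + 1)) =
        zp 1 * calGPlus k (zp (-(m + 1))) + (2 : ℂ) • calGPlus k (zp (-(m + 1)))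
          + (zp (-1) * calGPlus k (zp (-(m + 1))) - (m + 1 : ℂ) • zp (-(m + 1)))
          + zp 1 * divDiff (zp (-(m + 1))) + divDiff (zp (-(m + 1))) := by
      rw [calEPlus_eq_divDiff, etaEPlus, level, if_neg (by omega), if_neg (by omega)]
      push_cast
      module
    rw [e]
    exact add_mem (add_mem (add_mem (add_mem
      (zp_mul_mem_Icc 1 (by omega) (by omega) (calGPlus_zp_neg_succ_mem k m))
      (Submodule.smul_mem _ _ (Icc_mono le_rfl (by omega) (calGPlus_zp_neg_succ_mem k m))))
      (zp_neg_one_mul_calGPlus_sub_mem k m)) (zp_one_mul_divDiff_zp_neg_succ_mem m))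
      (divDiff_zp_neg_succ_mem m)

theorem hasLead_calEMinus (k : Mult) :
    HasLead (calEMinus k) id (label 0) (fun n => etaEMinus n k) := by
  apply hasLead_diagonal
  · rw [calEMinus_eq_divDiff, divDiff_zp_zero, calGPlus_zp_zero]
    simp [etaEMinus, level]
  · intro m
    have e : calEMinus k (zp (m + 1)) - etaEMinus (m + 1) k • zp (m + 1) =
        (zp 1 * calGPlus k (zp (m + 1)) - (m : ℂ) • zp (m + 1))
          - (2 : ℂ) • calGPlus k (zp (m + 1)) + zp (-1) * calGPlus k (zp (m + 1))
          + (zp 1 * divDiff (zp (m + 1)) - zp (m + 1)) - divDiff (zp (m + 1)) := by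
      rw [calEMinus_eq_divDiff, etaEMinus, level, if_pos (by omega), if_pos (by omega)]
      push_cast
      module
    rw [e]
    exact sub_mem (add_mem (add_mem (sub_mem (zp_one_mul_calGPlus_sub_mem k m)
      (Submodule.smul_mem _ _ (calGPlus_zp_succ_mem k m))) (zp_neg_one_mul_calGPlus_mem k m))
      (zp_one_mul_divDiff_sub_mem m)) (divDiff_zp_succ_mem m)
  · intro m
    have e : calEMinus k (zp (-(m + 1))) - etaEMinus (-(m + 1)) k • zp (-(m + 1)) =
        zp 1 * calGPlus k (zp (-(m + 1))) - (2 : ℂ) • calGPlus k (zp (-(m + 1)))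
          + (zp (-1) * calGPlus k (zp (-(m + 1))) - (m + 1 : ℂ) • zp (-(m + 1)))
          + zp 1 * divDiff (zp (-(m + 1))) - divDiff (zp (-(m + 1))) := by
      rw [calEMinus_eq_divDiff, etaEMinus, level, if_neg (by omega), if_neg (by omega)]
      push_cast
      module
    rw [e]
    exact sub_mem (add_mem (add_mem (sub_mem
      (zp_mul_mem_Icc 1 (by omega) (by omega) (calGPlus_zp_neg_succ_mem k m))
      (Submodule.smul_mem _ _ (Icc_mono le_rfl (by omega) (calGPlus_zp_neg_succ_mem k m))))
      (zp_neg_one_mul_calGPlus_sub_mem k m)) (zp_one_mul_divDiff_zp_neg_succ_mem m))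
      (divDiff_zp_neg_succ_mem m)

/-! ### Shift operators -/

theorem shiftBy_zero (k : Mult) : shiftBy k 0 = k := by simp [shiftBy]

theorem shiftBy_shiftBy (k : Mult) (l m : ℤ × ℤ) :
    shiftBy (shiftBy k l) m = shiftBy k (l + m) := by
  simp [shiftBy, add_assoc]

theorem mulOp_mem (a : Loc) : mulOp a ∈ diffReflOps :=
  Algebra.subset_adjoin (Or.inl ⟨a, rfl⟩)

theorem thetaOp_mem : thetaOp ∈ diffReflOps := Algebra.subset_adjoin (Or.inr (Or.inl rfl))

theorem s_mem : s ∈ diffReflOps := Algebra.subset_adjoin (Or.inr (Or.inr rfl))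

theorem cherednik_mem (k : Mult) : cherednik k ∈ diffReflOps := by
  have h1 := sub_mem (one_mem diffReflOps) s_mem
  exact sub_mem (add_mem (add_mem thetaOp_mem
    (Subalgebra.smul_mem _ (mul_mem (mulOp_mem _) h1) _))
    (Subalgebra.smul_mem _ (mul_mem (mulOp_mem _) h1) _)) (Subalgebra.smul_mem _ (one_mem _) _)

theorem calGPlus_mem (k : Mult) : calGPlus k ∈ diffReflOps :=
  sub_mem (mul_mem (mulOp_mem _) thetaOp_mem)
    (mul_mem (mulOp_mem _) (sub_mem (one_mem diffReflOps) s_mem))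

theorem calGMinus_mem (k : Mult) : calGMinus k ∈ diffReflOps :=
  sub_mem (add_mem (add_mem (add_mem (mul_mem (mulOp_mem _) thetaOp_mem)
    (Subalgebra.smul_mem _ (mulOp_mem _) _)) (Subalgebra.smul_mem _ (one_mem _) _))
    (mulOp_mem _)) (mul_mem (mulOp_mem _) s_mem)

theorem calEPlus_mem (k : Mult) : calEPlus k ∈ diffReflOps :=
  sub_mem (add_mem (mul_mem (mulOp_mem _) thetaOp_mem) (Subalgebra.smul_mem _ (one_mem _) _))
    (mul_mem (mulOp_mem _) (sub_mem (one_mem diffReflOps) s_mem))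

theorem calEMinus_mem (k : Mult) : calEMinus k ∈ diffReflOps :=
  add_mem (add_mem (mul_mem (mulOp_mem _) thetaOp_mem) (Subalgebra.smul_mem _ (one_mem _) _))
    (mul_mem (mulOp_mem _) (sub_mem (one_mem diffReflOps) s_mem))

theorem isNonsymShiftOp_calGPlus (k : Mult) : IsNonsymShiftOp (0, 1) k (calGPlus k) :=
  ⟨calGPlus_mem k, LinearMap.ext (transmutation_calGPlus_apply k), (hasLead_calGPlus k).map_laurent⟩

theorem isNonsymShiftOp_calGMinus (k : Mult) : IsNonsymShiftOp (0, -1) k (calGMinus k) :=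
  ⟨calGMinus_mem k, LinearMap.ext (transmutation_calGMinus_apply k),
    (hasLead_calGMinus k).map_laurent⟩

theorem isNonsymShiftOp_calEPlus (k : Mult) : IsNonsymShiftOp (2, -1) k (calEPlus k) :=
  ⟨calEPlus_mem k, LinearMap.ext (transmutation_calEPlus_apply k), (hasLead_calEPlus k).map_laurent⟩

theorem isNonsymShiftOp_calEMinus (k : Mult) : IsNonsymShiftOp (-2, 1) k (calEMinus k) :=
  ⟨calEMinus_mem k, LinearMap.ext (transmutation_calEMinus_apply k),
    (hasLead_calEMinus k).map_laurent⟩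

theorem IsNonsymShiftOp.one (k : Mult) : IsNonsymShiftOp 0 k 1 :=
  ⟨one_mem _, by rw [shiftBy_zero, one_mul, mul_one], fun f => ⟨f, rfl⟩⟩

theorem IsNonsymShiftOp.mul {k : Mult} {l m : ℤ × ℤ} {S R : Op}
    (hR : IsNonsymShiftOp m (shiftBy k l) R) (hS : IsNonsymShiftOp l k S) :
    IsNonsymShiftOp (l + m) k (R * S) where
  mem := mul_mem hR.mem hS.mem
  transmutation := by
    rw [mul_assoc, hS.transmutation, ← mul_assoc, hR.transmutation, shiftBy_shiftBy, mul_assoc]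
  maps_laurent f := by
    obtain ⟨g, hg⟩ := hS.maps_laurent f
    obtain ⟨h, hh⟩ := hR.maps_laurent g
    exact ⟨h, by rw [Module.End.mul_apply, hg, hh]⟩

theorem isNonsymShiftOp_chain {S : Mult → Op} {d : ℤ × ℤ}
    (hS : ∀ k, IsNonsymShiftOp d k (S k)) (k : Mult) (N : ℕ) :
    IsNonsymShiftOp ((N : ℤ) • d) k (chain S d k N) := by
  induction N with
  | zero =>
    rw [Nat.cast_zero, zero_smul]
    exact .one k
  | succ N ih =>
    have h := (hS (shiftBy k ((N : ℤ) • d))).mul ih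
    rwa [Nat.cast_succ, add_smul, one_smul]

/-- The part of `𝒢(ℓ, k)` composed of contiguity operators, for `ℓ₁ / 2 = m`. -/
def contigPart (m : ℤ) (k : Mult) : Op :=
  if 0 ≤ m then chain calEPlus (2, -1) k m.natAbs else chain calEMinus (-2, 1) k m.natAbs

/-- The part of `𝒢(ℓ, k)` composed of forward or backward shift operators, for `ρ(ℓ) = r`. -/
def shiftPart (r : ℤ) (k : Mult) : Op :=
  if 0 ≤ r then chain calGPlus (0, 1) k r.natAbs else chain calGMinus (0, -1) k r.natAbs

theorem calG_eq (l : ℤ × ℤ) (k : Mult) :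
    calG l k = contigPart (l.1 / 2) (shiftBy k (0, rhoZ l)) * shiftPart (rhoZ l) k := rfl

theorem natAbs_smul_of_nonneg {m : ℤ} (h : 0 ≤ m) (d : ℤ × ℤ) :
    (m.natAbs : ℤ) • d = m • d := by rw [Int.natAbs_of_nonneg h]

theorem natAbs_smul_of_neg {m : ℤ} (h : ¬ 0 ≤ m) (d : ℤ × ℤ) :
    (m.natAbs : ℤ) • d = m • -d := by
  have : (m.natAbs : ℤ) = -m := by omega
  rw [this, neg_smul, smul_neg]

theorem isNonsymShiftOp_contigPart (m : ℤ) (k : Mult) :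
    IsNonsymShiftOp (m • (2, -1)) k (contigPart m k) := by
  unfold contigPart
  split_ifs with h
  · rw [← natAbs_smul_of_nonneg h]
    exact isNonsymShiftOp_chain isNonsymShiftOp_calEPlus k _
  · have e := natAbs_smul_of_neg h (-2, 1)
    rw [Prod.neg_mk, neg_neg] at e
    rw [← e]
    exact isNonsymShiftOp_chain isNonsymShiftOp_calEMinus k _

theorem isNonsymShiftOp_shiftPart (r : ℤ) (k : Mult) :
    IsNonsymShiftOp (r • (0, 1)) k (shiftPart r k) := by
  unfold shiftPart
  split_ifs with h
  · rw [← natAbs_smul_of_nonneg h]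
    exact isNonsymShiftOp_chain isNonsymShiftOp_calGPlus k _
  · have e := natAbs_smul_of_neg h (0, -1)
    rw [Prod.neg_mk, neg_neg, neg_zero] at e
    rw [← e]
    exact isNonsymShiftOp_chain isNonsymShiftOp_calGMinus k _

theorem smul_zero_one (r : ℤ) : r • ((0, 1) : ℤ × ℤ) = (0, r) := by simp

theorem shift_decomp {l : ℤ × ℤ} (hl : Even l.1) :
    (0, rhoZ l) + (l.1 / 2) • ((2, -1) : ℤ × ℤ) = l := by
  obtain ⟨m, hm⟩ := hl
  have h : l.1 / 2 = m := by omega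
  rw [rhoZ, h]
  ext
  · simp only [Prod.fst_add, Prod.smul_fst, smul_eq_mul, hm]; ring
  · simp only [Prod.snd_add, Prod.smul_snd, smul_eq_mul]; ring

theorem isNonsymShiftOp_calG {l : ℤ × ℤ} (hl : Even l.1) (k : Mult) :
    IsNonsymShiftOp l k (calG l k) := by
  have h1 := isNonsymShiftOp_shiftPart (rhoZ l) k
  have h2 := isNonsymShiftOp_contigPart (l.1 / 2) (shiftBy k (0, rhoZ l))
  rw [smul_zero_one] at h1
  have h := h2.mul h1
  rwa [shift_decomp hl] at h

theorem isNonsymShiftOp_cherednik (k : Mult) : IsNonsymShiftOp 0 k (cherednik k) :=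
  ⟨cherednik_mem k, by rw [shiftBy_zero], (hasLead_cherednik k).map_laurent⟩

theorem isNonsymShiftOp_aeval (k : Mult) (p : Polynomial ℂ) :
    IsNonsymShiftOp 0 k (Polynomial.aeval (cherednik k) p) := by
  induction p using Polynomial.induction_on' with
  | add p q hp hq =>
    rw [map_add]
    refine ⟨add_mem hp.mem hq.mem, ?_, fun f => ?_⟩
    · rw [add_mul, mul_add, hp.transmutation, hq.transmutation]
    · obtain ⟨g, hg⟩ := hp.maps_laurent f
      obtain ⟨h, hh⟩ := hq.maps_laurent f
      exact ⟨g + h, by rw [LinearMap.add_apply, hg, hh, map_add]⟩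
  | monomial n a =>
    have key : ∀ n : ℕ, IsNonsymShiftOp 0 k (cherednik k ^ n) := by
      intro n
      induction n with
      | zero => exact .one k
      | succ n ih =>
        rw [pow_succ']
        have h := isNonsymShiftOp_cherednik k
        nth_rw 1 [← shiftBy_zero k] at h
        exact h.mul ih
    have h := key n
    rw [Polynomial.aeval_monomial, ← Algebra.smul_def]
    refine ⟨Subalgebra.smul_mem _ h.mem _, ?_, fun f => ?_⟩
    · rw [smul_mul_assoc, mul_smul_comm, h.transmutation]
    · obtain ⟨g, hg⟩ := h.maps_laurent f
      exact ⟨a • g, by rw [LinearMap.smul_apply, hg, map_smul]⟩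

theorem isNonsymShiftOp_shiftOp {l : ℤ × ℤ} (hl : Even l.1) (k : Mult) (p : Polynomial ℂ) :
    IsNonsymShiftOp l k (shiftOp l k p) := by
  have h := isNonsymShiftOp_calG hl (shiftBy k 0)
  have h2 := h.mul (isNonsymShiftOp_aeval k p)
  rwa [zero_add, shiftBy_zero] at h2

/-! ### Action on eigenfunctions with prescribed leading term -/

theorem label_label_one {j : ℕ} {n : ℤ} (h : (j : ℤ) < |n|) :
    label 1 (label j n) = label ((j + 1 : ℕ) : ℤ) n := by
  rcases le_or_gt n 0 with hn | hn
  · rw [abs_of_nonpos hn] at h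
    rw [label_of_nonpos _ hn, label_of_nonpos _ hn, label_of_nonpos _ (by omega)]
    push_cast; ring
  · rw [abs_of_pos hn] at h
    rw [label_of_pos _ hn, label_of_pos _ hn, label_of_pos _ (by omega)]
    push_cast; ring

theorem label_label_neg_one (j : ℕ) (n : ℤ) :
    label (-1) (label (-j) n) = label (-((j + 1 : ℕ) : ℤ)) n := by
  rcases le_or_gt n 0 with hn | hn
  · rw [label_of_nonpos _ hn, label_of_nonpos _ hn, label_of_nonpos _ (by omega)]
    push_cast; ring
  · rw [label_of_pos _ hn, label_of_pos _ hn, label_of_pos _ (by omega)]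
    push_cast; ring

theorem isLead_chain_calGPlus (k : Mult) {n : ℤ} {c : ℂ} {x : Loc} (hx : IsLead n c x) (N : ℕ)
    (hN : (N : ℤ) ≤ |n|) :
    IsLead (label N n)
      (c * ∏ j ∈ Finset.range N, etaGPlus (label j n) (shiftBy k (0, (j : ℤ))))
      (chain calGPlus (0, 1) k N x) := by
  induction N with
  | zero => simpa [label_zero_left, chain] using hx
  | succ N ih =>
    have h := (hasLead_calGPlus (shiftBy k ((N : ℤ) • (0, 1)))).isLead (ih (by omega))
    rw [label_label_one (by omega)] at h
    rw [Finset.prod_range_succ, ← mul_assoc]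
    exact h

theorem isLead_chain_calGMinus (k : Mult) {n : ℤ} {c : ℂ} {x : Loc} (hx : IsLead n c x) (N : ℕ) :
    IsLead (label (-N) n)
      (c * ∏ j ∈ Finset.range N, etaGMinus (label (-j) n) (shiftBy k (0, -(j : ℤ))))
      (chain calGMinus (0, -1) k N x) := by
  induction N with
  | zero => simpa [label_zero_left, chain] using hx
  | succ N ih =>
    have h := (hasLead_calGMinus (shiftBy k ((N : ℤ) • (0, -1)))).isLead ih
    have e : (N : ℤ) • ((0, -1) : ℤ × ℤ) = (0, -(N : ℤ)) := by simp
    rw [label_label_neg_one, e] at h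
    rw [Finset.prod_range_succ, ← mul_assoc, chain, e]
    exact h

theorem isLead_chain_diagonal {S : Mult → Op} {η : ℤ → Mult → ℂ} {d : ℤ × ℤ}
    (hS : ∀ k, HasLead (S k) id (label 0) (fun n => η n k)) (k : Mult) {n : ℤ} {c : ℂ} {x : Loc}
    (hx : IsLead n c x) (N : ℕ) :
    IsLead n (c * ∏ i ∈ Finset.range N, η n (shiftBy k ((i : ℤ) • d))) (chain S d k N x) := by
  induction N with
  | zero => simpa [chain] using hx
  | succ N ih =>
    have h := (hS (shiftBy k ((N : ℤ) • d))).isLead ih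
    rw [label_zero_left] at h
    rw [Finset.prod_range_succ, ← mul_assoc]
    exact h

theorem isLead_calG (l : ℤ × ℤ) (k : Mult) {n : ℤ} {c : ℂ} {x : Loc} (hx : IsLead n c x)
    (hn : 0 ≤ |n| - rhoZ l) : IsLead (label (rhoZ l) n) (c * etaG l n k) (calG l k x) := by
  have h1 : IsLead (label (rhoZ l) n) (c * (if 0 ≤ rhoZ l then
      ∏ j ∈ Finset.range (rhoZ l).natAbs, etaGPlus (label j n) (shiftBy k (0, (j : ℤ)))
    else
      ∏ j ∈ Finset.range (rhoZ l).natAbs, etaGMinus (label (-j) n) (shiftBy k (0, -(j : ℤ)))))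
      (shiftPart (rhoZ l) k x) := by
    unfold shiftPart
    split_ifs with h
    · have e := isLead_chain_calGPlus k hx (rhoZ l).natAbs (by omega)
      rwa [Int.natAbs_of_nonneg h] at e
    · have e := isLead_chain_calGMinus k hx (rhoZ l).natAbs
      have e2 : -((rhoZ l).natAbs : ℤ) = rhoZ l := by omega
      rwa [e2] at e
  rw [calG_eq, Module.End.mul_apply, etaG, ← mul_assoc]
  revert h1
  generalize shiftPart (rhoZ l) k x = y
  intro h1
  unfold contigPart
  by_cases h : 0 ≤ l.1 / 2
  · simp only [if_pos h]
    exact isLead_chain_diagonal (η := etaEPlus) hasLead_calEPlus _ h1 _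
  · simp only [if_neg h]
    exact isLead_chain_diagonal (η := etaEMinus) hasLead_calEMinus _ h1 _

theorem calGPlus_mem_V {k : Mult} {j : ℕ} {x : Loc} (hx : x ∈ V j) : calGPlus k x ∈ V (j - 2) := by
  have h := (hasLead_calGPlus k).map_V (n := expo j) (x := x) (by rwa [pos_expo])
  rwa [pos_expo] at h

theorem chain_calGPlus_mem_V {k : Mult} {j : ℕ} {x : Loc} (hx : x ∈ V j) (N : ℕ) :
    chain calGPlus (0, 1) k N x ∈ V (j - 2 * N) := by
  induction N with
  | zero => exact hx
  | succ N ih =>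
    have h := calGPlus_mem_V (k := shiftBy k ((N : ℤ) • (0, 1))) ih
    exact V_mono (by omega) h

theorem IsLead.mem_V {n : ℤ} {c : ℂ} {x : Loc} (hx : IsLead n c x) : x ∈ V (pos n + 1) := by
  have e : x = (x - c • zp n) + c • zp n := by abel
  rw [e]
  exact add_mem (V_mono (Nat.le_succ _) hx)
    (Submodule.smul_mem _ _ (zp_mem_V (Nat.lt_succ_self _)))

theorem calG_eq_zero {l : ℤ × ℤ} {k : Mult} {n : ℤ} {c : ℂ} {x : Loc} (hx : IsLead n c x)
    (hn : |n| - rhoZ l < 0) : calG l k x = 0 := by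
  have h0 : 0 ≤ rhoZ l := by have := abs_nonneg n; omega
  have h := chain_calGPlus_mem_V (k := k) hx.mem_V (rhoZ l).natAbs
  have e : pos n + 1 - 2 * (rhoZ l).natAbs = 0 := by
    have := Int.abs_eq_natAbs n
    simp only [pos]
    split_ifs <;> omega
  rw [e, mem_V_zero] at h
  rw [calG_eq, Module.End.mul_apply, shiftPart, if_pos h0, h, map_zero]

theorem tilde_eq_imp_eq {k : Mult} (hk : Generic k) {m n : ℤ} (h : tilde m k = tilde n k) :
    m = n := by
  unfold tilde rho at h
  split_ifs at h with h1 h2 h2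
  · exact_mod_cast add_right_cancel h
  · exfalso
    apply hk (m - n - 1).toNat
    have : ((m - n - 1).toNat : ℤ) = m - n - 1 := Int.toNat_of_nonneg (by omega)
    have h3 : (((m - n - 1).toNat : ℤ) : ℂ) = m - n - 1 := by rw [this]; push_cast; ring
    rw [Int.cast_natCast] at h3
    rw [h3]
    linear_combination h
  · exfalso
    apply hk (n - m - 1).toNat
    have : ((n - m - 1).toNat : ℤ) = n - m - 1 := Int.toNat_of_nonneg (by omega)
    have h3 : (((n - m - 1).toNat : ℤ) : ℂ) = n - m - 1 := by rw [this]; push_cast; ring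
    rw [Int.cast_natCast] at h3
    rw [h3]
    linear_combination -h
  · exact_mod_cast sub_left_injective h

theorem exists_isLead_of_mem_V_succ {j : ℕ} {x : Loc} (hx : x ∈ V (j + 1)) :
    ∃ c, IsLead (expo j) c x := by
  obtain ⟨f, rfl⟩ := mem_Z_univ.1 (Z_mono (Set.subset_univ _) hx)
  refine ⟨f.coeff (expo j), ?_⟩
  unfold IsLead
  change incl f - f.coeff (expo j) • incl (LaurentPolynomial.T (expo j)) ∈ _
  rw [← map_smul, ← map_sub, pos_expo, incl_mem_V]
  intro m hm
  have h := incl_mem_V.1 hx m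
  by_cases e : m = expo j
  · subst e
    simp at hm
  · have h2 : pos m < j + 1 := h <| by
      intro h0
      apply hm
      simp [h0, Ne.symm e]
    have h3 : pos m ≠ j := by
      rintro rfl
      exact e (expo_pos m).symm
    omega

theorem eq_zero_of_smul_zp_mem_V {n : ℤ} {c : ℂ} (h : c • zp n ∈ V (pos n)) : c = 0 := by
  by_contra hc
  change c • incl (LaurentPolynomial.T n) ∈ _ at h
  rw [← map_smul, incl_mem_V] at h
  exact lt_irrefl _ (h n (by simpa using hc))

theorem eigenfunction_eq_zero {k : Mult} (hk : Generic k) {n : ℤ} {j : ℕ} (hj : j ≤ pos n)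
    {x : Loc} (hx : x ∈ V j) (he : cherednik k x = tilde n k • x) : x = 0 := by
  induction j with
  | zero => exact mem_V_zero.1 hx
  | succ j ih =>
    obtain ⟨c, hc⟩ := exists_isLead_of_mem_V_succ hx
    have h := (hasLead_cherednik k).isLead hc
    rw [label_zero_left, he] at h
    have h2 : ((tilde n k - tilde (expo j) k) * c) • zp (expo j) ∈ V (pos (expo j)) := by
      have e : ((tilde n k - tilde (expo j) k) * c) • zp (expo j) =
          (tilde n k • x - (c * tilde (expo j) k) • zp (expo j))
            - tilde n k • (x - c • zp (expo j)) := by module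
      rw [e]
      exact sub_mem h (Submodule.smul_mem _ _ hc)
    rcases mul_eq_zero.1 (eq_zero_of_smul_zp_mem_V h2) with h3 | h3
    · have h4 := tilde_eq_imp_eq hk (sub_eq_zero.1 h3)
      have h5 := congrArg pos h4
      rw [pos_expo] at h5
      omega
    · subst h3
      refine ih (by omega) ?_
      unfold IsLead at hc
      rwa [zero_smul, sub_zero, pos_expo] at hc

theorem IsJacobiE.isLead {n : ℤ} {k : Mult} {E : Laurent} (h : IsJacobiE n k E) :
    IsLead n 1 (incl E) := by
  unfold IsLead
  change incl E - (1 : ℂ) • incl (LaurentPolynomial.T n) ∈ _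
  rw [one_smul, ← map_sub, incl_mem_V]
  intro m hm
  by_cases e : m = n
  · subst e
    simp [h.monic] at hm
  · have h2 : pos m ≤ pos n := h.lower m <| by
      intro h0
      apply hm
      simp [h0, Ne.symm e]
    have h3 : pos m ≠ pos n := by
      intro h4
      exact e (by rw [← expo_pos m, h4, expo_pos])
    omega

theorem aeval_cherednik_apply {k : Mult} {x : Loc} {a : ℂ} (h : cherednik k x = a • x)
    (p : Polynomial ℂ) : Polynomial.aeval (cherednik k) p x = p.eval a • x := by
  induction p using Polynomial.induction_on' with
  | add p q hp hq => rw [map_add, LinearMap.add_apply, hp, hq, Polynomial.eval_add, add_smul]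
  | monomial n c =>
    have key : (cherednik k ^ n) x = a ^ n • x := by
      induction n with
      | zero => simp
      | succ n ih => rw [pow_succ', Module.End.mul_apply, ih, map_smul, h, smul_smul, pow_succ]
    rw [Polynomial.aeval_monomial, ← Algebra.smul_def, LinearMap.smul_apply, key,
      Polynomial.eval_monomial, smul_smul]

theorem rho_shiftBy {l : ℤ × ℤ} (hl : Even l.1) (k : Mult) :
    rho (shiftBy k l) = rho k + rhoZ l := by
  obtain ⟨m, hm⟩ := hl
  have h : l.1 / 2 = m := by omega
  rw [rhoZ, h]
  simp only [rho, shiftBy, hm]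
  push_cast
  ring

theorem shiftOp_apply_jacobi {l : ℤ × ℤ} (hl : Even l.1) (p : Polynomial ℂ) {k : Mult}
    (hk' : Generic (shiftBy k l)) {n : ℤ} {E : Laurent} (hE : IsJacobiE n k E)
    (hn : 0 ≤ |n| - rhoZ l) {E' : Laurent} (hE' : IsJacobiE (label (rhoZ l) n) (shiftBy k l) E') :
    shiftOp l k p (incl E) = eta l n k p • incl E' := by
  have hG := isLead_calG l k hE.isLead hn
  rw [one_mul] at hG
  have h1 : calG l k (incl E) = etaG l n k • incl E' := by
    have hV : calG l k (incl E) - etaG l n k • incl E' ∈ V (pos (label (rhoZ l) n)) := by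
      have e : calG l k (incl E) - etaG l n k • incl E' =
          (calG l k (incl E) - etaG l n k • zp (label (rhoZ l) n))
            - etaG l n k • (incl E' - (1 : ℂ) • zp (label (rhoZ l) n)) := by module
      rw [e]
      exact sub_mem hG (Submodule.smul_mem _ _ hE'.isLead)
    rw [← sub_eq_zero]
    by_cases h0 : label (rhoZ l) n = 0
    · rw [h0] at hV
      exact mem_V_zero.1 hV
    · refine eigenfunction_eq_zero hk' le_rfl hV ?_
      have e : tilde (label (rhoZ l) n) (shiftBy k l) = tilde n k := by
        unfold tilde
        rw [rho_shiftBy hl]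
        rcases le_or_gt n 0 with h | h
        · rw [abs_of_nonpos h] at hn
          rw [label_of_nonpos _ h, if_neg (by omega), if_neg (by omega)]
          push_cast; ring
        · rw [abs_of_pos h] at hn
          rw [label_of_pos _ h] at h0 ⊢
          rw [if_pos (by omega), if_pos h]
          push_cast; ring
      have ht := DFunLike.congr_fun (isNonsymShiftOp_calG hl k).transmutation (incl E)
      rw [Module.End.mul_apply, Module.End.mul_apply, hE.eigen, map_smul] at ht
      rw [map_sub, ← ht, map_smul, hE'.eigen, e, smul_sub, smul_comm (etaG l n k)]
  rw [shiftOp, Module.End.mul_apply, aeval_cherednik_apply hE.eigen, map_smul, h1, eta, smul_smul,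
    mul_comm]

theorem shiftOp_apply_jacobi_eq_zero {l : ℤ × ℤ} (p : Polynomial ℂ) {k : Mult}
    {n : ℤ} {E : Laurent} (hE : IsJacobiE n k E)
    (hn : |n| - rhoZ l < 0) : shiftOp l k p (incl E) = 0 := by
  rw [shiftOp, Module.End.mul_apply, aeval_cherednik_apply hE.eigen, map_smul,
    calG_eq_zero hE.isLead hn, smul_zero]

/-! ### Evaluation on the circle -/

/-- Evaluation at `z = exp(i t)` as an algebra map. -/
def evC (t : ℝ) : Laurent →ₐ[ℂ] ℂ :=
  AddMonoidAlgebra.lift ℂ ℂ ℤ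
    { toFun := fun n => Complex.exp (n.toAdd * t * Complex.I)
      map_one' := by simp
      map_mul' := by
        intro a b
        rw [← Complex.exp_add, toAdd_mul, Int.cast_add]
        ring_nf }

theorem evC_T (n : ℤ) (t : ℝ) : evC t (LaurentPolynomial.T n) = Complex.exp (n * t * Complex.I) := by
  have h := AddMonoidAlgebra.lift_single (R := ℂ) (A := ℂ) (M := ℤ)
  unfold evC LaurentPolynomial.T
  rw [h, one_smul]
  rfl

theorem evalCircle_eq (f : Laurent) (t : ℝ) : evalCircle f t = evC t f := by
  have e : f = f.coeff.sum fun n a => a • LaurentPolynomial.T n := by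
    ext m
    simp only [AddMonoidAlgebra.coeff_finsuppSum]
    rw [Finsupp.sum, Finset.sum_apply']
    simp [LaurentPolynomial.T_apply]
  nth_rw 2 [e]
  rw [evalCircle, Finsupp.sum, Finsupp.sum, map_sum]
  refine Finset.sum_congr rfl fun n _ => ?_
  rw [map_smul, evC_T, smul_eq_mul]

theorem evC_invert (f : Laurent) (t : ℝ) : evC t (LaurentPolynomial.invert f) = evC (-t) f := by
  induction f using laurent_induction with
  | hT n => rw [LaurentPolynomial.invert_T, evC_T, evC_T]; push_cast; ring_nf
  | hadd f g hf hg => rw [map_add, map_add, map_add, hf, hg]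
  | hsmul a f hf => rw [map_smul, map_smul, map_smul, hf]

theorem evC_add_two_pi (f : Laurent) (t : ℝ) : evC (t + 2 * Real.pi) f = evC t f := by
  induction f using laurent_induction with
  | hT n =>
    rw [evC_T, evC_T, Complex.exp_eq_exp_iff_exists_int]
    exact ⟨n, by push_cast; ring⟩
  | hadd f g hf hg => rw [map_add, map_add, hf, hg]
  | hsmul a f hf => rw [map_smul, map_smul, hf]

/-- The involution `f ↦ conj f` of functions on the circle, on Laurent polynomials. -/
def starL : Laurent →+* Laurent :=
  (LaurentPolynomial.invert (R := ℂ)).toRingHom.comp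
    (AddMonoidAlgebra.mapRingHom ℤ (starRingEnd ℂ))

theorem starL_T (n : ℤ) : starL (LaurentPolynomial.T n) = LaurentPolynomial.T (-n) := by
  change LaurentPolynomial.invert (AddMonoidAlgebra.mapRingHom ℤ (starRingEnd ℂ)
    (AddMonoidAlgebra.single n 1)) = _
  rw [AddMonoidAlgebra.mapRingHom_single, map_one]
  exact LaurentPolynomial.invert_T n

theorem starL_smul (a : ℂ) (f : Laurent) : starL (a • f) = (starRingEnd ℂ) a • starL f := by
  rw [LaurentPolynomial.smul_eq_C_mul, LaurentPolynomial.smul_eq_C_mul, map_mul]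
  congr 1
  change LaurentPolynomial.invert (AddMonoidAlgebra.mapRingHom ℤ (starRingEnd ℂ)
    (AddMonoidAlgebra.single 0 a)) = _
  rw [AddMonoidAlgebra.mapRingHom_single]
  exact LaurentPolynomial.invert_C _

theorem evC_starL (f : Laurent) (t : ℝ) : evC t (starL f) = (starRingEnd ℂ) (evC t f) := by
  induction f using laurent_induction with
  | hT n =>
    rw [starL_T, evC_T, evC_T, ← Complex.exp_conj]
    simp
  | hadd f g hf hg => rw [map_add, map_add, map_add, map_add, hf, hg]
  | hsmul a f hf => rw [starL_smul, map_smul, map_smul, hf, smul_eq_mul, smul_eq_mul, map_mul]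

theorem exists_theta_eq (f : Laurent) : ∃ g : Laurent, theta (incl f) = incl g ∧
    ∀ t : ℝ, HasDerivAt (fun t : ℝ => evC t f) (Complex.I * evC t g) t := by
  induction f using laurent_induction with
  | hT n =>
    refine ⟨(n : ℂ) • LaurentPolynomial.T n, ?_, fun t => ?_⟩
    · rw [map_smul]
      exact theta_zp n
    · simp only [evC_T, map_smul]
      have h1 : HasDerivAt (fun t : ℝ => (t : ℂ)) 1 t := Complex.ofRealCLM.hasDerivAt
      have h2 := ((h1.const_mul (n : ℂ)).mul_const Complex.I).cexp
      convert! h2 using 1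
      rw [smul_eq_mul]
      ring
  | hadd f g hf hg =>
    obtain ⟨f', h1, h2⟩ := hf
    obtain ⟨g', h3, h4⟩ := hg
    refine ⟨f' + g', by rw [map_add, map_add, map_add, h1, h3], fun t => ?_⟩
    have h := (h2 t).add (h4 t)
    rw [map_add, mul_add]
    convert! h using 1
    ext t
    exact map_add _ _ _
  | hsmul a f hf =>
    obtain ⟨f', h1, h2⟩ := hf
    refine ⟨a • f', by rw [map_smul, Derivation.map_smul, h1, map_smul], fun t => ?_⟩
    have h := (h2 t).const_mul a
    rw [map_smul, smul_eq_mul, mul_left_comm]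
    convert! h using 1
    ext t
    exact map_smul _ _ _

theorem continuous_evC (f : Laurent) : Continuous fun t : ℝ => evC t f := by
  obtain ⟨g, -, h⟩ := exists_theta_eq f
  exact continuous_iff_continuousAt.2 fun t => (h t).continuousAt

theorem exists_norm_evC_le (f : Laurent) : ∃ M : ℝ, ∀ t : ℝ, ‖evC t f‖ ≤ M := by
  induction f using laurent_induction with
  | hT n =>
    refine ⟨1, fun t => ?_⟩
    have e : (n * t * Complex.I : ℂ) = ((n * t : ℝ) : ℂ) * Complex.I := by push_cast; ring
    rw [evC_T, e, Complex.norm_exp_ofReal_mul_I]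
  | hadd f g hf hg =>
    obtain ⟨M, hM⟩ := hf
    obtain ⟨N, hN⟩ := hg
    refine ⟨M + N, fun t => ?_⟩
    rw [map_add]
    exact (norm_add_le _ _).trans (add_le_add (hM t) (hN t))
  | hsmul a f hf =>
    obtain ⟨M, hM⟩ := hf
    refine ⟨‖a‖ * M, fun t => ?_⟩
    rw [map_smul, smul_eq_mul, norm_mul]
    exact mul_le_mul_of_nonneg_left (hM t) (norm_nonneg _)

theorem evC_T_one_add (t : ℝ) : evC t (LaurentPolynomial.T 1 + LaurentPolynomial.T (-1)) =
    2 * Complex.cos t := by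
  rw [map_add, evC_T, evC_T, Complex.two_cos]
  simp

theorem evC_Delta (t : ℝ) : evC t Delta = 2 * Complex.I * Complex.sin t := by
  rw [Delta, map_sub, evC_T, evC_T, Complex.sin]
  push_cast
  ring_nf
  rw [Complex.I_sq]
  ring

/-! ### The weight -/

theorem countable_sin_eq_zero : {t : ℝ | Real.sin t = 0}.Countable := by
  refine (Set.countable_range fun n : ℤ => (n : ℝ) * Real.pi).mono ?_
  intro t ht
  obtain ⟨n, hn⟩ := Real.sin_eq_zero_iff.1 ht
  exact ⟨n, hn⟩

theorem two_sub_two_cos (t : ℝ) : 2 - 2 * Real.cos t = |2 * Real.sin (t / 2)| ^ 2 := by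
  have h := Real.cos_two_mul (t / 2)
  have h2 := Real.sin_sq_add_cos_sq (t / 2)
  rw [mul_div_cancel₀ t two_ne_zero] at h
  rw [sq_abs, h]
  linarith

theorem two_sub_two_cos_two_mul (t : ℝ) : 2 - 2 * Real.cos (2 * t) =
    (|2 * Real.sin (t / 2)| * |2 * Real.cos (t / 2)|) ^ 2 := by
  have h := Real.sin_two_mul (t / 2)
  rw [mul_div_cancel₀ t two_ne_zero] at h
  rw [← abs_mul, sq_abs, Real.cos_two_mul, Real.cos_sq', h]
  ring

theorem two_sub_two_cos_two_mul' (t : ℝ) : 2 - 2 * Real.cos (2 * t) = (2 * Real.sin t) ^ 2 := by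
  rw [Real.cos_two_mul, Real.cos_sq']
  ring

theorem two_sub_two_cos_nonneg (t : ℝ) : 0 ≤ 2 - 2 * Real.cos t := by
  rw [two_sub_two_cos]; positivity

theorem abs_half_pos {t : ℝ} (h : Real.sin t ≠ 0) :
    0 < |2 * Real.sin (t / 2)| ∧ 0 < |2 * Real.cos (t / 2)| := by
  have h1 := Real.sin_two_mul (t / 2)
  rw [mul_div_cancel₀ t two_ne_zero] at h1
  constructor
  · rw [abs_pos]
    intro h0
    exact h (by rw [h1, h0, zero_mul])
  · rw [abs_pos]
    intro h0
    exact h (by rw [h1]; linear_combination Real.sin (t / 2) * h0)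

theorem two_sub_two_cos_pos {t : ℝ} (h : Real.sin t ≠ 0) : 0 < 2 - 2 * Real.cos t := by
  rw [two_sub_two_cos]
  exact pow_pos (abs_half_pos h).1 2

theorem two_sub_two_cos_two_mul_pos {t : ℝ} (h : Real.sin t ≠ 0) : 0 < 2 - 2 * Real.cos (2 * t) := by
  rw [two_sub_two_cos_two_mul' t]
  positivity

theorem norm_weight {k : Mult} {t : ℝ} (h : Real.sin t ≠ 0) : ‖weight k t‖ =
    |2 * Real.sin (t / 2)| ^ (2 * (k.1 + k.2).re) * |2 * Real.cos (t / 2)| ^ (2 * k.2.re) := by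
  obtain ⟨h1, h2⟩ := abs_half_pos h
  rw [weight, norm_mul, Complex.norm_cpow_eq_rpow_re_of_pos (two_sub_two_cos_pos h),
    Complex.norm_cpow_eq_rpow_re_of_pos (two_sub_two_cos_two_mul_pos h), two_sub_two_cos,
    two_sub_two_cos_two_mul, mul_pow, Real.mul_rpow (by positivity) (by positivity), ← mul_assoc,
    ← Real.rpow_add (by positivity), ← Complex.add_re, ← Real.rpow_natCast, ← Real.rpow_natCast,
    ← Real.rpow_mul h1.le, ← Real.rpow_mul h2.le]
  norm_num

theorem rpow_le_mul_rpow_neg {x a σ : ℝ} (h0 : 0 < x) (h2 : x ≤ 2) (h : 0 ≤ a + σ) :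
    x ^ a ≤ 2 ^ (a + σ) * x ^ (-σ) := by
  have e : x ^ a = x ^ (a + σ) * x ^ (-σ) := by
    rw [← Real.rpow_add h0]; ring_nf
  rw [e]
  exact mul_le_mul_of_nonneg_right (Real.rpow_le_rpow h0.le h2 h) (Real.rpow_nonneg h0.le _)

theorem exists_norm_weight_le {k : Mult} (hk : Convergent k) : ∃ σ C : ℝ, 0 ≤ σ ∧ σ < 1 ∧ 0 ≤ C ∧
    ∀ t : ℝ, Real.sin t ≠ 0 → ‖weight k t‖ ≤
      C * (|2 * Real.sin (t / 2)| ^ (-σ) + |2 * Real.cos (t / 2)| ^ (-σ)) := by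
  obtain ⟨ha, hb⟩ := hk
  set a := (k.1 + k.2).re
  set b := k.2.re
  obtain ⟨σ, h0, h1, h2, h3⟩ : ∃ σ : ℝ, 0 ≤ σ ∧ σ < 1 ∧ 0 ≤ 2 * a + σ ∧ 0 ≤ 2 * b + σ := by
    refine ⟨max 0 (max (-(2 * a)) (-(2 * b))), le_max_left _ _, ?_, ?_, ?_⟩
    · refine max_lt zero_lt_one (max_lt ?_ ?_) <;> linarith
    · have := (le_max_left (-(2 * a)) (-(2 * b))).trans (le_max_right 0 _)
      linarith
    · have := (le_max_right (-(2 * a)) (-(2 * b))).trans (le_max_right 0 _)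
      linarith
  refine ⟨σ, 2 ^ (2 * a + σ) * 2 ^ (2 * b + σ), h0, h1, by positivity, fun t ht => ?_⟩
  obtain ⟨hX, hY⟩ := abs_half_pos ht
  have hX2 : |2 * Real.sin (t / 2)| ≤ 2 := by
    rw [abs_mul, abs_two]
    linarith [Real.abs_sin_le_one (t / 2)]
  have hY2 : |2 * Real.cos (t / 2)| ≤ 2 := by
    rw [abs_mul, abs_two]
    linarith [Real.abs_cos_le_one (t / 2)]
  have hXY : |2 * Real.sin (t / 2)| ^ 2 + |2 * Real.cos (t / 2)| ^ 2 = 4 := by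
    rw [sq_abs, sq_abs]
    linear_combination 4 * Real.sin_sq_add_cos_sq (t / 2)
  rw [norm_weight ht]
  generalize |2 * Real.sin (t / 2)| = X at *
  generalize |2 * Real.cos (t / 2)| = Y at *
  have hx : 0 ≤ X ^ (-σ) := Real.rpow_nonneg hX.le _
  have hy : 0 ≤ Y ^ (-σ) := Real.rpow_nonneg hY.le _
  calc X ^ (2 * a) * Y ^ (2 * b)
      ≤ (2 ^ (2 * a + σ) * X ^ (-σ)) * (2 ^ (2 * b + σ) * Y ^ (-σ)) :=
        mul_le_mul (rpow_le_mul_rpow_neg hX hX2 h2) (rpow_le_mul_rpow_neg hY hY2 h3)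
          (Real.rpow_nonneg hY.le _) (by positivity)
    _ = 2 ^ (2 * a + σ) * 2 ^ (2 * b + σ) * (X ^ (-σ) * Y ^ (-σ)) := by ring
    _ ≤ _ := by
      refine mul_le_mul_of_nonneg_left ?_ (by positivity)
      rcases le_total 1 X with h | h
      · have := Real.rpow_le_one_of_one_le_of_nonpos h (neg_nonpos.2 h0)
        nlinarith
      · have h' : 1 ≤ Y := by nlinarith
        have := Real.rpow_le_one_of_one_le_of_nonpos h' (neg_nonpos.2 h0)
        nlinarith

open MeasureTheory

theorem intervalIntegrable_sin_rpow {σ : ℝ} (h0 : 0 ≤ σ) (h1 : σ < 1) (a b : ℝ) :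
    IntervalIntegrable (fun t => |2 * Real.sin t| ^ (-σ)) volume a b := by
  have hper : Function.Periodic (fun t => |2 * Real.sin t| ^ (-σ)) Real.pi := by
    intro t
    simp [Real.sin_add_pi]
  have hpi := Real.pi_pos
  have hmeas : Measurable fun t : ℝ => |2 * Real.sin t| ^ (-σ) := by fun_prop
  have hhalf : IntervalIntegrable (fun t => |2 * Real.sin t| ^ (-σ)) volume 0 (Real.pi / 2) := by
    have hi : IntervalIntegrable (fun t : ℝ => t ^ (-σ)) volume 0 (Real.pi / 2) :=
      intervalIntegral.intervalIntegrable_rpow' (by linarith)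
    refine hi.mono_fun' hmeas.aestronglyMeasurable ?_
    refine (ae_restrict_iff' measurableSet_uIoc).2 (Filter.Eventually.of_forall fun t ht => ?_)
    rw [Set.uIoc_of_le (by positivity)] at ht
    have h2 : t ≤ |2 * Real.sin t| := by
      have h3 := Real.mul_le_sin ht.1.le ht.2
      have h4 : t / 2 ≤ 2 / Real.pi * t := by
        have : (1 / 2 : ℝ) ≤ 2 / Real.pi := by
          rw [div_le_div_iff₀ two_pos hpi]
          linarith [Real.pi_le_four]
        nlinarith [ht.1]
      exact le_trans (by linarith) (le_abs_self _)
    change ‖|2 * Real.sin t| ^ (-σ)‖ ≤ t ^ (-σ)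
    rw [Real.norm_of_nonneg (Real.rpow_nonneg (abs_nonneg _) _)]
    exact Real.rpow_le_rpow_of_nonpos ht.1 h2 (neg_nonpos.2 h0)
  have hhalf2 : IntervalIntegrable (fun t => |2 * Real.sin t| ^ (-σ)) volume (Real.pi / 2)
      Real.pi := by
    have h := (hhalf.comp_sub_left Real.pi (by simp)).symm
    simp only [Real.sin_pi_sub, sub_zero, sub_half] at h
    exact h
  exact hper.intervalIntegrable₀ hpi.ne' (hhalf.trans hhalf2) a b

theorem measurable_weight (k : Mult) : Measurable (weight k) := by
  unfold weight
  fun_prop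

theorem ae_sin_ne_zero : ∀ᵐ t : ℝ, Real.sin t ≠ 0 := countable_sin_eq_zero.ae_notMem volume

theorem intervalIntegrable_weight {k : Mult} (hk : Convergent k) (a b : ℝ) :
    IntervalIntegrable (weight k) volume a b := by
  obtain ⟨σ, C, h0, h1, -, h⟩ := exists_norm_weight_le hk
  have hs : IntervalIntegrable (fun t => |2 * Real.sin (t / 2)| ^ (-σ)) volume a b := by
    have := (intervalIntegrable_sin_rpow h0 h1 (a / 2) (b / 2)).comp_mul_left (c := 2⁻¹)
      (by simp) (by simp)
    simp only [div_inv_eq_mul, div_mul_cancel₀ _ (two_ne_zero' ℝ)] at this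
    refine this.congr (fun t _ => ?_)
    simp only [div_eq_inv_mul]
  have hc : IntervalIntegrable (fun t => |2 * Real.cos (t / 2)| ^ (-σ)) volume a b := by
    have := ((intervalIntegrable_sin_rpow h0 h1 (a / 2 + Real.pi / 2)
      (b / 2 + Real.pi / 2)).comp_add_right (Real.pi / 2) (by simp)).comp_mul_left (c := 2⁻¹)
      (by simp) (by simp)
    simp only [div_inv_eq_mul, div_mul_cancel₀ _ (two_ne_zero' ℝ), add_sub_cancel_right,
      Real.sin_add_pi_div_two] at this
    refine this.congr (fun t _ => ?_)
    simp only [div_eq_inv_mul]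
  refine ((hs.add hc).const_mul C).mono_fun' (measurable_weight k).aestronglyMeasurable ?_
  exact (ae_restrict_of_ae ae_sin_ne_zero).mono fun t ht => h t ht

theorem weight_neg (k : Mult) (t : ℝ) : weight k (-t) = weight k t := by
  unfold weight
  rw [mul_neg, Real.cos_neg, Real.cos_neg]

theorem weight_add_two_pi (k : Mult) (t : ℝ) : weight k (t + 2 * Real.pi) = weight k t := by
  have e : 2 * (t + 2 * Real.pi) = 2 * t + 2 * Real.pi + 2 * Real.pi := by ring
  unfold weight
  rw [e, Real.cos_add_two_pi, Real.cos_add_two_pi, Real.cos_add_two_pi]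

theorem weight_conjMult (k : Mult) (t : ℝ) :
    weight (conjMult k) t = (starRingEnd ℂ) (weight k t) := by
  have key : ∀ (x : ℝ) (c : ℂ), 0 ≤ x →
      ((x : ℂ) ^ ((starRingEnd ℂ) c)) = (starRingEnd ℂ) ((x : ℂ) ^ c) := by
    intro x c hx
    rw [Complex.cpow_conj, Complex.conj_ofReal]
    rw [Complex.arg_ofReal_of_nonneg hx]
    exact Real.pi_ne_zero.symm
  unfold weight conjMult
  rw [key _ _ (two_sub_two_cos_nonneg _), key _ _ (two_sub_two_cos_nonneg _), map_mul]

theorem hasDerivAt_ofReal_cpow {x : ℝ → ℝ} {x' t : ℝ} (c : ℂ) (hx : HasDerivAt x x' t)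
    (h : 0 < x t) : HasDerivAt (fun t => (x t : ℂ) ^ c) ((x t : ℂ) ^ c * (c * x' / x t)) t := by
  have h1 : ((x t : ℝ) : ℂ) ∈ Complex.slitPlane := Complex.ofReal_mem_slitPlane.2 h
  have h2 := ((Complex.hasStrictDerivAt_cpow_const (c := c) h1).hasDerivAt.comp_ofReal).scomp t hx
  have h0 : ((x t : ℝ) : ℂ) ≠ 0 := Complex.ofReal_ne_zero.2 h.ne'
  convert! h2 using 1
  rw [Complex.cpow_sub _ _ h0, Complex.cpow_one, Complex.real_smul]
  ring

/-! ### The pairing as a linear functional -/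

/-- Integration over the circle against the weight `δ_k`. -/
def integ (k : Mult) (h : Laurent) : ℂ := ∫ t in (0 : ℝ)..(2 * Real.pi), evC t h * weight k t

theorem pairing_eq_integ (k : Mult) (f g : Laurent) : pairing k f g = integ k (starL f * g) := by
  unfold pairing integ
  simp only [map_mul, evC_starL, evalCircle_eq]

theorem intervalIntegrable_evC_mul_weight {k : Mult} (hk : Convergent k) (h : Laurent) (a b : ℝ) :
    IntervalIntegrable (fun t => evC t h * weight k t) volume a b :=
  (intervalIntegrable_weight hk a b).continuousOn_mul (continuous_evC h).continuousOn

theorem integ_add {k : Mult} (hk : Convergent k) (f g : Laurent) :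
    integ k (f + g) = integ k f + integ k g := by
  unfold integ
  rw [← intervalIntegral.integral_add (intervalIntegrable_evC_mul_weight hk f _ _)
    (intervalIntegrable_evC_mul_weight hk g _ _)]
  simp only [map_add, add_mul]

theorem integ_smul (k : Mult) (a : ℂ) (f : Laurent) : integ k (a • f) = a * integ k f := by
  unfold integ
  rw [← intervalIntegral.integral_const_mul]
  simp only [map_smul, smul_eq_mul, mul_assoc]

theorem integ_neg (k : Mult) (f : Laurent) : integ k (-f) = -integ k f := by
  rw [← neg_one_smul ℂ f, integ_smul, neg_one_mul]

theorem integ_sub {k : Mult} (hk : Convergent k) (f g : Laurent) :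
    integ k (f - g) = integ k f - integ k g := by
  rw [sub_eq_add_neg, integ_add hk, integ_neg, sub_eq_add_neg]

theorem integ_invert (k : Mult) (f : Laurent) :
    integ k (LaurentPolynomial.invert f) = integ k f := by
  unfold integ
  have h := intervalIntegral.integral_comp_sub_left (a := 0) (b := 2 * Real.pi)
    (fun t => evC t f * weight k t) (2 * Real.pi)
  rw [sub_self, sub_zero] at h
  rw [← h]
  congr 1
  ext t
  rw [evC_invert, sub_eq_neg_add, evC_add_two_pi, weight_add_two_pi, weight_neg]

theorem integ_congr {k k' : Mult} {f g : Laurent}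
    (h : ∀ t : ℝ, Real.sin t ≠ 0 → evC t f * weight k t = evC t g * weight k' t) :
    integ k f = integ k' g :=
  intervalIntegral.integral_congr_ae (ae_sin_ne_zero.mono fun t ht _ => h t ht)

theorem conj_integ (k : Mult) (f : Laurent) :
    (starRingEnd ℂ) (integ k f) = integ (conjMult k) (starL f) := by
  unfold integ
  rw [← intervalIntegral.intervalIntegral_conj]
  simp only [map_mul, evC_starL, weight_conjMult]

theorem starL_starL (f : Laurent) : starL (starL f) = f := by
  induction f using laurent_induction with
  | hT n => rw [starL_T, starL_T, neg_neg]
  | hadd f g hf hg => rw [map_add, map_add, hf, hg]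
  | hsmul a f hf => rw [starL_smul, starL_smul, hf, Complex.conj_conj]

theorem conj_pairing (k : Mult) (f g : Laurent) :
    (starRingEnd ℂ) (pairing k f g) = pairing (conjMult k) g f := by
  rw [pairing_eq_integ, conj_integ, pairing_eq_integ, map_mul, starL_starL, mul_comm]

/-! ### Integration by parts -/

theorem hasDerivAt_weight (k : Mult) {t : ℝ} (h : Real.sin t ≠ 0) :
    HasDerivAt (weight k) (weight k t * (k.1 * (2 * Real.sin t : ℝ) / (2 - 2 * Real.cos t : ℝ)
      + k.2 * (4 * Real.sin (2 * t) : ℝ) / (2 - 2 * Real.cos (2 * t) : ℝ))) t := by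
  have h1 : HasDerivAt (fun t => 2 - 2 * Real.cos t) (2 * Real.sin t) t := by
    convert! ((Real.hasDerivAt_cos t).const_mul 2).const_sub 2 using 1
    ring
  have h2 : HasDerivAt (fun t => 2 - 2 * Real.cos (2 * t)) (4 * Real.sin (2 * t)) t := by
    convert! (((hasDerivAt_id t).const_mul 2).cos.const_mul 2).const_sub 2 using 1
    simp only [id]
    ring
  have h3 := (hasDerivAt_ofReal_cpow k.1 h1 (two_sub_two_cos_pos h)).mul
    (hasDerivAt_ofReal_cpow k.2 h2 (two_sub_two_cos_two_mul_pos h))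
  convert! h3 using 1
  unfold weight
  ring

/-- The Laurent polynomial `δ_k⁻¹ θ((z - z⁻¹) q δ_k)`, where `g = θ q`. -/
def partsExpr (k : Mult) (q g : Laurent) : Laurent :=
  Delta * g + (1 + k.1 + 2 * k.2) • ((LaurentPolynomial.T 1 + LaurentPolynomial.T (-1)) * q)
    + (2 * k.1) • q

theorem hasDerivAt_evC_mul_weight (k : Mult) {q g : Laurent} (hg : theta (incl q) = incl g)
    {t : ℝ} (h : Real.sin t ≠ 0) :
    HasDerivAt (fun t => evC t (Delta * q) * weight k t)
      (Complex.I * (evC t (partsExpr k q g) * weight k t)) t := by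
  obtain ⟨g', h1, h2⟩ := exists_theta_eq q
  obtain rfl : g' = g := incl_injective (h1.symm.trans hg)
  have h3 : HasDerivAt (fun t : ℝ => 2 * Complex.I * (Real.sin t : ℂ))
      (2 * Complex.I * (Real.cos t : ℂ)) t :=
    ((Real.hasDerivAt_sin t).ofReal_comp).const_mul _
  have h4 := (h3.mul (h2 t)).mul (hasDerivAt_weight k h)
  convert! h4 using 1
  · ext t
    simp only [Pi.mul_apply, map_mul, evC_Delta, Complex.ofReal_sin]
  · have e1 : (2 - 2 * Complex.cos t) ≠ 0 := by
      have := (two_sub_two_cos_pos h).ne'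
      exact_mod_cast this
    have e2 : (2 - 2 * Complex.cos (2 * t)) ≠ 0 := by
      have := (two_sub_two_cos_two_mul_pos h).ne'
      exact_mod_cast this
    have e3 : Complex.sin t ≠ 0 := by exact_mod_cast h
    have c1 : Complex.sin t * (2 * Complex.sin t) / (2 - 2 * Complex.cos t) =
        Complex.cos t + 1 := by
      rw [div_eq_iff e1]
      linear_combination 2 * Complex.sin_sq_add_cos_sq (t : ℂ)
    have c2 : Complex.sin t * (4 * Complex.sin (2 * t)) / (2 - 2 * Complex.cos (2 * t)) =
        2 * Complex.cos t := by
      rw [div_eq_iff e2, Complex.sin_two_mul, Complex.cos_two_mul]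
      linear_combination 8 * Complex.cos t * Complex.sin_sq_add_cos_sq (t : ℂ)
    simp only [Pi.mul_apply, partsExpr, map_add, map_mul, map_smul, evC_Delta, smul_eq_mul]
    rw [← map_add, evC_T_one_add]
    push_cast
    linear_combination (-2 * Complex.I * evC t q * weight k t) * (k.1 * c1 + k.2 * c2)

theorem continuous_evC_mul_weight {k : Mult} (hk : Convergent k) (q : Laurent) :
    Continuous (fun t => evC t (Delta * q) * weight k t) := by
  obtain ⟨g, hg, -⟩ := exists_theta_eq q
  refine continuous_iff_continuousAt.2 fun t₀ => ?_
  by_cases h0 : Real.sin t₀ = 0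
  · obtain ⟨σ, C, hσ0, hσ1, hC, h⟩ := exists_norm_weight_le hk
    obtain ⟨M, hM⟩ := exists_norm_evC_le q
    have hM0 : 0 ≤ M := (norm_nonneg _).trans (hM 0)
    have hzero : ∀ t : ℝ, Real.sin t = 0 → evC t (Delta * q) * weight k t = 0 := by
      intro t ht
      rw [map_mul, evC_Delta, ← Complex.ofReal_sin, ht]
      simp
    set G : ℝ → ℝ := fun t => M * C * (|2 * Real.sin (t / 2)| ^ (1 - σ) * |2 * Real.cos (t / 2)|
      + |2 * Real.sin (t / 2)| * |2 * Real.cos (t / 2)| ^ (1 - σ)) with hG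
    have hGc : Continuous G := by
      have e1 : ∀ _ : ℝ, 0 ≤ 1 - σ := fun _ => by linarith
      have c1 : Continuous fun t : ℝ => |2 * Real.sin (t / 2)| := by fun_prop
      have c2 : Continuous fun t : ℝ => |2 * Real.cos (t / 2)| := by fun_prop
      exact continuous_const.mul (((c1.rpow_const fun t => Or.inr (e1 t)).mul c2).add
        (c1.mul (c2.rpow_const fun t => Or.inr (e1 t))))
    have hsin : ∀ t : ℝ, |2 * Real.sin t| = |2 * Real.sin (t / 2)| * |2 * Real.cos (t / 2)| := by
      intro t
      have := Real.sin_two_mul (t / 2)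
      rw [mul_div_cancel₀ t two_ne_zero] at this
      rw [this, ← abs_mul]
      congr 1
      ring
    have hG0 : G t₀ = 0 := by
      have h1 := hsin t₀
      rw [h0, mul_zero, abs_zero] at h1
      have hne : (1 - σ) ≠ 0 := by linarith
      rcases mul_eq_zero.1 h1.symm with h2 | h2
      · simp only [hG, h2, Real.zero_rpow hne]; ring
      · simp only [hG, h2, Real.zero_rpow hne]; ring
    have hle : ∀ t : ℝ, ‖evC t (Delta * q) * weight k t‖ ≤ G t := by
      intro t
      by_cases ht : Real.sin t = 0
      · rw [hzero t ht, norm_zero]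
        positivity
      · have hD : ‖evC t Delta‖ = |2 * Real.sin (t / 2)| * |2 * Real.cos (t / 2)| := by
          rw [← hsin, evC_Delta, ← Complex.ofReal_sin, norm_mul, norm_mul, Complex.norm_I,
            Complex.norm_real, abs_mul]
          simp
        obtain ⟨hX, hY⟩ := abs_half_pos ht
        have hw := h t ht
        rw [map_mul, norm_mul, norm_mul, hD]
        simp only [hG]
        generalize |2 * Real.sin (t / 2)| = X at *
        generalize |2 * Real.cos (t / 2)| = Y at *
        have e1 : X ^ (1 - σ) = X * X ^ (-σ) := by
          rw [sub_eq_add_neg, Real.rpow_add hX, Real.rpow_one]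
        have e2 : Y ^ (1 - σ) = Y * Y ^ (-σ) := by
          rw [sub_eq_add_neg, Real.rpow_add hY, Real.rpow_one]
        calc X * Y * ‖evC t q‖ * ‖weight k t‖
            ≤ X * Y * M * (C * (X ^ (-σ) + Y ^ (-σ))) :=
              mul_le_mul (mul_le_mul_of_nonneg_left (hM t) (by positivity)) hw (norm_nonneg _)
                (by positivity)
          _ = _ := by rw [e1, e2]; ring
    rw [ContinuousAt, hzero t₀ h0]
    refine squeeze_zero_norm hle ?_
    rw [← hG0]
    exact hGc.continuousAt
  · exact (hasDerivAt_evC_mul_weight k hg h0).continuousAt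

theorem integ_partsExpr {k : Mult} (hk : Convergent k) {q g : Laurent}
    (hg : theta (incl q) = incl g) : integ k (partsExpr k q g) = 0 := by
  have h := integral_eq_of_hasDerivAt_off_countable (a := 0) (b := 2 * Real.pi)
    (fun t => evC t (Delta * q) * weight k t)
    (fun t => Complex.I * (evC t (partsExpr k q g) * weight k t)) countable_sin_eq_zero
    (continuous_evC_mul_weight hk q).continuousOn
    (fun t ht => hasDerivAt_evC_mul_weight k hg ht.2)
    ((intervalIntegrable_evC_mul_weight hk _ _ _).const_mul _)
  rw [intervalIntegral.integral_const_mul] at h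
  have e1 : evC (2 * Real.pi) (Delta * q) = 0 := by
    rw [map_mul, evC_Delta, ← Complex.ofReal_sin, Real.sin_two_pi]; simp
  have e2 : evC 0 (Delta * q) = 0 := by
    rw [map_mul, evC_Delta, ← Complex.ofReal_sin, Real.sin_zero]; simp
  rw [e1, e2, zero_mul, zero_mul, sub_zero] at h
  exact (mul_eq_zero.1 h).resolve_left Complex.I_ne_zero

theorem incl_partsExpr (k : Mult) {q g : Laurent} (hg : theta (incl q) = incl g) :
    incl (partsExpr k q g) = (zp 1 - zp (-1)) * theta (incl q)
      + (1 + cst k.1 + 2 * cst k.2) * ((zp 1 + zp (-1)) * incl q) + 2 * cst k.1 * incl q := by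
  simp only [partsExpr, map_add, map_mul, map_smul, Delta, map_sub, hg, zp]
  simp only [cst, Algebra.smul_def, map_add, map_mul, map_one, map_ofNat]

/-- The main tool for computing adjoints. -/
theorem integ_eq_zero_of_symm {k : Mult} (hk : Convergent k) {X q : Laurent}
    (h : incl X + reflHom (incl X) = (zp 1 - zp (-1)) * theta (incl q)
      + (1 + cst k.1 + 2 * cst k.2) * ((zp 1 + zp (-1)) * incl q) + 2 * cst k.1 * incl q) :
    integ k X = 0 := by
  obtain ⟨g, hg, -⟩ := exists_theta_eq q
  rw [← incl_partsExpr k hg, reflHom_incl, ← map_add, incl_inj] at h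
  have h1 := integ_partsExpr hk hg
  rw [← h, integ_add hk, integ_invert] at h1
  exact add_self_eq_zero.1 h1

/-! ### The involution on the localization -/

theorem starL_Delta : starL Delta = -Delta := by
  rw [Delta, map_sub, starL_T, starL_T, neg_neg, neg_sub]

theorem isUnit_starL (y : Submonoid.powers Delta) :
    IsUnit ((incl.toRingHom.comp starL) (y : Laurent)) := by
  obtain ⟨_, n, rfl⟩ := y
  change IsUnit (incl (starL (Delta ^ n)))
  rw [map_pow, map_pow, starL_Delta, map_neg]
  exact ((IsLocalization.Away.algebraMap_isUnit (S := Loc) Delta).neg).pow n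

/-- The extension of `starL` to the localization. -/
def starLoc : Loc →+* Loc :=
  IsLocalization.lift (M := Submonoid.powers Delta) (g := incl.toRingHom.comp starL) isUnit_starL

theorem starLoc_incl (f : Laurent) : starLoc (incl f) = incl (starL f) :=
  IsLocalization.lift_eq (M := Submonoid.powers Delta) _ f

theorem starLoc_zp (n : ℤ) : starLoc (zp n) = zp (-n) := by
  unfold zp
  rw [starLoc_incl, starL_T]

theorem starLoc_dInv : starLoc dInv = -dInv := by
  have h := congrArg starLoc dInv_mul
  rw [map_mul, map_sub, starLoc_zp, starLoc_zp, neg_neg, map_one] at h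
  linear_combination -dInv * h - starLoc dInv * dInv_mul

theorem starLoc_cst (a : ℂ) : starLoc (cst a) = cst ((starRingEnd ℂ) a) := by
  have h : ∀ a, cst a = incl (a • 1) := by
    intro a
    rw [map_smul, map_one, cst, Algebra.algebraMap_eq_smul_one]
  rw [h, h, starLoc_incl, starL_smul, map_one]

theorem starLoc_reflHom (f : Laurent) : starLoc (reflHom (incl f)) = reflHom (incl (starL f)) := by
  rw [reflHom_incl, starLoc_incl, reflHom_incl]
  congr 1
  induction f using laurent_induction with
  | hT n => simp only [starL_T, LaurentPolynomial.invert_T]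
  | hadd f g hf hg => rw [map_add, map_add, map_add, map_add, hf, hg]
  | hsmul a f hf => rw [map_smul, starL_smul, starL_smul, map_smul, hf]

theorem starLoc_theta (f : Laurent) : starLoc (theta (incl f)) = -theta (incl (starL f)) := by
  induction f using laurent_induction with
  | hT n =>
    rw [starL_T]
    change starLoc (theta (zp n)) = -theta (zp (-n))
    rw [theta_zp, theta_zp, Algebra.smul_def, map_mul, starLoc_zp, starLoc_cst]
    simp [Algebra.smul_def]
  | hadd f g hf hg => rw [map_add, map_add, map_add, hf, hg, map_add, map_add, map_add, neg_add]
  | hsmul a f hf =>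
    rw [map_smul, Derivation.map_smul, Algebra.smul_def, map_mul, starLoc_cst, hf, starL_smul,
      map_smul, Derivation.map_smul, Algebra.smul_def, mul_neg]

theorem exists_divDiff_eq (f : Laurent) : ∃ g, divDiff (incl f) = incl g := by
  rw [← mem_Z_univ]
  refine map_mem_Z divDiff (fun m _ => ?_) (mem_Z_univ.2 ⟨f, rfl⟩)
  rcases lt_trichotomy m 0 with h | rfl | h
  · obtain ⟨m, rfl⟩ := exists_eq_of_neg h
    exact Z_mono (Set.subset_univ _) (divDiff_zp_neg_succ_mem m)
  · rw [divDiff_zp_zero]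
    exact zero_mem _
  · obtain ⟨m, rfl⟩ := exists_eq_of_pos h
    exact Z_mono (Set.subset_univ _) (divDiff_zp_succ_mem m)

/-! ### Adjoints of the fundamental operators -/

theorem conj_two : (starRingEnd ℂ) 2 = 2 := map_ofNat _ 2
theorem starLoc_two : starLoc 2 = 2 := map_ofNat starLoc 2

theorem integ_eq_of_symm {k : Mult} (hk : Convergent k) {X Y q : Laurent}
    (h : incl Y - incl X + reflHom (incl Y - incl X) = (zp 1 - zp (-1)) * theta (incl q)
      + (1 + cst k.1 + 2 * cst k.2) * ((zp 1 + zp (-1)) * incl q) + 2 * cst k.1 * incl q) :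
    integ k X = integ k Y := by
  rw [← map_sub] at h
  have h1 := integ_eq_zero_of_symm hk h
  rw [integ_sub hk] at h1
  exact (sub_eq_zero.1 h1).symm

theorem pairing_cherednik {k : Mult} (hk : Convergent k) {f g F H : Laurent}
    (hF : incl F = cherednik (conjMult k) (incl f)) (hH : incl H = cherednik k (incl g)) :
    pairing k F g = pairing k f H := by
  rw [pairing_eq_integ, pairing_eq_integ]
  obtain ⟨q, hq⟩ := exists_divDiff_eq (starL f * g)
  refine integ_eq_of_symm hk (q := q) ?_
  rw [← hq, map_mul, map_mul, ← starLoc_incl F, hF, hH]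
  have h0 := toRat_ne_zero
  have h2 := toRat_sq_sub_one_ne_zero
  have h3 := two_ne_zero_rat
  apply toRat_injective
  simp only [cherednik_apply, divDiff_apply, conjMult, rho, map_add, map_sub, map_mul, map_neg,
    Derivation.leibniz, theta_dInv, starLoc_theta, starLoc_incl, starLoc_zp, starLoc_dInv,
    starLoc_cst, starLoc_reflHom, starLoc_two, conj_two, Complex.conj_conj,
    theta_cst, theta_zp_one, theta_zp_neg_one, theta_two, reflHom_two, map_one,
    Derivation.map_one_eq_zero, reflHom_dInv, reflHom_cst, reflHom_theta, reflHom_reflHom,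
    reflHom_zp, neg_neg, smul_eq_mul, toRat_cst, toRat_two, map_div₀, cstRat_two, map_zero,
    toRat_dInv, toRat_zp_neg, map_pow]
  generalize toRat (theta (reflHom (incl (starL f)))) = a1
  generalize toRat (theta (incl (starL f))) = a2
  generalize toRat (reflHom (incl (starL f))) = a3
  generalize toRat (incl (starL f)) = a4
  generalize toRat (theta (reflHom (incl g))) = b1
  generalize toRat (theta (incl g)) = b2
  generalize toRat (reflHom (incl g)) = b3
  generalize toRat (incl g) = b4
  generalize toRat (zp 1) = z at *
  generalize cstRat k.1 = k1
  generalize cstRat k.2 = k2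
  field_simp
  ring

theorem Convergent.forward {k : Mult} (hk : Convergent k) : Convergent (shiftBy k (0, 1)) := by
  obtain ⟨h1, h2⟩ := hk
  rw [Complex.add_re] at h1
  constructor
  · simp [shiftBy]; linarith
  · simp [shiftBy]; linarith

theorem evC_T_one_sub (t : ℝ) : evC t (2 - LaurentPolynomial.T 1 - LaurentPolynomial.T (-1)) =
    ((2 - 2 * Real.cos t : ℝ) : ℂ) := by
  have h := evC_T_one_add t
  rw [sub_sub, map_sub, h, map_ofNat]
  push_cast
  rfl

theorem two_sub_two_cos_mul (t : ℝ) :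
    2 - 2 * Real.cos (2 * t) = (2 - 2 * Real.cos t) * (2 + 2 * Real.cos t) := by
  rw [Real.cos_two_mul]; ring

theorem evC_T_two_add (t : ℝ) : evC t (2 + LaurentPolynomial.T 1 + LaurentPolynomial.T (-1)) =
    ((2 + 2 * Real.cos t : ℝ) : ℂ) := by
  have h := evC_T_one_add t
  rw [add_assoc, map_add, h, map_ofNat]
  push_cast
  rfl

theorem integ_forward (k : Mult) (h : Laurent) :
    integ (shiftBy k (0, 1)) h = integ k (-(Delta * Delta) * h) := by
  refine integ_congr fun t ht => ?_
  have h1 : ((2 - 2 * Real.cos (2 * t) : ℝ) : ℂ) ≠ 0 :=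
    Complex.ofReal_ne_zero.2 (two_sub_two_cos_two_mul_pos ht).ne'
  have h2 : evC t (-(Delta * Delta)) = ((2 - 2 * Real.cos (2 * t) : ℝ) : ℂ) := by
    rw [map_neg, map_mul, evC_Delta, two_sub_two_cos_two_mul']
    push_cast
    linear_combination -4 * Complex.sin t ^ 2 * Complex.I_mul_I
  rw [map_mul, h2]
  simp only [weight, shiftBy, Int.cast_zero, Int.cast_one, add_zero]
  rw [Complex.cpow_add _ _ h1, Complex.cpow_one]
  ring

theorem pairing_calGPlus {k : Mult} (hk : Convergent k) {k₀ : Mult} {f g F H : Laurent}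
    (hF : incl F = calGPlus k₀ (incl f))
    (hH : incl H = calGMinus (shiftBy k (0, 1)) (incl g)) :
    pairing (shiftBy k (0, 1)) F g = pairing k f H := by
  rw [pairing_eq_integ, pairing_eq_integ, integ_forward]
  refine integ_eq_of_symm hk (q := starL f * g + LaurentPolynomial.invert (starL f * g)) ?_
  have hD : incl Delta = zp 1 - zp (-1) := map_sub _ _ _
  rw [map_add, ← reflHom_incl, map_mul, map_mul, map_mul, map_neg, map_mul, hD, ← starLoc_incl F,
    hF, hH]
  have h0 := toRat_ne_zero
  have h2 := toRat_sq_sub_one_ne_zero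
  have h3 := two_ne_zero_rat
  apply toRat_injective
  simp only [calGPlus_apply, calGMinus_apply, shiftBy, map_add, map_sub, map_mul, map_neg,
    Derivation.leibniz, theta_dInv, starLoc_theta, starLoc_incl, starLoc_zp, starLoc_dInv,
    starLoc_cst, starLoc_reflHom, starLoc_two, conj_two, Complex.conj_conj,
    theta_cst, theta_zp_one, theta_zp_neg_one, theta_two, reflHom_two, map_one,
    Derivation.map_one_eq_zero, reflHom_dInv, reflHom_cst, reflHom_theta, reflHom_reflHom,
    reflHom_zp, neg_neg, smul_eq_mul, toRat_cst, toRat_two, map_div₀, cstRat_two, map_zero,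
    toRat_dInv, toRat_zp_neg, map_pow, Int.cast_zero, Int.cast_one]
  generalize toRat (theta (reflHom (incl (starL f)))) = a1
  generalize toRat (theta (incl (starL f))) = a2
  generalize toRat (reflHom (incl (starL f))) = a3
  generalize toRat (incl (starL f)) = a4
  generalize toRat (theta (reflHom (incl g))) = b1
  generalize toRat (theta (incl g)) = b2
  generalize toRat (reflHom (incl g)) = b3
  generalize toRat (incl g) = b4
  generalize toRat (zp 1) = z at *
  generalize cstRat k.1 = k1
  generalize cstRat k.2 = k2
  field_simp
  ring

/-- The multiplicity with weight `δ_k / (2 + z + z⁻¹)`. -/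
def halfShift (k : Mult) : Mult := (k.1 + 1, k.2 - 1)

theorem integ_eq_halfShift (k : Mult) (h : Laurent) : integ k h =
    integ (halfShift k) ((2 + LaurentPolynomial.T 1 + LaurentPolynomial.T (-1)) * h) := by
  refine integ_congr fun t ht => ?_
  have h1 : ((2 - 2 * Real.cos (2 * t) : ℝ) : ℂ) ≠ 0 :=
    Complex.ofReal_ne_zero.2 (two_sub_two_cos_two_mul_pos ht).ne'
  have h2 : ((2 - 2 * Real.cos t : ℝ) : ℂ) ≠ 0 :=
    Complex.ofReal_ne_zero.2 (two_sub_two_cos_pos ht).ne'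
  rw [map_mul, evC_T_two_add]
  simp only [weight, halfShift]
  rw [Complex.cpow_add _ _ h2, Complex.cpow_sub _ _ h1, Complex.cpow_one, Complex.cpow_one]
  have h3 := congrArg (fun x : ℝ => (x : ℂ)) (two_sub_two_cos_mul t)
  simp only [Complex.ofReal_mul (2 - 2 * Real.cos t)] at h3
  have h4 : ((2 - 2 * Real.cos t : ℝ) : ℂ) * ((2 + 2 * Real.cos t : ℝ) : ℂ) /
      ((2 - 2 * Real.cos (2 * t) : ℝ) : ℂ) = 1 := by rw [h3, div_self (h3 ▸ h1)]
  generalize ((2 - 2 * Real.cos (2 * t) : ℝ) : ℂ) ^ k.2 = y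
  linear_combination (-evC t h * ((2 - 2 * Real.cos t : ℝ) : ℂ) ^ k.1 * y) * h4

theorem integ_contig_eq_halfShift (k : Mult) (h : Laurent) : integ (shiftBy k (2, -1)) h =
    integ (halfShift k) ((2 - LaurentPolynomial.T 1 - LaurentPolynomial.T (-1)) * h) := by
  refine integ_congr fun t ht => ?_
  have h2 : ((2 - 2 * Real.cos t : ℝ) : ℂ) ≠ 0 :=
    Complex.ofReal_ne_zero.2 (two_sub_two_cos_pos ht).ne'
  rw [map_mul, evC_T_one_sub]
  have e : k.1 + ((2 : ℤ) : ℂ) = k.1 + 1 + 1 := by push_cast; ring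
  have e2 : k.2 + ((-1 : ℤ) : ℂ) = k.2 - 1 := by push_cast; ring
  simp only [weight, halfShift, shiftBy]
  rw [e, e2, Complex.cpow_add _ _ h2, Complex.cpow_one]
  ring

theorem pairing_calEPlus {k : Mult} (hk : Convergent k) (hk' : Convergent (shiftBy k (2, -1)))
    {f g F H : Laurent} (hF : incl F = calEPlus (conjMult k) (incl f))
    (hH : incl H = calEMinus (shiftBy k (2, -1)) (incl g)) :
    pairing (shiftBy k (2, -1)) F g = pairing k f H := by
  have hc : Convergent (halfShift k) := by
    refine ⟨?_, ?_⟩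
    · have := hk.1
      simp only [halfShift]
      rwa [add_add_sub_cancel]
    · have := hk'.2
      simp only [shiftBy, halfShift] at this ⊢
      push_cast at this
      rwa [← sub_eq_add_neg] at this
  rw [pairing_eq_integ, pairing_eq_integ, integ_contig_eq_halfShift, integ_eq_halfShift k]
  refine integ_eq_of_symm hc (q := starL f * g + LaurentPolynomial.invert (starL f * g)) ?_
  have e1 : incl (2 - LaurentPolynomial.T 1 - LaurentPolynomial.T (-1)) = 2 - zp 1 - zp (-1) := by
    rw [map_sub, map_sub, map_ofNat]; rfl
  have e2 : incl (2 + LaurentPolynomial.T 1 + LaurentPolynomial.T (-1)) = 2 + zp 1 + zp (-1) := by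
    rw [map_add, map_add, map_ofNat]; rfl
  rw [map_add, ← reflHom_incl, map_mul, map_mul, map_mul, map_mul, map_mul, e1, e2,
    ← starLoc_incl F, hF, hH]
  have h0 := toRat_ne_zero
  have h2 := toRat_sq_sub_one_ne_zero
  have h3 := two_ne_zero_rat
  apply toRat_injective
  simp only [calEPlus_apply, calEMinus_apply, shiftBy, halfShift, conjMult, map_add, map_sub,
    map_mul, map_neg,
    Derivation.leibniz, theta_dInv, starLoc_theta, starLoc_incl, starLoc_zp, starLoc_dInv,
    starLoc_cst, starLoc_reflHom, starLoc_two, conj_two, Complex.conj_conj,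
    theta_cst, theta_zp_one, theta_zp_neg_one, theta_two, reflHom_two, map_one,
    Derivation.map_one_eq_zero, reflHom_dInv, reflHom_cst, reflHom_theta, reflHom_reflHom,
    reflHom_zp, neg_neg, smul_eq_mul, toRat_cst, toRat_two, map_div₀, cstRat_two, map_zero,
    toRat_dInv, toRat_zp_neg, map_pow, Int.cast_neg, Int.cast_one, Int.cast_ofNat]
  generalize toRat (theta (reflHom (incl (starL f)))) = a1
  generalize toRat (theta (incl (starL f))) = a2
  generalize toRat (reflHom (incl (starL f))) = a3
  generalize toRat (incl (starL f)) = a4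
  generalize toRat (theta (reflHom (incl g))) = b1
  generalize toRat (theta (incl g)) = b2
  generalize toRat (reflHom (incl g)) = b3
  generalize toRat (incl g) = b4
  generalize toRat (zp 1) = z at *
  generalize cstRat k.1 = k1
  generalize cstRat k.2 = k2
  field_simp
  ring

/-! ### Adjoints of compositions -/

theorem conjMult_conjMult (k : Mult) : conjMult (conjMult k) = k := by simp [conjMult]

theorem conjMult_shiftBy (k : Mult) (l : ℤ × ℤ) :
    conjMult (shiftBy k l) = shiftBy (conjMult k) l := by simp [conjMult, shiftBy]

theorem convergent_shiftBy {k : Mult} {l : ℤ × ℤ} : Convergent (shiftBy k l) ↔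
    -(1 / 2) < k.1.re + k.2.re + l.1 + l.2 ∧ -(1 / 2) < k.2.re + l.2 := by
  have e : k.1.re + (l.1 : ℝ) + (k.2.re + (l.2 : ℝ)) = k.1.re + k.2.re + l.1 + l.2 := by ring
  simp [Convergent, shiftBy, e]

theorem convergent_iff {k : Mult} : Convergent k ↔
    -(1 / 2) < k.1.re + k.2.re ∧ -(1 / 2) < k.2.re := by
  simp [Convergent]

theorem Convergent.conj {k : Mult} (hk : Convergent k) : Convergent (conjMult k) := by
  rw [convergent_iff] at hk ⊢
  simpa [conjMult] using hk

/-- `S'` is the formal adjoint of the operator `S` of shift `ℓ`, at the multiplicity `k`. -/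
def IsAdj (l : ℤ × ℤ) (k : Mult) (S S' : Op) : Prop :=
  ∀ f g F H : Laurent, incl F = S (incl f) → incl H = S' (incl g) →
    pairing (shiftBy (conjMult k) l) F g = pairing (conjMult k) f H

theorem IsAdj.symm {l : ℤ × ℤ} {k : Mult} {S S' : Op} (h : IsAdj l k S S') :
    IsAdj (-l) (shiftBy (conjMult k) l) S' S := by
  intro f g F H hF hH
  have e := congrArg (starRingEnd ℂ) (h g f H F hH hF)
  rw [conj_pairing, conj_pairing, conjMult_shiftBy, conjMult_conjMult] at e
  rw [conjMult_shiftBy, conjMult_conjMult, shiftBy_shiftBy, add_neg_cancel, shiftBy_zero, e]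

theorem IsAdj.one (k : Mult) : IsAdj 0 k 1 1 := by
  intro f g F H hF hH
  rw [incl_injective hF, incl_injective hH, shiftBy_zero]

theorem IsAdj.mul {l m : ℤ × ℤ} {k : Mult} {S S' R R' : Op} (hS : IsAdj l k S S')
    (hR : IsAdj m (shiftBy k l) R R') (h1 : ∀ f : Laurent, ∃ g : Laurent, S (incl f) = incl g)
    (h2 : ∀ f : Laurent, ∃ g : Laurent, R' (incl f) = incl g) :
    IsAdj (l + m) k (R * S) (S' * R') := by
  intro f g F H hF hH
  obtain ⟨f', hf'⟩ := h1 f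
  obtain ⟨g', hg'⟩ := h2 g
  rw [Module.End.mul_apply, hf'] at hF
  rw [Module.End.mul_apply, hg'] at hH
  have e1 := hR f' g F g' hF hg'.symm
  have e2 := hS f g' f' H hf'.symm hH
  rw [conjMult_shiftBy, shiftBy_shiftBy] at e1
  rw [e1, e2]

/-- The families `S` and `S'`, of shifts `d` and `-d`, are adjoint to each other. -/
def AdjFamilies (d : ℤ × ℤ) (S S' : Mult → Op) : Prop :=
  ∀ k, Convergent k → Convergent (shiftBy k d) → IsAdj d k (S k) (S' (shiftBy (conjMult k) d))

theorem AdjFamilies.symm {d : ℤ × ℤ} {S S' : Mult → Op} (h : AdjFamilies d S S') :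
    AdjFamilies (-d) S' S := by
  intro k h1 h2
  have h3 := (h (shiftBy (conjMult k) (-d)) (by rw [← conjMult_shiftBy]; exact h2.conj)
    (by rw [shiftBy_shiftBy, neg_add_cancel, shiftBy_zero]; exact h1.conj)).symm
  rwa [conjMult_shiftBy, conjMult_conjMult, shiftBy_shiftBy, neg_add_cancel, shiftBy_zero] at h3

theorem adjFamilies_calG : AdjFamilies (0, 1) calGPlus calGMinus := by
  intro k hk _ f g F H hF hH
  exact pairing_calGPlus hk.conj hF hH

theorem adjFamilies_calE : AdjFamilies (2, -1) calEPlus calEMinus := by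
  intro k hk hk' f g F H hF hH
  have h := hk'.conj
  rw [conjMult_shiftBy] at h
  exact pairing_calEPlus hk.conj h (by rwa [conjMult_conjMult]) hH

theorem chain_succ_right (S : Mult → Op) (d : ℤ × ℤ) (k : Mult) (N : ℕ) :
    chain S d k (N + 1) = chain S d (shiftBy k d) N * S k := by
  induction N with
  | zero => simp [chain, shiftBy_zero]
  | succ N ih =>
    rw [chain, ih, chain, shiftBy_shiftBy, mul_assoc]
    congr 3
    rw [Nat.cast_succ, add_smul, one_smul, add_comm]

theorem Convergent.segment {k : Mult} {d : ℤ × ℤ} {N j : ℕ} (h0 : Convergent k)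
    (h1 : Convergent (shiftBy k ((N : ℤ) • d))) (hj : j ≤ N) :
    Convergent (shiftBy k ((j : ℤ) • d)) := by
  have key : ∀ a b : ℝ, -(1 / 2) < a → -(1 / 2) < a + N * b → -(1 / 2) < a + j * b := by
    intro a b h2 h3
    have h4 : (j : ℝ) ≤ N := by exact_mod_cast hj
    have h5 : (0 : ℝ) ≤ j := j.cast_nonneg
    rcases le_total 0 b with hb | hb
    · nlinarith
    · nlinarith
  rw [convergent_iff] at h0
  rw [convergent_shiftBy] at h1 ⊢
  simp only [Prod.smul_fst, Prod.smul_snd, smul_eq_mul, Int.cast_mul, Int.cast_natCast] at h1 ⊢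
  constructor
  · have := key (k.1.re + k.2.re) (d.1 + d.2) h0.1 (by linarith [h1.1])
    linarith
  · exact key _ _ h0.2 h1.2

theorem isAdj_chain {d : ℤ × ℤ} {S S' : Mult → Op} (h : AdjFamilies d S S')
    (hS : ∀ k, IsNonsymShiftOp d k (S k)) (hS' : ∀ k, IsNonsymShiftOp (-d) k (S' k)) {k : Mult}
    (N : ℕ) (h0 : Convergent k) (h1 : Convergent (shiftBy k ((N : ℤ) • d))) :
    IsAdj ((N : ℤ) • d) k (chain S d k N) (chain S' (-d) (shiftBy (conjMult k) ((N : ℤ) • d)) N) := by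
  induction N with
  | zero =>
    rw [Nat.cast_zero, zero_smul]
    exact .one k
  | succ N ih =>
    have h2 := h0.segment h1 N.le_succ
    have e : ((N + 1 : ℕ) : ℤ) • d = (N : ℤ) • d + d := by
      rw [Nat.cast_succ, add_smul, one_smul]
    have h3 := (ih h2).mul (h _ h2 (by rwa [shiftBy_shiftBy, ← e]))
      (isNonsymShiftOp_chain hS k N).maps_laurent (hS' _).maps_laurent
    rw [chain_succ_right S', shiftBy_shiftBy, e, add_neg_cancel_right]
    rwa [conjMult_shiftBy, shiftBy_shiftBy] at h3

theorem isAdj_contigPart (m : ℤ) {k : Mult} (h0 : Convergent k)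
    (h1 : Convergent (shiftBy k (m • (2, -1)))) : IsAdj (m • (2, -1)) k (contigPart m k)
      (contigPart (-m) (shiftBy (conjMult k) (m • (2, -1)))) := by
  rcases lt_trichotomy m 0 with h | rfl | h
  · have e := natAbs_smul_of_neg h.not_ge (-2, 1)
    rw [Prod.neg_mk, neg_neg] at e
    rw [contigPart, contigPart, if_neg h.not_ge, if_pos (by omega), Int.natAbs_neg, ← e]
    rw [← e] at h1
    exact isAdj_chain adjFamilies_calE.symm isNonsymShiftOp_calEMinus isNonsymShiftOp_calEPlus _ h0 h1
  · rw [neg_zero, zero_smul]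
    exact .one k
  · have e := natAbs_smul_of_nonneg h.le (2, -1)
    rw [contigPart, contigPart, if_pos h.le, if_neg (by omega), Int.natAbs_neg, ← e]
    rw [← e] at h1
    exact isAdj_chain adjFamilies_calE isNonsymShiftOp_calEPlus isNonsymShiftOp_calEMinus _ h0 h1

theorem isAdj_shiftPart (r : ℤ) {k : Mult} (h0 : Convergent k)
    (h1 : Convergent (shiftBy k (r • (0, 1)))) : IsAdj (r • (0, 1)) k (shiftPart r k)
      (shiftPart (-r) (shiftBy (conjMult k) (r • (0, 1)))) := by
  rcases lt_trichotomy r 0 with h | rfl | h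
  · have e := natAbs_smul_of_neg h.not_ge (0, -1)
    rw [Prod.neg_mk, neg_neg, neg_zero] at e
    rw [shiftPart, shiftPart, if_neg h.not_ge, if_pos (by omega), Int.natAbs_neg, ← e]
    rw [← e] at h1
    exact isAdj_chain adjFamilies_calG.symm isNonsymShiftOp_calGMinus isNonsymShiftOp_calGPlus _ h0 h1
  · rw [neg_zero, zero_smul]
    exact .one k
  · have e := natAbs_smul_of_nonneg h.le (0, 1)
    rw [shiftPart, shiftPart, if_pos h.le, if_neg (by omega), Int.natAbs_neg, ← e]
    rw [← e] at h1
    exact isAdj_chain adjFamilies_calG isNonsymShiftOp_calGPlus isNonsymShiftOp_calGMinus _ h0 h1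

/-! ### Commutation of backward shift operators and contiguity operators -/

theorem mul_chain_comm {A B : Mult → Op} {a b : ℤ × ℤ}
    (h : ∀ k, A (shiftBy k b) * B k = B (shiftBy k a) * A k) (k : Mult) (M : ℕ) :
    A (shiftBy k ((M : ℤ) • b)) * chain B b k M = chain B b (shiftBy k a) M * A k := by
  induction M with
  | zero => simp [chain, shiftBy_zero]
  | succ M ih =>
    have e : ((M + 1 : ℕ) : ℤ) • b = (M : ℤ) • b + b := by
      rw [Nat.cast_succ, add_smul, one_smul]
    rw [chain, chain, e, ← shiftBy_shiftBy, ← mul_assoc, h, mul_assoc, ih, ← mul_assoc,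
      shiftBy_shiftBy, shiftBy_shiftBy, add_comm a]

theorem chain_comm {A B : Mult → Op} {a b : ℤ × ℤ}
    (h : ∀ k, A (shiftBy k b) * B k = B (shiftBy k a) * A k) (k : Mult) (N M : ℕ) :
    chain A a (shiftBy k ((M : ℤ) • b)) N * chain B b k M =
      chain B b (shiftBy k ((N : ℤ) • a)) M * chain A a k N := by
  induction N with
  | zero => simp [chain, shiftBy_zero]
  | succ N ih =>
    have e : ((N + 1 : ℕ) : ℤ) • a = (N : ℤ) • a + a := by
      rw [Nat.cast_succ, add_smul, one_smul]
    rw [chain, chain, mul_assoc, ih, ← mul_assoc, shiftBy_shiftBy, add_comm, ← shiftBy_shiftBy,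
      mul_chain_comm h, mul_assoc, e, shiftBy_shiftBy]

theorem contigPart_mul_shiftPart {r : ℤ} (hr : r ≤ 0) (m : ℤ) (k : Mult) :
    contigPart m (shiftBy k (r • (0, 1))) * shiftPart r k =
      shiftPart r (shiftBy k (m • (2, -1))) * contigPart m k := by
  rcases hr.lt_or_eq with hr | rfl
  · have er := natAbs_smul_of_neg hr.not_ge (0, -1)
    rw [Prod.neg_mk, neg_neg, neg_zero] at er
    rw [shiftPart, shiftPart, if_neg hr.not_ge, if_neg hr.not_ge, contigPart, contigPart, ← er]
    split_ifs with hm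
    · rw [← natAbs_smul_of_nonneg hm]
      exact chain_comm (fun k => LinearMap.ext (calEPlus_calGMinus_apply k)) k _ _
    · have em := natAbs_smul_of_neg hm (-2, 1)
      rw [Prod.neg_mk, neg_neg] at em
      rw [← em]
      exact chain_comm (fun k => LinearMap.ext (calEMinus_calGMinus_apply k)) k _ _
  · have e : ∀ k, shiftPart 0 k = 1 := fun k => rfl
    rw [e, e, zero_smul, shiftBy_zero, one_mul, mul_one]

theorem shift_decomp' {l : ℤ × ℤ} (hl : Even l.1) :
    rhoZ l • ((0, 1) : ℤ × ℤ) + (l.1 / 2) • ((2, -1) : ℤ × ℤ) = l := by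
  rw [smul_zero_one, shift_decomp hl]

theorem isAdj_calG {l : ℤ × ℤ} (hl : Even l.1) {k : Mult} (h0 : Convergent k)
    (h1 : Convergent (shiftBy k l)) :
    IsAdj l k (calG l k) (calG (-l) (shiftBy (conjMult k) l)) := by
  have hd := shift_decomp' hl
  have hm : (-l).1 / 2 = -(l.1 / 2) := by
    obtain ⟨m, hm⟩ := hl
    rw [Prod.fst_neg]
    omega
  have hr : rhoZ (-l) = -rhoZ l := by
    simp only [rhoZ, hm, Prod.snd_neg]
    ring
  rw [calG_eq, calG_eq, hm, hr, ← smul_zero_one (rhoZ l), ← smul_zero_one (-rhoZ l)]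
  generalize l.1 / 2 = m at *
  generalize rhoZ l = r at *
  subst hd
  have h0' := convergent_iff.1 h0
  have h1' := convergent_shiftBy.1 h1
  simp only [Prod.fst_add, Prod.snd_add, Prod.smul_fst, Prod.smul_snd, smul_eq_mul, mul_zero,
    mul_one, zero_add, Int.cast_add, Int.cast_mul, Int.cast_ofNat, Int.cast_neg,
    Int.cast_one] at h1'
  by_cases hr0 : 0 ≤ r
  · have hr' : (0 : ℝ) ≤ r := by exact_mod_cast hr0
    have h2 : Convergent (shiftBy k (r • (0, 1))) := by
      rw [convergent_shiftBy]
      simp only [Prod.smul_fst, Prod.smul_snd, smul_eq_mul, mul_zero, mul_one, Int.cast_zero]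
      constructor <;> linarith
    have h3 := (isAdj_shiftPart r h0 h2).mul (isAdj_contigPart m h2 (by rwa [shiftBy_shiftBy]))
      (isNonsymShiftOp_shiftPart r k).maps_laurent (isNonsymShiftOp_contigPart _ _).maps_laurent
    rw [contigPart_mul_shiftPart (r := -r) (by omega), shiftBy_shiftBy _ _ (-m • _), neg_smul m,
      add_neg_cancel_right]
    rwa [conjMult_shiftBy, shiftBy_shiftBy] at h3
  · have hr' : (r : ℝ) ≤ 0 := by exact_mod_cast (not_le.1 hr0).le
    have h2 : Convergent (shiftBy k (m • (2, -1))) := by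
      rw [convergent_shiftBy]
      simp only [Prod.smul_fst, Prod.smul_snd, smul_eq_mul, Int.cast_mul, Int.cast_ofNat,
        Int.cast_neg, Int.cast_one]
      constructor <;> linarith
    have h3 := (isAdj_contigPart m h0 h2).mul
      (isAdj_shiftPart r h2 (by rwa [shiftBy_shiftBy, add_comm]))
      (isNonsymShiftOp_contigPart _ _).maps_laurent (isNonsymShiftOp_shiftPart _ _).maps_laurent
    rw [contigPart_mul_shiftPart (r := r) (by omega), shiftBy_shiftBy _ _ (-r • _), add_comm (r • _), neg_smul r,
      add_neg_cancel_right]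
    rw [conjMult_shiftBy, shiftBy_shiftBy] at h3
    exact h3

theorem pairing_add_right {k : Mult} (hk : Convergent k) (f g h : Laurent) :
    pairing k f (g + h) = pairing k f g + pairing k f h := by
  rw [pairing_eq_integ, mul_add, integ_add hk, pairing_eq_integ, pairing_eq_integ]

theorem pairing_add_left {k : Mult} (hk : Convergent k) (f g h : Laurent) :
    pairing k (f + g) h = pairing k f h + pairing k g h := by
  rw [pairing_eq_integ, map_add, add_mul, integ_add hk, pairing_eq_integ, pairing_eq_integ]

theorem pairing_smul_right (k : Mult) (a : ℂ) (f g : Laurent) :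
    pairing k f (a • g) = a * pairing k f g := by
  rw [pairing_eq_integ, mul_smul_comm, integ_smul, pairing_eq_integ]

theorem pairing_smul_left (k : Mult) (a : ℂ) (f g : Laurent) :
    pairing k (a • f) g = (starRingEnd ℂ) a * pairing k f g := by
  rw [pairing_eq_integ, starL_smul, smul_mul_assoc, integ_smul, pairing_eq_integ]

theorem pairing_zero_right (k : Mult) (f : Laurent) : pairing k f 0 = 0 := by
  rw [← zero_smul ℂ (0 : Laurent), pairing_smul_right, zero_mul]

theorem pairing_sub_right {k : Mult} (hk : Convergent k) (f g h : Laurent) :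
    pairing k f (g - h) = pairing k f g - pairing k f h := by
  rw [sub_eq_add_neg, ← neg_one_smul ℂ h, pairing_add_right hk, pairing_smul_right]
  ring

theorem pairing_sum_right {k : Mult} (hk : Convergent k) {ι : Type*} (t : Finset ι) (f : Laurent)
    (g : ι → Laurent) : pairing k f (∑ i ∈ t, g i) = ∑ i ∈ t, pairing k f (g i) := by
  classical
  induction t using Finset.induction_on with
  | empty => rw [Finset.sum_empty, Finset.sum_empty, pairing_zero_right]
  | insert i t hi ih =>
    rw [Finset.sum_insert hi, Finset.sum_insert hi, pairing_add_right hk, ih]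

theorem isAdj_cherednik {k : Mult} (hk : Convergent k) :
    IsAdj 0 k (cherednik k) (cherednik (conjMult k)) := by
  intro f g F H hF hH
  rw [shiftBy_zero]
  exact pairing_cherednik hk.conj (by rwa [conjMult_conjMult]) hH

theorem isAdj_cherednik_pow {k : Mult} (hk : Convergent k) (n : ℕ) :
    IsAdj 0 k (cherednik k ^ n) (cherednik (conjMult k) ^ n) := by
  induction n with
  | zero => exact .one k
  | succ n ih =>
    have h := (isAdj_cherednik hk).mul (m := 0) (R := cherednik k ^ n)
      (R' := cherednik (conjMult k) ^ n) (by rwa [shiftBy_zero])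
      (isNonsymShiftOp_cherednik k).maps_laurent (fun f => ?_)
    · rw [add_zero] at h
      rwa [pow_succ, pow_succ']
    · have h2 := (isNonsymShiftOp_aeval (conjMult k) (Polynomial.X ^ n)).maps_laurent f
      rwa [map_pow, Polynomial.aeval_X] at h2

theorem isAdj_aeval {k : Mult} (hk : Convergent k) (p : Polynomial ℂ) :
    IsAdj 0 k (Polynomial.aeval (cherednik k) p)
      (Polynomial.aeval (cherednik (conjMult k)) (p.map (starRingEnd ℂ))) := by
  induction p using Polynomial.induction_on' with
  | add p q hp hq =>
    intro f g F H hF hH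
    obtain ⟨F1, hF1⟩ := (isNonsymShiftOp_aeval k p).maps_laurent f
    obtain ⟨F2, hF2⟩ := (isNonsymShiftOp_aeval k q).maps_laurent f
    obtain ⟨H1, hH1⟩ := (isNonsymShiftOp_aeval (conjMult k) (p.map (starRingEnd ℂ))).maps_laurent g
    obtain ⟨H2, hH2⟩ := (isNonsymShiftOp_aeval (conjMult k) (q.map (starRingEnd ℂ))).maps_laurent g
    rw [map_add, LinearMap.add_apply, hF1, hF2, ← map_add, incl_inj] at hF
    rw [Polynomial.map_add, map_add, LinearMap.add_apply, hH1, hH2, ← map_add, incl_inj] at hH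
    have e1 := hp f g F1 H1 hF1.symm hH1.symm
    have e2 := hq f g F2 H2 hF2.symm hH2.symm
    rw [shiftBy_zero] at e1 e2 ⊢
    rw [hF, hH, pairing_add_left hk.conj, pairing_add_right hk.conj, e1, e2]
  | monomial n a =>
    intro f g F H hF hH
    have hn : ∀ (k : Mult) (f : Laurent), ∃ g, (cherednik k ^ n) (incl f) = incl g := by
      intro k f
      have h2 := (isNonsymShiftOp_aeval k (Polynomial.X ^ n)).maps_laurent f
      rwa [map_pow, Polynomial.aeval_X] at h2
    obtain ⟨F1, hF1⟩ := hn k f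
    obtain ⟨H1, hH1⟩ := hn (conjMult k) g
    rw [Polynomial.aeval_monomial, ← Algebra.smul_def, LinearMap.smul_apply, hF1, ← map_smul,
      incl_inj] at hF
    rw [Polynomial.map_monomial, Polynomial.aeval_monomial, ← Algebra.smul_def,
      LinearMap.smul_apply, hH1, ← map_smul, incl_inj] at hH
    rw [hF, hH, pairing_smul_left, pairing_smul_right,
      isAdj_cherednik_pow hk n f g F1 H1 hF1.symm hH1.symm]

theorem aeval_mul_comm {S D D' : Op} (h : S * D = D' * S) (p : Polynomial ℂ) :
    S * Polynomial.aeval D p = Polynomial.aeval D' p * S := by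
  induction p using Polynomial.induction_on' with
  | add p q hp hq => rw [map_add, map_add, mul_add, add_mul, hp, hq]
  | monomial n a =>
    have key : S * D ^ n = D' ^ n * S := (SemiconjBy.pow_right (a := S) h n).eq
    rw [Polynomial.aeval_monomial, Polynomial.aeval_monomial, ← Algebra.smul_def,
      ← Algebra.smul_def, mul_smul_comm, smul_mul_assoc, key]

theorem isAdj_shiftOp {l : ℤ × ℤ} (hl : Even l.1) (p : Polynomial ℂ) {k : Mult}
    (h0 : Convergent k) (h1 : Convergent (shiftBy k l)) :
    IsAdj l k (shiftOp l k p)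
      (shiftOp (-l) (shiftBy (conjMult k) l) (p.map (starRingEnd ℂ))) := by
  have hl' : Even (-l).1 := by rw [Prod.fst_neg]; exact hl.neg
  have h := (isAdj_aeval h0 p).mul (m := l) (R := calG l k)
    (R' := calG (-l) (shiftBy (conjMult k) l)) (by rw [shiftBy_zero]; exact isAdj_calG hl h0 h1)
    (isNonsymShiftOp_aeval k p).maps_laurent (isNonsymShiftOp_calG hl' _).maps_laurent
  have ht := (isNonsymShiftOp_calG hl' (shiftBy (conjMult k) l)).transmutation
  rw [shiftBy_shiftBy, add_neg_cancel, shiftBy_zero] at ht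
  rw [zero_add, ← aeval_mul_comm ht] at h
  exact h

/-! ### Positivity of the pairing for real multiplicities -/

theorem integral_exp_int (m : ℤ) : ∫ t in (0 : ℝ)..(2 * Real.pi), Complex.exp (m * t * Complex.I) =
    if m = 0 then (2 * Real.pi : ℂ) else 0 := by
  split_ifs with h
  · subst h
    simp
  · have hc : (m : ℂ) * Complex.I ≠ 0 :=
      mul_ne_zero (by exact_mod_cast h) Complex.I_ne_zero
    have h1 := integral_exp_mul_complex (a := 0) (b := 2 * Real.pi) hc
    have h2 : Complex.exp ((m : ℂ) * Complex.I * ((2 * Real.pi : ℝ) : ℂ)) = 1 := by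
      rw [Complex.exp_eq_one_iff]
      exact ⟨m, by push_cast; ring⟩
    rw [h2, Complex.ofReal_zero, mul_zero, Complex.exp_zero, sub_self, zero_div] at h1
    rw [← h1]
    congr 1
    ext t
    ring_nf

theorem integral_evC (n : ℤ) (f : Laurent) :
    ∫ t in (0 : ℝ)..(2 * Real.pi), evC t (LaurentPolynomial.T (-n) * f) =
      2 * Real.pi * f.coeff n := by
  induction f using laurent_induction with
  | hT m =>
    simp only [← LaurentPolynomial.T_add, evC_T]
    rw [integral_exp_int, LaurentPolynomial.T_apply]
    by_cases h : m = n
    · subst h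
      simp
    · rw [if_neg h, if_neg (by omega), mul_zero]
  | hadd f g hf hg =>
    simp only [mul_add, map_add]
    rw [intervalIntegral.integral_add ((continuous_evC _).intervalIntegrable _ _)
      ((continuous_evC _).intervalIntegrable _ _), hf, hg, AddMonoidAlgebra.coeff_add,
      Finsupp.add_apply, mul_add]
  | hsmul a f hf =>
    simp only [mul_smul_comm, map_smul]
    rw [intervalIntegral.integral_smul, hf, AddMonoidAlgebra.coeff_smul_apply, smul_eq_mul,
      smul_eq_mul]
    ring

theorem weight_realMult (k : ℝ × ℝ) (t : ℝ) : weight (realMult k) t =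
    (((2 - 2 * Real.cos t) ^ k.1 * (2 - 2 * Real.cos (2 * t)) ^ k.2 : ℝ) : ℂ) := by
  rw [Complex.ofReal_mul, Complex.ofReal_cpow (two_sub_two_cos_nonneg _),
    Complex.ofReal_cpow (two_sub_two_cos_nonneg _)]
  rfl

theorem eq_zero_of_pairing_self {k : ℝ × ℝ} (hk : Convergent (realMult k)) {f : Laurent}
    (h : pairing (realMult k) f f = 0) : f = 0 := by
  set w : ℝ → ℝ := fun t => (2 - 2 * Real.cos t) ^ k.1 * (2 - 2 * Real.cos (2 * t)) ^ k.2 with hw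
  have e : ∀ t : ℝ, evC t (starL f * f) * weight (realMult k) t =
      ((Complex.normSq (evC t f) * w t : ℝ) : ℂ) := by
    intro t
    rw [map_mul, evC_starL, ← Complex.normSq_eq_conj_mul_self, weight_realMult]
    exact (Complex.ofReal_mul _ _).symm
  have hi := intervalIntegrable_evC_mul_weight hk (starL f * f) 0 (2 * Real.pi)
  rw [pairing_eq_integ, integ] at h
  simp only [e] at h hi
  rw [intervalIntegral.integral_ofReal, Complex.ofReal_eq_zero] at h
  have hi' : IntervalIntegrable (fun t => Complex.normSq (evC t f) * w t) volume 0
      (2 * Real.pi) := by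
    have := hi.norm
    refine this.congr fun t _ => ?_
    rw [Complex.norm_real, Real.norm_of_nonneg]
    exact mul_nonneg (Complex.normSq_nonneg _) (mul_nonneg
      (Real.rpow_nonneg (two_sub_two_cos_nonneg _) _)
      (Real.rpow_nonneg (two_sub_two_cos_nonneg _) _))
  rw [intervalIntegral.integral_eq_zero_iff_of_le_of_nonneg_ae (by positivity)
    (Filter.Eventually.of_forall fun t => mul_nonneg (Complex.normSq_nonneg _) (mul_nonneg
      (Real.rpow_nonneg (two_sub_two_cos_nonneg _) _)
      (Real.rpow_nonneg (two_sub_two_cos_nonneg _) _))) hi'] at h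
  have hae : ∀ᵐ t : ℝ, t ∈ Set.uIoc 0 (2 * Real.pi) → evC t f = 0 := by
    have h1 := (ae_restrict_iff' measurableSet_Ioc).1 h
    filter_upwards [h1, ae_sin_ne_zero] with t ht hs hmem
    rw [Set.uIoc_of_le (by positivity)] at hmem
    have h2 := ht hmem
    simp only [Pi.zero_apply] at h2
    have h3 : 0 < w t := mul_pos (Real.rpow_pos_of_pos (two_sub_two_cos_pos hs) _)
      (Real.rpow_pos_of_pos (two_sub_two_cos_two_mul_pos hs) _)
    exact Complex.normSq_eq_zero.1 ((mul_eq_zero.1 h2).resolve_right h3.ne')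
  ext n
  have h4 : ∫ t in (0 : ℝ)..(2 * Real.pi), evC t (LaurentPolynomial.T (-n) * f) =
      ∫ t in (0 : ℝ)..(2 * Real.pi), (0 : ℂ) := by
    refine intervalIntegral.integral_congr_ae (hae.mono fun t ht hmem => ?_)
    rw [map_mul, ht hmem, mul_zero]
  rw [integral_evC, intervalIntegral.integral_zero] at h4
  have h5 : (2 * Real.pi : ℂ) ≠ 0 := by
    exact_mod_cast Real.two_pi_pos.ne'
  exact (mul_eq_zero.1 h4).resolve_left h5

/-! ### The Gram-Schmidt process -/

theorem isLead_gramSchmidt (k : Mult) (j : ℕ) : IsLead (expo j) 1 (incl (gramSchmidt k j)) := by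
  induction j using Nat.strong_induction_on with
  | _ j ih =>
    have e : incl (gramSchmidt k j) - (1 : ℂ) • zp (expo j) = -∑ i : Fin j,
        (pairing k (gramSchmidt k i) (LaurentPolynomial.T (expo j)) /
          pairing k (gramSchmidt k i) (gramSchmidt k i)) • incl (gramSchmidt k i) := by
      rw [gramSchmidt, map_sub, map_sum, one_smul]
      simp only [map_smul]
      rw [zp]
      abel
    unfold IsLead
    rw [e, pos_expo]
    refine neg_mem (Submodule.sum_mem _ fun i _ => Submodule.smul_mem _ _ ?_)
    have h := (ih i i.2).mem_V
    rw [pos_expo] at h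
    exact V_mono i.2 h

theorem IsLead.ne_zero {n : ℤ} {f : Laurent} (h : IsLead n 1 (incl f)) : f ≠ 0 := by
  rintro rfl
  unfold IsLead at h
  rw [map_zero, zero_sub, ← neg_smul] at h
  simpa using eq_zero_of_smul_zp_mem_V h

theorem gramSchmidt_self_ne_zero {k : ℝ × ℝ} (hk : Convergent (realMult k)) (j : ℕ) :
    pairing (realMult k) (gramSchmidt (realMult k) j) (gramSchmidt (realMult k) j) ≠ 0 :=
  fun h => (isLead_gramSchmidt (realMult k) j).ne_zero (eq_zero_of_pairing_self hk h)

theorem pairing_eq_zero_comm {k : ℝ × ℝ} {f g : Laurent} (h : pairing (realMult k) f g = 0) :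
    pairing (realMult k) g f = 0 := by
  have e := conj_pairing (realMult k) f g
  rw [h, conjMult_realMult, map_zero] at e
  exact e.symm

theorem gramSchmidt_orthogonal {k : ℝ × ℝ} (hk : Convergent (realMult k)) (j : ℕ) :
    ∀ i < j, pairing (realMult k) (gramSchmidt (realMult k) i) (gramSchmidt (realMult k) j) = 0 := by
  induction j using Nat.strong_induction_on with
  | _ j ih =>
    intro i hi
    rw [gramSchmidt.eq_def _ j, pairing_sub_right hk, pairing_sum_right hk,
      Finset.sum_eq_single (⟨i, hi⟩ : Fin j)]
    · rw [pairing_smul_right, div_mul_cancel₀ _ (gramSchmidt_self_ne_zero hk i), sub_self]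
    · intro i' _ hne
      rw [pairing_smul_right]
      have hne' : (i' : ℕ) ≠ i := fun h => hne (Fin.ext h)
      rcases lt_or_gt_of_ne hne' with h | h
      · rw [pairing_eq_zero_comm (ih i hi i' h), mul_zero]
      · rw [ih i' i'.2 i h, mul_zero]
    · intro h
      exact absurd (Finset.mem_univ _) h

theorem pairing_gramSchmidt_eq_zero {k : ℝ × ℝ} (hk : Convergent (realMult k)) {j m : ℕ}
    (hm : m ≤ j) {r : Laurent} (hr : incl r ∈ V m) :
    pairing (realMult k) (gramSchmidt (realMult k) j) r = 0 := by
  induction m generalizing r with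
  | zero =>
    rw [mem_V_zero, ← map_zero incl, incl_inj] at hr
    rw [hr, pairing_zero_right]
  | succ m ih =>
    obtain ⟨c, hc⟩ := exists_isLead_of_mem_V_succ hr
    have h := isLead_gramSchmidt (realMult k) m
    have h2 : incl (r - c • gramSchmidt (realMult k) m) ∈ V m := by
      have e : incl (r - c • gramSchmidt (realMult k) m) = (incl r - c • zp (expo m)) -
          c • (incl (gramSchmidt (realMult k) m) - (1 : ℂ) • zp (expo m)) := by
        rw [map_sub, map_smul]
        module
      unfold IsLead at hc h
      rw [pos_expo] at hc h
      rw [e]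
      exact sub_mem hc (Submodule.smul_mem _ _ h)
    have h3 := ih (by omega) h2
    rw [pairing_sub_right hk, pairing_smul_right,
      pairing_eq_zero_comm (gramSchmidt_orthogonal hk j m (by omega)), mul_zero, sub_zero] at h3
    exact h3

theorem cherednik_gramSchmidt {k : ℝ × ℝ} (hk : Convergent (realMult k)) (j : ℕ) :
    cherednik (realMult k) (incl (gramSchmidt (realMult k) j)) =
      tilde (expo j) (realMult k) • incl (gramSchmidt (realMult k) j) := by
  set K := realMult k
  set G := gramSchmidt K j
  have hL := isLead_gramSchmidt K j
  have hD := (hasLead_cherednik K).isLead hL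
  rw [label_zero_left, one_mul] at hD
  obtain ⟨H, hH⟩ := (hasLead_cherednik K).map_laurent G
  have hr : incl (H - tilde (expo j) K • G) ∈ V (pos (expo j)) := by
    have e : incl (H - tilde (expo j) K • G) =
        (cherednik K (incl G) - tilde (expo j) K • zp (expo j)) -
          tilde (expo j) K • (incl G - (1 : ℂ) • zp (expo j)) := by
      rw [map_sub, map_smul, ← hH]
      module
    rw [e]
    exact sub_mem hD (Submodule.smul_mem _ _ hL)
  set r := H - tilde (expo j) K • G with hrdef
  obtain ⟨F, hF⟩ := (hasLead_cherednik K).map_laurent r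
  have hFV : incl F ∈ V (pos (expo j)) := by
    rw [← hF]
    exact (hasLead_cherednik K).map_V hr
  rw [pos_expo] at hFV hr
  have h1 : pairing K r H = pairing K F G :=
    (pairing_cherednik hk (by rw [conjMult_realMult]; exact hF.symm) hH.symm).symm
  have h2 : pairing K F G = 0 :=
    pairing_eq_zero_comm (pairing_gramSchmidt_eq_zero hk le_rfl hFV)
  have h3 : pairing K r G = 0 :=
    pairing_eq_zero_comm (pairing_gramSchmidt_eq_zero hk le_rfl hr)
  have h4 : pairing K r r = 0 := by
    nth_rw 2 [hrdef]
    rw [pairing_sub_right hk, pairing_smul_right, h1, h2, h3, mul_zero, sub_zero]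
  have h5 := eq_zero_of_pairing_self hk h4
  rw [hrdef, sub_eq_zero] at h5
  rw [hH, h5, map_smul]

theorem isJacobiE_jacobiE {k : ℝ × ℝ} (hk : Convergent (realMult k)) (n : ℤ) :
    IsJacobiE n (realMult k) (jacobiE n (realMult k)) := by
  have hL := isLead_gramSchmidt (realMult k) (pos n)
  rw [expo_pos] at hL
  have hc : ∀ m, (jacobiE n (realMult k) - (1 : ℂ) • LaurentPolynomial.T n).coeff m ≠ 0 →
      pos m < pos n := by
    rw [← incl_mem_V, map_sub, map_smul]
    exact hL
  refine ⟨?_, fun m hm => ?_, ?_⟩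
  · by_contra h
    refine lt_irrefl _ (hc n ?_)
    simpa [sub_eq_zero] using h
  · by_cases e : m = n
    · rw [e]
    · refine (hc m ?_).le
      simpa [Ne.symm e] using hm
  · have h := cherednik_gramSchmidt hk (pos n)
    rwa [expo_pos] at h

theorem Convergent.generic {k : ℝ × ℝ} (hk : Convergent (realMult k)) : Generic (realMult k) := by
  intro j hj
  rw [convergent_iff] at hk
  have h := congrArg Complex.re hj
  simp [realMult] at h hk
  have : (0 : ℝ) ≤ j := j.cast_nonneg
  linarith [hk.1, hk.2]

theorem shiftBy_realMult (k : ℝ × ℝ) (l : ℤ × ℤ) :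
    shiftBy (realMult k) l = realMult (k.1 + l.1, k.2 + l.2) := by simp [shiftBy, realMult]

end

end JacobiBC1

theorem mainTheorem11 (l : ℤ × ℤ) (hl : Even l.1) (p : Polynomial ℂ) :
    -- `𝒢(ℓ, k) p(D_k)` is a non-symmetric shift operator with shift `ℓ`
    (∀ k : Mult, IsNonsymShiftOp l k (shiftOp l k p)) ∧
    -- (i) the action on the Gram-Schmidt polynomials for real `k`
    (∀ k : ℝ × ℝ, Convergent (realMult k) → Convergent (shiftBy (realMult k) l) →
      ∀ n : ℤ, shiftOp l (realMult k) p (incl (jacobiE n (realMult k))) =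
        if 0 ≤ |n| - rhoZ l then
          eta l n (realMult k) p •
            incl (jacobiE (label (rhoZ l) n) (shiftBy (realMult k) l))
        else 0) ∧
    -- (i) the action for complex `k`
    (∀ k : Mult, Generic k → Generic (shiftBy k l) →
      ∀ (n : ℤ) (E : Laurent), IsJacobiE n k E →
        (0 ≤ |n| - rhoZ l → ∀ E' : Laurent, IsJacobiE (label (rhoZ l) n) (shiftBy k l) E' →
          shiftOp l k p (incl E) = eta l n k p • incl E') ∧
        (|n| - rhoZ l < 0 → shiftOp l k p (incl E) = 0)) ∧
    -- (ii) the formal adjoint; for real `k` one has `conjMult k = k`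
    (∀ k : Mult, Convergent k → Convergent (shiftBy k l) →
      ∀ f g F H : Laurent,
        incl F = shiftOp l k p (incl f) →
        incl H = shiftOp (-l) (shiftBy (conjMult k) l) (p.map (starRingEnd ℂ)) (incl g) →
        pairing (shiftBy (conjMult k) l) F g = pairing (conjMult k) f H) := by
  refine ⟨fun k => isNonsymShiftOp_shiftOp hl k p, ?_, ?_, ?_⟩
  · intro k h0 h1 n
    have hE := isJacobiE_jacobiE h0 n
    have h2 := h1
    rw [shiftBy_realMult] at h2
    split_ifs with hn
    · refine shiftOp_apply_jacobi hl p ?_ hE hn ?_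
      · rw [shiftBy_realMult]
        exact h2.generic
      · rw [shiftBy_realMult]
        exact isJacobiE_jacobiE h2 _
    · exact shiftOp_apply_jacobi_eq_zero p hE (not_le.1 hn)
  · intro k _ h1 n E hE
    exact ⟨fun hn E' hE' => shiftOp_apply_jacobi hl p h1 hE hn hE',
      fun hn => shiftOp_apply_jacobi_eq_zero p hE hn⟩
  · intro k h0 h1 f g F H hF hH
    exact isAdj_shiftOp hl p h0 h1 f g F H hF hH
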